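/- **Definitions.** For $n\ge 4$ the wheel $W_n$ has vertices $1,\dots,n$, spokes $(i,n)$ for $1\le i\le n-1$, and rim edges $(i,i+1)$ for $1\le i\le n-2$ and $(1,n-1)$; $n$ is its hub. A graph is a matching if no two of its edges share an end-vertex. A *plane $st$-graph* on $V\cup\{s,t\}$ is an acyclic digraph with unique source $s$, unique sink $t$ and an edge $(s,t)$, together with a planar embedding that has $s$ and $t$ on the outer face. Let $G_r$ and $G_b$ be plane $st$-graphs on $V\cup\{s_r,t_r\}$ and $V\cup\{s_b,t_b\}$, and let $\Phi$ assign to each $v\in V$ one of the four rotations of an L-shape; the first rotation is the letter L, whose corner is at the lower left. A *$\Phi$-LSVR* of $\langle G_r,G_b\rangle$ consists, for some $\varepsilon>0$, of a representation of $G_r$ by disjoint horizontal bars and one of $G_b$ by disjoint vertical bars, both preserving the embeddings. Two bars of the same representation are joined by a visibility segment of thickness $\varepsilon$ that meets no other bar of that representation if and only if the corresponding vertices are adjacent; the edges of $G_r$ go from bottom to top, those of $G_b$ from left to right. For each $v\in V$ the two bars of $v$ share an end-point and form an L-shape with rotation $\Phi(v)$, no two L-shapes intersect, and the bars of $s_r,t_r,s_b,t_b$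 lie at the bottommost, topmost, leftmost and rightmost side, respectively. A *$\Phi$-transversal* of $\langle G_r,G_b\rangle$ is a drawing on $V\cup\{s_r,t_r,s_b,t_b\}$ consisting of the edges of $G_r$ (red), the edges of $G_b$ (blue), and the uncrossed special edges $(s_r,s_b),(s_b,t_r),(t_r,t_b),(t_b,s_r)$, which form the outer face in clockwise order, such that the red edges and the blue edges realize the embeddings of $G_r$ and $G_b$; the edges around each $v\in V$ form four non-empty blocks (red outgoing, red incoming, blue outgoing, blue incoming) in the clockwise order that $\Phi(v)$ prescribes (for the first rotation: red out, red in, blue in, blue out); and edges cross only if one is red and the other is blue, at most once, with the blue edge crossing the red edge from left to right. A *simultaneous RAC embedding* of two graphs on the same vertex set is a pair of planar drawings with the same vertex positions in which edges of different graphs meet, except at common end-vertices, only in crossings at right angles. **Theorem.** Let $n\ge 4$, and let $M$ be a matching on the vertices of the wheel $W_n$. Let $\Phi$ be constantly the first rotation. Then: 1. There are plane $st$-graphs $G_r$ and $G_b$ on the vertex set $\{1,\dots,n\}$ augmented with distinct dummy sources and sinks such that $\langle G_r,G_b\rangle$ admits a $\Phi$-transversal and a $\Phi$-LSVR, and such that,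 after deletion of the dummy vertices and of the directions, $G_r$ becomes exactly $W_n$ and $G_b$ becomes exactly $M$; if the hub is the only vertex that $M$ leaves unmatched, then $G_b$ is allowed to become $M$ plus one further edge incident to the hub. 2. $W_n$ and $M$ have a simultaneous RAC embedding with polygonal edges in which every wheel edge has at most two bends and the matching edges have no bends. -/

import Mathlib

/-! ## Graphs -/

namespace SimVis

/-- The wheel `W_n` on `n` vertices. The vertex called `i + 1` in the usual labelling `1, …, n` is
`i : Fin n`; the hub is the last vertex, the rim is the cycle through all the others. -/
def wheel (n : ℕ) : SimpleGraph (Fin n) :=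
  SimpleGraph.fromRel fun i j : Fin n =>
    (j : ℕ) + 1 = n ∨
    ((j : ℕ) = (i : ℕ) + 1 ∧ (j : ℕ) + 1 < n) ∨
    ((i : ℕ) = 0 ∧ (j : ℕ) + 2 = n)

/-- A graph is a matching if no two of its edges share an end-vertex. -/
def IsMatchingGraph {V : Type*} (M : SimpleGraph V) : Prop :=
  ∀ v, (M.neighborSet v).Subsingleton

/-- The vertex set `V ∪ {s, t}`: `V` with a dummy source and a dummy sink. -/
inductive StVertex (V : Type*) where
  | source : StVertex V
  | sink : StVertex V
  | inner : V → StVertex V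

/-- `E` is the edge relation of an `st`-graph on `V ∪ {s, t}`: it is acyclic, `s` is its only
source, `t` is its only sink, and it contains the edge `(s, t)`. -/
def IsStGraph {V : Type*} (E : StVertex V → StVertex V → Prop) : Prop :=
  (∀ v, ¬ Relation.TransGen E v v) ∧
  (∀ v, (∀ u, ¬ E u v) ↔ v = StVertex.source) ∧
  (∀ v, (∀ u, ¬ E v u) ↔ v = StVertex.sink) ∧
  E StVertex.source StVertex.sink

/-! ## Polygonal arcs in the plane `ℂ` -/

/-- The point set of the polygonal path through the listed points. -/
def trace : List ℂ → Set ℂ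
  | [] => ∅
  | [a] => {a}
  | a :: b :: l => segment ℝ a b ∪ trace (b :: l)

/-- The polygonal path does not meet itself: it is a Jordan arc. -/
def SimpleArc : List ℂ → Prop
  | [] => True
  | [_] => True
  | a :: b :: l =>
      a ≠ b ∧ (∀ z ∈ segment ℝ a b, z ∈ trace (b :: l) → z = b) ∧ SimpleArc (b :: l)

/-- The directed segments of the polygonal path, in order. -/
def segs (l : List ℂ) : List (ℂ × ℂ) := l.zip l.tail

/-- The direction in which the path leaves its first point. -/
def firstDir : List ℂ → ℂ
  | a :: b :: _ => b - a
  | _ => 0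

/-- The planar cross product; it is negative if `b` points to the right of `a`. -/
def cross (a b : ℂ) : ℝ := a.re * b.im - a.im * b.re

/-- The point `z` lies strictly to the right of the line directed from `a` to `b`. -/
def RightOf (a b z : ℂ) : Prop := cross (b - a) (z - a) < 0

/-- The angle in `[0, 2π)` by which one has to turn clockwise from direction `d` to direction
`e` (both nonzero). -/
noncomputable def cwAngle (d e : ℂ) : ℝ :=
  if (e / d).arg ≤ 0 then -(e / d).arg else 2 * Real.pi - (e / d).arg

/-! ## Drawings -/

/-- A polygonal drawing: positions of the vertices and, for an edge from `u` to `v`, the list of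
its bends, in the order from `u` to `v`. -/
structure PolyDrawing (W : Type*) where
  pos : W → ℂ
  bends : W → W → List ℂ

namespace PolyDrawing

variable {W : Type*} (D : PolyDrawing W)

/-- The polygonal path that represents the edge from `u` to `v`. -/
def path (u v : W) : List ℂ := D.pos u :: (D.bends u v ++ [D.pos v])

/-- The direction at `v` of the edge from `v` to `w`. -/
def outDir (v w : W) : ℂ := firstDir (D.path v w)

/-- The direction at `v` of the edge from `u` to `v`. -/
def inDir (u v : W) : ℂ := firstDir (D.path u v).reverse

/-- The drawing, restricted to the edges in `E`, is planar: vertices are distinct points, edges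
are Jordan arcs that contain no vertices but their end-vertices, and two distinct edges have no
points in common but common end-vertices. -/
def IsPlanar (E : W → W → Prop) : Prop :=
  Function.Injective D.pos ∧
  (∀ u v, E u v → SimpleArc (D.path u v)) ∧
  (∀ u v w, E u v → D.pos w ∈ trace (D.path u v) → w = u ∨ w = v) ∧
  (∀ u v u' v', E u v → E u' v' → s(u, v) ≠ s(u', v') →
    ∀ z ∈ trace (D.path u v), z ∈ trace (D.path u' v') → ∃ w, z = D.pos w)

end PolyDrawing

/-- The drawing `D` of the `st`-graph `E` has the following left-to-right orders: `outLeft v a b`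
says that, among the edges leaving `v`, the edge to `a` is to the left of the edge to `b`;
`inLeft v a b` says that, among the edges entering `v`, the edge from `a` is to the left of the
edge from `b`. Clockwise around an inner vertex one meets the leaving edges from left to right and
then the entering edges from right to left. At the source and at the sink the circular order is
cut open at the outer face, into which the directions `ds` and `dt` point. -/
def HasLeftRightOrders {V : Type*} (D : PolyDrawing (StVertex V))
    (E : StVertex V → StVertex V → Prop)
    (outLeft inLeft : StVertex V → StVertex V → StVertex V → Prop) (ds dt : ℂ) : Prop :=
  (∀ a b, E .source a → E .source b →
    (outLeft .source a b ↔ cwAngle ds (D.outDir .source a) < cwAngle ds (D.outDir .source b))) ∧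
  (∀ a b, E a .sink → E b .sink →
    (inLeft .sink a b ↔ cwAngle dt (D.inDir b .sink) < cwAngle dt (D.inDir a .sink))) ∧
  (∀ v : V, ∃ d : ℂ, d ≠ 0 ∧
    (∀ a b, E (.inner v) a → E b (.inner v) →
      cwAngle d (D.outDir (.inner v) a) < cwAngle d (D.inDir b (.inner v))) ∧
    (∀ a b, E (.inner v) a → E (.inner v) b →
      (outLeft (.inner v) a b ↔
        cwAngle d (D.outDir (.inner v) a) < cwAngle d (D.outDir (.inner v) b))) ∧
    (∀ a b, E a (.inner v) → E b (.inner v) →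
      (inLeft (.inner v) a b ↔
        cwAngle d (D.inDir b (.inner v)) < cwAngle d (D.inDir a (.inner v)))))

/-- A plane `st`-graph on `V ∪ {s, t}`. Its planar embedding (with `s` and `t` on the outer face)
is recorded by the left-to-right orders of the edges leaving and of the edges entering each vertex.
These orders come from a planar drawing with `s` and `t` on the outer face; such a drawing can be
taken with `s` as its lowest and `t` as its highest point. The values of `outLeft` and `inLeft` on
non-edges are irrelevant. -/
structure PlaneStGraph (V : Type*) where
  E : StVertex V → StVertex V → Prop
  outLeft : StVertex V → StVertex V → StVertex V → Prop
  inLeft : StVertex V → StVertex V → StVertex V → Prop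
  isStGraph : IsStGraph E
  planar : ∃ D : PolyDrawing (StVertex V), D.IsPlanar E ∧
    (∀ u v, E u v → ∀ z ∈ trace (D.path u v),
      (z ≠ D.pos .source → (D.pos .source).im < z.im) ∧
      (z ≠ D.pos .sink → z.im < (D.pos .sink).im)) ∧
    HasLeftRightOrders D E outLeft inLeft (-Complex.I) Complex.I

/-- The undirected graph on `V` that remains when the dummy source and sink are removed and the
directions are forgotten. -/
def PlaneStGraph.skeleton {V : Type*} (G : PlaneStGraph V) : SimpleGraph V :=
  SimpleGraph.fromRel fun u v => G.E (.inner u) (.inner v)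

/-! ## L-shapes and the transversal structure -/

/-- The four rotations of an L-shape, named by the position of its corner; the first one is the
letter L itself. -/
inductive Rotation where
  | lowerLeft
  | lowerRight
  | upperRight
  | upperLeft

/-- The listed sets of directions are nonempty and form consecutive blocks in clockwise order,
starting from direction `d`. -/
def ClockwiseBlocks (d : ℂ) (L : List (Set ℂ)) : Prop :=
  (∀ A ∈ L, A.Nonempty) ∧
  L.Pairwise fun A B => ∀ a ∈ A, ∀ b ∈ B, cwAngle d a < cwAngle d b

/-- The clockwise order of the four blocks of edges at a vertex: red out (`ro`), red in (`ri`),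
blue out (`bo`), blue in (`bi`). -/
def Rotation.blocks (ro ri bo bi : Set ℂ) : Rotation → List (Set ℂ)
  | .lowerLeft => [ro, ri, bi, bo]
  | .lowerRight => [ri, ro, bi, bo]
  | .upperRight => [ri, ro, bo, bi]
  | .upperLeft => [ro, ri, bo, bi]

/-- A (4-polar) `Φ`-transversal of the pair of plane `st`-graphs `Gr` (red) and `Gb` (blue). It is
a drawing on the vertex set `V ∪ {s_r, t_r, s_b, t_b}`, given by its red part `R` and its blue
part `B`. The four special edges are drawn straight, as a convex quadrilateral. -/
structure IsTransversal {V : Type*} (Gr Gb : PlaneStGraph V) (Φ : V → Rotation)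
    (R B : PolyDrawing (StVertex V)) : Prop where
  same_pos : ∀ v : V, R.pos (.inner v) = B.pos (.inner v)
  /-- Edges of the same color do not cross. -/
  red_planar : R.IsPlanar Gr.E
  blue_planar : B.IsPlanar Gb.E
  /-- The special edges form, in clockwise order, the convex quadrilateral `s_r s_b t_r t_b`. -/
  convex : ∀ s_r s_b t_r t_b : ℂ, s_r = R.pos .source → s_b = B.pos .source →
    t_r = R.pos .sink → t_b = B.pos .sink →
    (RightOf s_r s_b t_r ∧ RightOf s_r s_b t_b) ∧ (RightOf s_b t_r t_b ∧ RightOf s_b t_r s_r) ∧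
    (RightOf t_r t_b s_r ∧ RightOf t_r t_b s_b) ∧ (RightOf t_b s_r s_b ∧ RightOf t_b s_r t_r)
  /-- The rest of the drawing lies inside that quadrilateral, so that the latter bounds the outer
  face and is not crossed. -/
  inside : ∀ u v z, (Gr.E u v ∧ z ∈ trace (R.path u v)) ∨ (Gb.E u v ∧ z ∈ trace (B.path u v)) →
    (z = R.pos .source ∨ z = R.pos .sink ∨ z = B.pos .source ∨ z = B.pos .sink) ∨
    (RightOf (R.pos .source) (B.pos .source) z ∧ RightOf (B.pos .source) (R.pos .sink) z ∧
      RightOf (R.pos .sink) (B.pos .sink) z ∧ RightOf (B.pos .sink) (R.pos .source) z)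
  /-- The restrictions to red and to blue edges realize the embeddings of `Gr` and `Gb`. -/
  red_embedding : HasLeftRightOrders R Gr.E Gr.outLeft Gr.inLeft
    (B.pos .source - R.pos .source) (B.pos .sink - R.pos .sink)
  blue_embedding : HasLeftRightOrders B Gb.E Gb.outLeft Gb.inLeft
    (R.pos .sink - B.pos .source) (R.pos .source - B.pos .sink)
  /-- The edges at each vertex form four nonempty blocks, in the order prescribed by `Φ`. -/
  blocks : ∀ v : V, ∃ d : ℂ, d ≠ 0 ∧ ClockwiseBlocks d ((Φ v).blocks
    {e | ∃ w, Gr.E (.inner v) w ∧ e = R.outDir (.inner v) w}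
    {e | ∃ w, Gr.E w (.inner v) ∧ e = R.inDir w (.inner v)}
    {e | ∃ w, Gb.E (.inner v) w ∧ e = B.outDir (.inner v) w}
    {e | ∃ w, Gb.E w (.inner v) ∧ e = B.inDir w (.inner v)})
  /-- A point common to a red and a blue edge is a vertex, or a proper crossing (not at a bend),
  in which the blue edge crosses the red edge from left to right. -/
  crossings : ∀ u v u' v', Gr.E u v → Gb.E u' v' →
    ∀ z ∈ trace (R.path u v), z ∈ trace (B.path u' v') →
      (∃ w : V, z = R.pos (.inner w)) ∨
      ∃ p ∈ segs (R.path u v), ∃ q ∈ segs (B.path u' v'),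
        z ∈ openSegment ℝ p.1 p.2 ∧ z ∈ openSegment ℝ q.1 q.2 ∧
        cross (p.2 - p.1) (q.2 - q.1) < 0
  /-- A red and a blue edge cross at most once. -/
  cross_once : ∀ u v u' v', Gr.E u v → Gb.E u' v' →
    {z | z ∈ trace (R.path u v) ∧ z ∈ trace (B.path u' v') ∧
      ∀ w : V, z ≠ R.pos (.inner w)}.Subsingleton

/-- The pair `⟨Gr, Gb⟩` admits a `Φ`-transversal. -/
def AdmitsTransversal {V : Type*} (Gr Gb : PlaneStGraph V) (Φ : V → Rotation) : Prop :=
  ∃ R B : PolyDrawing (StVertex V), IsTransversal Gr Gb Φ R B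

/-! ## Visibility representations -/

/-- Parallel bars, one for each vertex: the bar of `v` is the interval `[lo v, hi v]` placed at
level `level v`. For an edge from `u` to `v`, the visibility segment joining the two bars starts
at coordinate `win u v`. -/
structure BarRep (W : Type*) where
  level : W → ℝ
  lo : W → ℝ
  hi : W → ℝ
  win : W → W → ℝ

namespace BarRep

variable {W : Type*} (Γ : BarRep W)

/-- The bar of `u` lies below the bar of `v`, and the two are joined by a visibility segment of
thickness `ε` that occupies the coordinates `[c, c + ε]` and meets no other bar. -/
def Visible (ε : ℝ) (u v : W) (c : ℝ) : Prop :=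
  Γ.level u < Γ.level v ∧
  Set.Icc c (c + ε) ⊆ Set.Icc (Γ.lo u) (Γ.hi u) ∧
  Set.Icc c (c + ε) ⊆ Set.Icc (Γ.lo v) (Γ.hi v) ∧
  ∀ w, w ≠ u → w ≠ v → Γ.level u ≤ Γ.level w → Γ.level w ≤ Γ.level v →
    Disjoint (Set.Icc c (c + ε)) (Set.Icc (Γ.lo w) (Γ.hi w))

/-- `Γ` is a bar visibility representation of the digraph `E`, with visibility segments of
thickness `ε` along which the edges are directed upwards: bars do not overlap, and two bars are
joined by a visibility segment if and only if there is an edge. -/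
def Represents (ε : ℝ) (E : W → W → Prop) : Prop :=
  (∀ v, Γ.lo v < Γ.hi v) ∧
  (∀ u v, u ≠ v → Γ.level u = Γ.level v →
    Disjoint (Set.Icc (Γ.lo u) (Γ.hi u)) (Set.Icc (Γ.lo v) (Γ.hi v))) ∧
  (∀ u v, E u v ↔ ∃ c, Γ.Visible ε u v c) ∧
  (∀ u v, E u v → Γ.Visible ε u v (Γ.win u v))

end BarRep

/-- The L-shape of the vertex `v`: its horizontal bar in `H` together with its vertical bar
in `K`. -/
def lShape {V : Type*} (H K : BarRep (StVertex V)) (v : V) : Set (ℝ × ℝ) :=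
  Set.Icc (H.lo (.inner v)) (H.hi (.inner v)) ×ˢ {H.level (.inner v)} ∪
  {K.level (.inner v)} ×ˢ Set.Icc (K.lo (.inner v)) (K.hi (.inner v))

/-- The bars of `v` in `H` (horizontal) and in `K` (vertical) share the end-point that is the
corner of an L-shape with the given rotation. -/
def HasCorner {V : Type*} (H K : BarRep (StVertex V)) (v : V) : Rotation → Prop
  | .lowerLeft => K.level (.inner v) = H.lo (.inner v) ∧ H.level (.inner v) = K.lo (.inner v)
  | .lowerRight => K.level (.inner v) = H.hi (.inner v) ∧ H.level (.inner v) = K.lo (.inner v)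
  | .upperRight => K.level (.inner v) = H.hi (.inner v) ∧ H.level (.inner v) = K.hi (.inner v)
  | .upperLeft => K.level (.inner v) = H.lo (.inner v) ∧ H.level (.inner v) = K.hi (.inner v)

/-- A `Φ`-LSVR (simultaneous visibility representation with L-shapes rotated as `Φ` says) of the
pair of plane `st`-graphs `⟨Gr, Gb⟩`. The representation `H` of `Gr` has horizontal bars: levels
are `y`-coordinates, positions along bars are `x`-coordinates, and edges go from bottom to top. The
representation `K` of `Gb` has vertical bars: levels are `x`-coordinates, positions along bars are
`y`-coordinates, and edges go from left to right. -/
structure IsLSVR {V : Type*} (Gr Gb : PlaneStGraph V) (Φ : V → Rotation) (ε : ℝ)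
    (H K : BarRep (StVertex V)) : Prop where
  red : H.Represents ε Gr.E
  blue : K.Represents ε Gb.E
  /-- `H` preserves the embedding of `Gr`: left means smaller `x`-coordinate. -/
  red_out : ∀ v a b, Gr.E v a → Gr.E v b → (Gr.outLeft v a b ↔ H.win v a < H.win v b)
  red_in : ∀ v a b, Gr.E a v → Gr.E b v → (Gr.inLeft v a b ↔ H.win a v < H.win b v)
  /-- `K` preserves the embedding of `Gb`: for edges directed to the right, left means larger
  `y`-coordinate. -/
  blue_out : ∀ v a b, Gb.E v a → Gb.E v b → (Gb.outLeft v a b ↔ K.win v b < K.win v a)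
  blue_in : ∀ v a b, Gb.E a v → Gb.E b v → (Gb.inLeft v a b ↔ K.win b v < K.win a v)
  corner : ∀ v, HasCorner H K v (Φ v)
  disjoint : ∀ u v, u ≠ v → Disjoint (lShape H K u) (lShape H K v)
  /-- The bars of the dummy vertices `s_r, t_r, s_b, t_b` are placed at the bottommost, topmost,
  leftmost and rightmost sides of the drawing. -/
  frame : ∀ v : V, H.level .source < K.lo (.inner v) ∧ K.hi (.inner v) < H.level .sink ∧
    K.level .source < H.lo (.inner v) ∧ H.hi (.inner v) < K.level .sink

/-- The pair `⟨Gr, Gb⟩` admits a `Φ`-LSVR. -/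
def AdmitsLSVR {V : Type*} (Gr Gb : PlaneStGraph V) (Φ : V → Rotation) : Prop :=
  ∃ ε : ℝ, 0 < ε ∧ ∃ H K : BarRep (StVertex V), IsLSVR Gr Gb Φ ε H K

/-! ## Simultaneous RAC embeddings -/

/-- The polygonal drawings `R` of `G` and `B` of `G'` form a simultaneous RAC embedding: both are
planar drawings of graphs with the same vertex set, each vertex is the same point in both, and a
point common to an edge of `G` and an edge of `G'` is a vertex or an interior point of a segment of
each of them, where these two segments are perpendicular. -/
structure IsSRE {V : Type*} (G G' : SimpleGraph V) (R B : PolyDrawing V) : Prop where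
  same_pos : R.pos = B.pos
  /-- An edge is the same curve in both of its directions. -/
  red_symm : ∀ u v, R.bends v u = (R.bends u v).reverse
  blue_symm : ∀ u v, B.bends v u = (B.bends u v).reverse
  red_planar : R.IsPlanar G.Adj
  blue_planar : B.IsPlanar G'.Adj
  right_angles : ∀ u v u' v', G.Adj u v → G'.Adj u' v' →
    ∀ z ∈ trace (R.path u v), z ∈ trace (B.path u' v') →
      (∃ w, z = R.pos w) ∨
      ∃ p ∈ segs (R.path u v), ∃ q ∈ segs (B.path u' v'),
        z ∈ openSegment ℝ p.1 p.2 ∧ z ∈ openSegment ℝ q.1 q.2 ∧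
        (p.2 - p.1).re * (q.2 - q.1).re + (p.2 - p.1).im * (q.2 - q.1).im = 0

end SimVis

namespace SimVis

/-! ## Clockwise angles -/

/-! The visibility part is an explicit construction. Single out one rim vertex `root`; the other rim
vertices form a path. The horizontal bar of `root` is a floor at height 0 that hides the hub and the
path from the source, and the hub lies above it at height 4. The path bars, at heights at least 8,
overlap like roof tiles: bar `i` occupies `[4i, 4i + 6]`, so only consecutive bars overlap, and each
keeps a stretch of its own through which it sees the hub below and the sink above. The hub's bar is
a little too short at both ends, so exactly the two ends of the path see `root`. This represents the
wheel for every admissible choice of heights (`Heights.red_represents`).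

The heights are therefore free to encode the matching. A path vertex gets a vertical bar of length 2
at its left end; two of them see each other if and only if their heights differ by 1, all other
differences being at least 3 (`Heights.blue_represents`). The hub's vertical bar spans `[4, 6]`. If
the hub is matched, its partner becomes `root`, with a vertical bar up to 5. If the hub and some rim
vertex are unmatched, that rim vertex becomes `root`, with a bar up to 2. If only the hub is
unmatched, the bar of `root` must reach its partner at height 8; it then passes the hub, which
creates the one additional edge (`exists_wheel_matching`).

A transversal is read off from the bars: vertices sit at the corners of the L-shapes, edges follow
their visibility windows and bend only in thin strips around the bars. Visibility alone yields
planarity (`BarRep.Fits.isPlanar`). Vertical bars are handled as horizontal ones turned by a right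
angle, so the same lemma serves both colors. If the windows of either color avoid the strips of the
other, and strips of different L-shapes are disjoint, then red and blue edges meet only at vertices
or where an upward red segment crosses a rightward blue one (`BarRep.Compatible.common_point`,
`BarRep.Compatible.isTransversal`).

The RAC embedding is a separate drawing (`Rows`). Rim vertex `v` has abscissa `v`, and its row is
shared exactly with its partner, so matching edges between rim vertices are horizontal. Wheel edges
are vertical wherever they pass another vertex's row. The hub lies below all rows, and its straight
matching edge is placed so that it meets no wheel edge except at vertices (`Rows.isSRE`). -/

theorem cross_eq_norm_mul_sin (z w : ℂ) :
    cross z w = ‖z‖ * ‖w‖ * Real.sin (w.arg - z.arg) := by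
  have h (z : ℂ) : z.re = ‖z‖ * Real.cos z.arg ∧ z.im = ‖z‖ * Real.sin z.arg :=
    ⟨(Complex.norm_mul_cos_arg z).symm, (Complex.norm_mul_sin_arg z).symm⟩
  rw [cross, (h z).1, (h z).2, (h w).1, (h w).2, Real.sin_sub]
  ring

theorem im_div_eq (d e : ℂ) : (e / d).im = cross d e / Complex.normSq d := by
  rw [Complex.div_im, cross]; ring

theorem cross_div_div {d : ℂ} (hd : d ≠ 0) (a b : ℂ) :
    cross (a / d) (b / d) = cross a b / Complex.normSq d := by
  have h : Complex.normSq d ≠ 0 := by simpa using hd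
  have h' : Complex.normSq d = d.re * d.re + d.im * d.im := Complex.normSq_apply d
  simp only [cross, Complex.div_re, Complex.div_im]
  field_simp
  rw [h']
  ring

/-- The sine has the sign of its argument on `(-π, π)`; the bound on the difference rules out a jump
of `arg` between the two vectors. -/
theorem arg_lt_arg_iff_cross_neg {z w : ℂ} (hz : z ≠ 0) (hw : w ≠ 0)
    (h : |w.arg - z.arg| < Real.pi) : w.arg < z.arg ↔ cross z w < 0 := by
  have hp : 0 < ‖z‖ * ‖w‖ := by positivity
  obtain ⟨h1, h2⟩ := abs_lt.1 h
  rw [cross_eq_norm_mul_sin]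
  constructor
  · intro hlt
    exact mul_neg_of_pos_of_neg hp (Real.sin_neg_of_neg_of_neg_pi_lt (by linarith) h1)
  · intro hneg
    by_contra hge
    have := Real.sin_nonneg_of_nonneg_of_le_pi (x := w.arg - z.arg) (by linarith) h2.le
    nlinarith

/-- The line through `d` separates two branches of `cwAngle`: values in `(0, π)` on the clockwise
side and, in the next lemma, in `(π, 2π)` on the other. On each branch angles can be compared by the
sign of a cross product. -/
theorem arg_div_of_cross_neg {d e : ℂ} (h : cross d e < 0) :
    d ≠ 0 ∧ e / d ≠ 0 ∧ (e / d).arg < 0 ∧ -Real.pi < (e / d).arg ∧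
      cwAngle d e = -(e / d).arg := by
  have hd : d ≠ 0 := by rintro rfl; simp [cross] at h
  have he : e ≠ 0 := by rintro rfl; simp [cross] at h
  have hlt : (e / d).arg < 0 := by
    rw [Complex.arg_neg_iff, im_div_eq]
    exact div_neg_of_neg_of_pos h (Complex.normSq_pos.2 hd)
  exact ⟨hd, div_ne_zero he hd, hlt, Complex.neg_pi_lt_arg _, by rw [cwAngle, if_pos hlt.le]⟩

theorem arg_div_of_cross_pos {d e : ℂ} (h : 0 < cross d e) :
    d ≠ 0 ∧ e / d ≠ 0 ∧ 0 < (e / d).arg ∧ (e / d).arg < Real.pi ∧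
      cwAngle d e = 2 * Real.pi - (e / d).arg := by
  have hd : d ≠ 0 := by rintro rfl; simp [cross] at h
  have he : e ≠ 0 := by rintro rfl; simp [cross] at h
  have him : 0 < (e / d).im := by
    rw [im_div_eq]
    exact div_pos h (Complex.normSq_pos.2 hd)
  have hpos : 0 < (e / d).arg := by
    refine lt_of_le_of_ne (Complex.arg_nonneg_iff.2 him.le) fun h0 => ?_
    exact him.ne' (Complex.arg_eq_zero_iff.1 h0.symm).2
  have hpi : (e / d).arg < Real.pi := by
    refine lt_of_le_of_ne (Complex.arg_le_pi _) fun h0 => ?_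
    exact him.ne' (Complex.arg_eq_pi_iff.1 h0).2
  exact ⟨hd, div_ne_zero he hd, hpos, hpi, by rw [cwAngle, if_neg (not_le.2 hpos)]⟩

theorem cwAngle_lt_of_cross_neg_of_pos {d a b : ℂ} (ha : cross d a < 0) (hb : 0 < cross d b) :
    cwAngle d a < cwAngle d b := by
  obtain ⟨-, -, -, h1, h2⟩ := arg_div_of_cross_neg ha
  obtain ⟨-, -, -, h3, h4⟩ := arg_div_of_cross_pos hb
  rw [h2, h4]; linarith

theorem cwAngle_lt_iff_of_cross_neg {d a b : ℂ} (ha : cross d a < 0) (hb : cross d b < 0) :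
    cwAngle d a < cwAngle d b ↔ cross a b < 0 := by
  obtain ⟨hd, ha0, ha1, ha2, ha3⟩ := arg_div_of_cross_neg ha
  obtain ⟨-, hb0, hb1, hb2, hb3⟩ := arg_div_of_cross_neg hb
  rw [ha3, hb3, neg_lt_neg_iff, arg_lt_arg_iff_cross_neg ha0 hb0, cross_div_div hd,
    div_lt_iff₀ (Complex.normSq_pos.2 hd), zero_mul]
  exact abs_lt.2 ⟨by linarith, by linarith⟩

theorem cwAngle_lt_iff_of_cross_pos {d a b : ℂ} (ha : 0 < cross d a) (hb : 0 < cross d b) :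
    cwAngle d a < cwAngle d b ↔ cross a b < 0 := by
  obtain ⟨hd, ha0, ha1, ha2, ha3⟩ := arg_div_of_cross_pos ha
  obtain ⟨-, hb0, hb1, hb2, hb3⟩ := arg_div_of_cross_pos hb
  rw [ha3, hb3, sub_lt_sub_iff_left, arg_lt_arg_iff_cross_neg ha0 hb0, cross_div_div hd,
    div_lt_iff₀ (Complex.normSq_pos.2 hd), zero_mul]
  exact abs_lt.2 ⟨by linarith, by linarith⟩

/-- Needed to transfer circular orders to the blue drawing, which is a turned copy of a drawing with
horizontal bars. -/
theorem cwAngle_mul_left {w : ℂ} (hw : w ≠ 0) (d e : ℂ) :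
    cwAngle (w * d) (w * e) = cwAngle d e := by
  simp only [cwAngle, mul_div_mul_left e d hw]

/-! ## Polygonal paths -/

theorem mem_segment_iff {a b z : ℂ} : z ∈ segment ℝ a b ↔
    ∃ t : ℝ, 0 ≤ t ∧ t ≤ 1 ∧ z.re = a.re + t * (b.re - a.re) ∧
      z.im = a.im + t * (b.im - a.im) := by
  rw [segment_eq_image']
  constructor
  · rintro ⟨t, ⟨h0, h1⟩, rfl⟩
    exact ⟨t, h0, h1, by simp, by simp⟩
  · rintro ⟨t, h0, h1, hr, hi⟩
    exact ⟨t, ⟨h0, h1⟩, by apply Complex.ext <;> simp [hr, hi]⟩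

theorem mem_openSegment_iff {a b z : ℂ} : z ∈ openSegment ℝ a b ↔
    ∃ t : ℝ, 0 < t ∧ t < 1 ∧ z.re = a.re + t * (b.re - a.re) ∧
      z.im = a.im + t * (b.im - a.im) := by
  rw [openSegment_eq_image']
  constructor
  · rintro ⟨t, ⟨h0, h1⟩, rfl⟩
    exact ⟨t, h0, h1, by simp, by simp⟩
  · rintro ⟨t, h0, h1, hr, hi⟩
    exact ⟨t, ⟨h0, h1⟩, by apply Complex.ext <;> simp [hr, hi]⟩

theorem mem_trace_two {a b z : ℂ} : z ∈ trace [a, b] ↔ z ∈ segment ℝ a b := by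
  simp only [trace, Set.mem_union, Set.mem_singleton_iff, or_iff_left_iff_imp]
  rintro rfl
  exact right_mem_segment ℝ a z

theorem mem_trace_three {a b c z : ℂ} :
    z ∈ trace [a, b, c] ↔ z ∈ segment ℝ a b ∨ z ∈ segment ℝ b c := by
  rw [← mem_trace_two (a := b)]
  simp only [trace, Set.mem_union]

theorem mem_trace_four {a b c d z : ℂ} : z ∈ trace [a, b, c, d] ↔
    z ∈ segment ℝ a b ∨ z ∈ segment ℝ b c ∨ z ∈ segment ℝ c d := by
  rw [← mem_trace_three (a := b)]
  simp only [trace, Set.mem_union]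

theorem simpleArc_two {a b : ℂ} : SimpleArc [a, b] ↔ a ≠ b := by
  simp only [SimpleArc, trace, and_true, Set.mem_singleton_iff]
  exact ⟨fun h => h.1, fun h => ⟨h, fun _ _ h => h⟩⟩

theorem simpleArc_three {a b c : ℂ} : SimpleArc [a, b, c] ↔ a ≠ b ∧ b ≠ c ∧
    ∀ z ∈ segment ℝ a b, z ∈ segment ℝ b c → z = b := by
  rw [SimpleArc, simpleArc_two]
  simp only [mem_trace_two]
  tauto

theorem simpleArc_four {a b c d : ℂ} : SimpleArc [a, b, c, d] ↔ a ≠ b ∧ b ≠ c ∧ c ≠ d ∧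
    (∀ z ∈ segment ℝ a b, z ∈ segment ℝ b c → z = b) ∧
    (∀ z ∈ segment ℝ b c, z ∈ segment ℝ c d → z = c) ∧
    (∀ z ∈ segment ℝ a b, z ∉ segment ℝ c d) := by
  rw [SimpleArc, simpleArc_three]
  simp only [mem_trace_three]
  constructor
  · rintro ⟨h1, h2, h3, h4, h5⟩
    refine ⟨h1, h3, h4, fun z hz hz' => h2 z hz (.inl hz'), h5, fun z hz hz' => ?_⟩
    -- A point common to the first and the last segment must be `b`; then `b` also lies on both
    -- later segments, which forces `b = c`.
    obtain rfl := h2 z hz (.inr hz')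
    exact h3 (h5 _ (left_mem_segment ℝ _ _) hz')
  · rintro ⟨h1, h2, h3, h4, h5, h6⟩
    exact ⟨h1, fun z hz hz' => hz'.elim (h4 z hz) fun h => absurd h (h6 z hz), h2, h3, h5⟩

theorem segs_two (a b : ℂ) : segs [a, b] = [(a, b)] := rfl

theorem segs_three (a b c : ℂ) : segs [a, b, c] = [(a, b), (b, c)] := rfl

theorem segs_four (a b c d : ℂ) : segs [a, b, c, d] = [(a, b), (b, c), (c, d)] := rfl

/-- A path with strictly increasing heights cannot return to a height it has left. -/
theorem simpleArc_four_of_im_lt {a b c d : ℂ} (hab : a.im < b.im) (hbc : b.im < c.im)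
    (hcd : c.im < d.im) : SimpleArc [a, b, c, d] := by
  rw [simpleArc_four]
  refine ⟨fun h => hab.ne (by rw [h]), fun h => hbc.ne (by rw [h]),
    fun h => hcd.ne (by rw [h]), ?_, ?_, ?_⟩ <;> intro z hz hz' <;>
    obtain ⟨t, t0, t1, hr, hi⟩ := mem_segment_iff.1 hz <;>
    obtain ⟨s, s0, s1, hr', hi'⟩ := mem_segment_iff.1 hz'
  · obtain rfl : s = 0 := by nlinarith
    apply Complex.ext <;> simp [hr', hi']
  · obtain rfl : s = 0 := by nlinarith
    apply Complex.ext <;> simp [hr', hi']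
  · nlinarith

theorem mem_trace_map_mul {w : ℂ} {l : List ℂ} {z : ℂ} (h : z ∈ trace l) :
    w * z ∈ trace (l.map (w * ·)) := by
  have hseg {a b z : ℂ} (h : z ∈ segment ℝ a b) : w * z ∈ segment ℝ (w * a) (w * b) := by
    obtain ⟨p, q, hp, hq, hpq, rfl⟩ := h
    exact ⟨p, q, hp, hq, hpq, by simp only [Complex.real_smul]; ring⟩
  induction l using trace.induct with
  | case1 => exact h.elim
  | case2 a => rw [Set.mem_singleton_iff.1 h]; exact rfl
  | case3 a b l ih => exact h.elim (fun h => Or.inl (hseg h)) (fun h => Or.inr (ih h))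

theorem mem_trace_map_mul_iff {w : ℂ} (hw : w ≠ 0) {l : List ℂ} {z : ℂ} :
    w * z ∈ trace (l.map (w * ·)) ↔ z ∈ trace l := by
  refine ⟨fun h => ?_, mem_trace_map_mul⟩
  have := mem_trace_map_mul (w := w⁻¹) h
  simpa [Function.comp_def, inv_mul_cancel_left₀ hw] using this

theorem simpleArc_map_mul {w : ℂ} (hw : w ≠ 0) {l : List ℂ} (h : SimpleArc l) :
    SimpleArc (l.map (w * ·)) := by
  induction l using SimpleArc.induct with
  | case1 => trivial
  | case2 a => trivial
  | case3 a b l ih =>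
    obtain ⟨h1, h2, h3⟩ := h
    refine ⟨fun h => h1 (mul_left_cancel₀ hw h), fun z hz hz' => ?_, ih h3⟩
    have e : w * (w⁻¹ * z) = z := mul_inv_cancel_left₀ hw z
    rw [← e, h2 (w⁻¹ * z)]
    · rw [← mem_trace_two, ← mem_trace_map_mul_iff hw, e]
      exact mem_trace_two.2 hz
    · rw [← mem_trace_map_mul_iff hw, e]
      exact hz'

/-! ### Rotated and scaled drawings -/

namespace PolyDrawing

variable {W : Type*}

/-- The image of a drawing under multiplication by `w`. -/
def mul (w : ℂ) (D : PolyDrawing W) : PolyDrawing W where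
  pos v := w * D.pos v
  bends u v := (D.bends u v).map (w * ·)

theorem path_mul (w : ℂ) (D : PolyDrawing W) (u v : W) :
    (D.mul w).path u v = (D.path u v).map (w * ·) := by
  simp [path, mul]

theorem firstDir_map_mul (w : ℂ) (l : List ℂ) :
    firstDir (l.map (w * ·)) = w * firstDir l := by
  rcases l with _ | ⟨a, _ | ⟨b, l⟩⟩ <;> simp [firstDir, mul_sub]

theorem outDir_mul (w : ℂ) (D : PolyDrawing W) (u v : W) :
    (D.mul w).outDir u v = w * D.outDir u v := by
  rw [outDir, path_mul, firstDir_map_mul, outDir]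

theorem inDir_mul (w : ℂ) (D : PolyDrawing W) (u v : W) :
    (D.mul w).inDir u v = w * D.inDir u v := by
  rw [inDir, path_mul, ← List.map_reverse, firstDir_map_mul, inDir]

theorem mem_trace_mul {w : ℂ} (hw : w ≠ 0) {D : PolyDrawing W} {u v : W} {z : ℂ} :
    z ∈ trace ((D.mul w).path u v) ↔ w⁻¹ * z ∈ trace (D.path u v) := by
  rw [path_mul, ← mem_trace_map_mul_iff hw (z := w⁻¹ * z), mul_inv_cancel_left₀ hw]

theorem IsPlanar.mul {w : ℂ} (hw : w ≠ 0) {D : PolyDrawing W} {E : W → W → Prop}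
    (h : D.IsPlanar E) : (D.mul w).IsPlanar E := by
  obtain ⟨h1, h2, h3, h4⟩ := h
  refine ⟨fun u v huv => h1 (mul_left_cancel₀ hw huv), fun u v huv => ?_, ?_, ?_⟩
  · rw [path_mul]
    exact simpleArc_map_mul hw (h2 u v huv)
  · intro u v x huv hx
    rw [mem_trace_mul hw] at hx
    exact h3 u v x huv (by simpa [PolyDrawing.mul, inv_mul_cancel_left₀ hw] using hx)
  · intro u v u' v' huv huv' hne z hz hz'
    rw [mem_trace_mul hw] at hz hz'
    obtain ⟨x, hx⟩ := h4 u v u' v' huv huv' hne _ hz hz'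
    exact ⟨x, by rw [← mul_inv_cancel_left₀ hw z, hx]; rfl⟩

end PolyDrawing

theorem HasLeftRightOrders.mul {V : Type*} {D : PolyDrawing (StVertex V)}
    {E : StVertex V → StVertex V → Prop}
    {outLeft inLeft : StVertex V → StVertex V → StVertex V → Prop} {ds dt w : ℂ} (hw : w ≠ 0)
    (h : HasLeftRightOrders D E outLeft inLeft ds dt) :
    HasLeftRightOrders (D.mul w) E outLeft inLeft (w * ds) (w * dt) := by
  obtain ⟨h1, h2, h3⟩ := h
  simp only [HasLeftRightOrders, PolyDrawing.outDir_mul, PolyDrawing.inDir_mul,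
    cwAngle_mul_left hw]
  refine ⟨h1, h2, fun v => ?_⟩
  obtain ⟨d, hd, h⟩ := h3 v
  refine ⟨w * d, mul_ne_zero hw hd, ?_⟩
  simpa only [cwAngle_mul_left hw] using h

end SimVis
namespace SimVis

/-! ## Drawings from bar representations -/

namespace BarRep

/-- Data that turn bars into a drawing: the vertex `v` is placed at coordinate `anchor v` of its
bar, and its edges bend at the levels `bot v` and `top v` just below and just above the bar. -/
structure Fans (W : Type*) where
  anchor : W → ℝ
  bot : W → ℝ
  top : W → ℝ

/-- The drawing in which each edge runs along its visibility segment, with one bend near each of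
its end-vertices. -/
def drawing {W : Type*} (Γ : BarRep W) (F : Fans W) : PolyDrawing W where
  pos v := ⟨F.anchor v, Γ.level v⟩
  bends u v := [⟨Γ.win u v, F.top u⟩, ⟨Γ.win u v, F.bot v⟩]

/-- The bars `Γ` represent `E`, anchors lie on the bars, and the strips around bars at different
levels do not overlap. -/
structure Fits {W : Type*} (Γ : BarRep W) (F : Fans W) (ε : ℝ) (E : W → W → Prop) : Prop where
  nonneg : 0 ≤ ε
  represents : Γ.Represents ε E
  anchor_mem : ∀ v, F.anchor v ∈ Set.Icc (Γ.lo v) (Γ.hi v)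
  bot_lt : ∀ v, F.bot v < Γ.level v
  lt_top : ∀ v, Γ.level v < F.top v
  sep : ∀ u v, Γ.level u < Γ.level v → F.top u < F.bot v

variable {W : Type*} {Γ : BarRep W} {F : Fans W} {ε : ℝ} {E : W → W → Prop}

namespace Fits

theorem level_lt (h : Γ.Fits F ε E) {u v : W} (huv : E u v) : Γ.level u < Γ.level v :=
  (h.represents.2.2.2 u v huv).1

theorem win_mem_left (h : Γ.Fits F ε E) {u v : W} (huv : E u v) :
    Γ.win u v ∈ Set.Icc (Γ.lo u) (Γ.hi u) :=
  (h.represents.2.2.2 u v huv).2.1 ⟨le_rfl, by linarith [h.nonneg]⟩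

theorem win_mem_right (h : Γ.Fits F ε E) {u v : W} (huv : E u v) :
    Γ.win u v ∈ Set.Icc (Γ.lo v) (Γ.hi v) :=
  (h.represents.2.2.2 u v huv).2.2.1 ⟨le_rfl, by linarith [h.nonneg]⟩

/-- A bar over the window's coordinate at a level between the two ends would obstruct the visibility
segment. All separation arguments below rest on this. -/
theorem level_of_win_mem (h : Γ.Fits F ε E) {u v w : W} (huv : E u v) (hu : w ≠ u) (hv : w ≠ v)
    (hw : Γ.win u v ∈ Set.Icc (Γ.lo w) (Γ.hi w)) :
    Γ.level w < Γ.level u ∨ Γ.level v < Γ.level w := by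
  by_contra! hc
  exact Set.disjoint_left.1 ((h.represents.2.2.2 u v huv).2.2.2 w hu hv hc.1 hc.2)
    ⟨le_rfl, by linarith [h.nonneg]⟩ hw

theorem eq_of_strips (h : Γ.Fits F ε E) {u v : W} {x y : ℝ}
    (hu : x ∈ Set.Icc (Γ.lo u) (Γ.hi u)) (hv : x ∈ Set.Icc (Γ.lo v) (Γ.hi v))
    (hu' : y ∈ Set.Icc (F.bot u) (F.top u)) (hv' : y ∈ Set.Icc (F.bot v) (F.top v)) : u = v := by
  by_contra hne
  rcases lt_trichotomy (Γ.level u) (Γ.level v) with hl | hl | hl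
  · linarith [h.sep u v hl, hu'.2, hv'.1]
  · exact Set.disjoint_left.1 (h.represents.2.1 u v hne hl) hu hv
  · linarith [h.sep v u hl, hu'.1, hv'.2]

/-- If two different upper ends shared a window coordinate, the one that is not higher would
obstruct the other. -/
theorem right_inj (h : Γ.Fits F ε E) {u v v' : W} (huv : E u v) (huv' : E u v')
    (hc : Γ.win u v = Γ.win u v') : v = v' := by
  by_contra hne
  have l1 := h.level_lt huv
  have l2 := h.level_lt huv'
  have r1 := h.level_of_win_mem (w := v') huv (by rintro rfl; linarith) (Ne.symm hne)
    (hc ▸ h.win_mem_right huv')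
  have r2 := h.level_of_win_mem (w := v) huv' (by rintro rfl; linarith) hne
    (hc ▸ h.win_mem_right huv)
  rcases r1 with r1 | r1 <;> rcases r2 with r2 | r2 <;> linarith

theorem left_inj (h : Γ.Fits F ε E) {u u' v : W} (huv : E u v) (huv' : E u' v)
    (hc : Γ.win u v = Γ.win u' v) : u = u' := by
  by_contra hne
  have l1 := h.level_lt huv
  have l2 := h.level_lt huv'
  have r1 := h.level_of_win_mem (w := u') huv (Ne.symm hne) (by rintro rfl; linarith)
    (hc ▸ h.win_mem_left huv')
  have r2 := h.level_of_win_mem (w := u) huv' hne (by rintro rfl; linarith)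
    (hc ▸ h.win_mem_left huv)
  rcases r1 with r1 | r1 <;> rcases r2 with r2 | r2 <;> linarith

/-- The edge from `u` to `v` consists of a segment in the strip around the bar of `u`, of a
vertical segment, and of a segment in the strip around the bar of `v`. -/
theorem mem_trace (h : Γ.Fits F ε E) {u v : W} (huv : E u v) {z : ℂ}
    (hz : z ∈ trace ((Γ.drawing F).path u v)) :
    (∃ t : ℝ, 0 ≤ t ∧ t ≤ 1 ∧ z.re = F.anchor u + t * (Γ.win u v - F.anchor u) ∧
      z.im = Γ.level u + t * (F.top u - Γ.level u)) ∨
    (z.re = Γ.win u v ∧ F.top u ≤ z.im ∧ z.im ≤ F.bot v) ∨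
    (∃ t : ℝ, 0 ≤ t ∧ t ≤ 1 ∧ z.re = F.anchor v + t * (Γ.win u v - F.anchor v) ∧
      z.im = Γ.level v - t * (Γ.level v - F.bot v)) := by
  have hz' : z ∈ trace [⟨F.anchor u, Γ.level u⟩, ⟨Γ.win u v, F.top u⟩, ⟨Γ.win u v, F.bot v⟩,
    ⟨F.anchor v, Γ.level v⟩] := hz
  have hs := h.sep u v (h.level_lt huv)
  rw [mem_trace_four] at hz'
  rcases hz' with hz | hz | hz <;> obtain ⟨t, t0, t1, hr, hi⟩ := mem_segment_iff.1 hz <;>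
    simp only at hr hi
  · exact .inl ⟨t, t0, t1, hr, hi⟩
  · exact .inr (.inl ⟨by linarith, by nlinarith, by nlinarith⟩)
  · exact .inr (.inr ⟨1 - t, by linarith, by linarith, by linarith, by linarith⟩)

theorem fan_mem {a l h' c s t : ℝ} {lo hi : ℝ} (t0 : 0 ≤ t) (t1 : t ≤ 1)
    (ha : a ∈ Set.Icc lo hi) (hc : c ∈ Set.Icc lo hi) (hl : l ∈ Set.Icc h' s)
    {x y : ℝ} {k : ℝ} (hk : k ∈ Set.Icc h' s)
    (hx : x = a + t * (c - a)) (hy : y = l + t * (k - l)) :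
    x ∈ Set.Icc lo hi ∧ y ∈ Set.Icc h' s := by
  obtain ⟨a1, a2⟩ := ha
  obtain ⟨c1, c2⟩ := hc
  obtain ⟨l1, l2⟩ := hl
  obtain ⟨k1, k2⟩ := hk
  subst hx hy
  exact ⟨⟨by nlinarith, by nlinarith⟩, ⟨by nlinarith, by nlinarith⟩⟩

theorem level_mem (h : Γ.Fits F ε E) (v : W) : Γ.level v ∈ Set.Icc (F.bot v) (F.top v) :=
  ⟨(h.bot_lt v).le, (h.lt_top v).le⟩

/-- Coarse version of `mem_trace`: an upper fan, a vertical segment, a lower fan. -/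
theorem mem_trace_coarse (h : Γ.Fits F ε E) {u v : W} (huv : E u v) {z : ℂ}
    (hz : z ∈ trace ((Γ.drawing F).path u v)) :
    (z.re ∈ Set.Icc (Γ.lo u) (Γ.hi u) ∧ z.im ∈ Set.Icc (Γ.level u) (F.top u)) ∨
    (z.re = Γ.win u v ∧ z.im ∈ Set.Icc (F.top u) (F.bot v)) ∨
    (z.re ∈ Set.Icc (Γ.lo v) (Γ.hi v) ∧ z.im ∈ Set.Icc (F.bot v) (Γ.level v)) := by
  rcases h.mem_trace huv hz with ⟨t, t0, t1, hr, hi⟩ | hm | ⟨t, t0, t1, hr, hi⟩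
  · exact .inl (fan_mem t0 t1 (h.anchor_mem u) (h.win_mem_left huv)
      ⟨le_rfl, (h.lt_top u).le⟩ ⟨(h.lt_top u).le, le_rfl⟩ hr hi)
  · exact .inr (.inl hm)
  · exact .inr (.inr (fan_mem (k := F.bot v) t0 t1 (h.anchor_mem v) (h.win_mem_right huv)
      ⟨(h.bot_lt v).le, le_rfl⟩ ⟨le_rfl, (h.bot_lt v).le⟩ hr (by rw [hi]; ring)))

/-- The vertical part of an edge avoids the strips around the bars of the other vertices. -/
theorem vertical_strip (h : Γ.Fits F ε E) {u v w : W} (huv : E u v) (hu : w ≠ u) (hv : w ≠ v)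
    {y : ℝ} (hy : y ∈ Set.Icc (F.top u) (F.bot v)) (hy' : y ∈ Set.Icc (F.bot w) (F.top w))
    (hw : Γ.win u v ∈ Set.Icc (Γ.lo w) (Γ.hi w)) : False := by
  rcases h.level_of_win_mem huv hu hv hw with hl | hl
  · linarith [h.sep w u hl, h.bot_lt u, h.lt_top u, hy.1, hy'.2]
  · linarith [h.sep v w hl, h.bot_lt v, h.lt_top v, hy.2, hy'.1]

/-- Both lower ends lie below the common height `y`, and both upper ends above it. If the lower ends
differed, the one that is not lower would obstruct the other edge; once they agree, `right_inj`
applies. -/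
theorem eq_of_verticals (h : Γ.Fits F ε E) {u v u' v' : W} (huv : E u v) (huv' : E u' v')
    (hc : Γ.win u v = Γ.win u' v') {y : ℝ} (hy : y ∈ Set.Icc (F.top u) (F.bot v))
    (hy' : y ∈ Set.Icc (F.top u') (F.bot v')) : u = u' ∧ v = v' := by
  have a1 := h.lt_top u
  have a2 := h.bot_lt v
  have a3 := h.lt_top u'
  have a4 := h.bot_lt v'
  obtain ⟨y1, y2⟩ := hy
  obtain ⟨y3, y4⟩ := hy'
  have huu : u = u' := by
    by_contra hne
    have r1 := h.level_of_win_mem (w := u') huv (Ne.symm hne) (by rintro rfl; linarith)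
      (hc ▸ h.win_mem_left huv')
    have r2 := h.level_of_win_mem (w := u) huv' hne (by rintro rfl; linarith)
      (hc ▸ h.win_mem_left huv)
    rcases r1 with r1 | r1 <;> rcases r2 with r2 | r2 <;> linarith
  subst huu
  exact ⟨rfl, h.right_inj huv huv' hc⟩

theorem pos_mem (h : Γ.Fits F ε E) (v : W) :
    ((Γ.drawing F).pos v).re ∈ Set.Icc (Γ.lo v) (Γ.hi v) ∧
      ((Γ.drawing F).pos v).im ∈ Set.Icc (F.bot v) (F.top v) :=
  ⟨h.anchor_mem v, h.level_mem v⟩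

/-- Two segments from the apex `(a, l)` to different points at the same height `l + k` meet only at
the apex. -/
theorem eq_pos_of_fans {a l c c' t t' k : ℝ} {z : ℂ} (hk : k ≠ 0) (hc : c ≠ c')
    (hr : z.re = a + t * (c - a)) (hi : z.im = l + t * k)
    (hr' : z.re = a + t' * (c' - a)) (hi' : z.im = l + t' * k) : z = ⟨a, l⟩ := by
  have ht : t = t' := mul_right_cancel₀ hk (by linarith)
  subst ht
  have h0 : t * (c - c') = 0 := by linarith
  have ht : t = 0 := (mul_eq_zero.1 h0).resolve_right (sub_ne_zero.2 hc)
  subst ht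
  apply Complex.ext <;> simp [hr, hi]

/-- The vertical part avoids foreign strips, so it leaves the same bar; it starts at the top of the
strip, which the fan reaches only at its bend, so the two windows coincide. -/
theorem eq_of_upper_fan_of_vertical (h : Γ.Fits F ε E) {u v u' v' : W} (huv : E u v)
    (huv' : E u' v') {t x y : ℝ} (hr : x = F.anchor u + t * (Γ.win u v - F.anchor u))
    (hi : y = Γ.level u + t * (F.top u - Γ.level u)) (hx : x ∈ Set.Icc (Γ.lo u) (Γ.hi u))
    (hy : y ∈ Set.Icc (Γ.level u) (F.top u)) (hx' : x = Γ.win u' v')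
    (hy' : y ∈ Set.Icc (F.top u') (F.bot v')) : u = u' ∧ v = v' := by
  have hu : u = u' := by
    by_contra hne
    refine h.vertical_strip huv' hne ?_ hy' ⟨(h.bot_lt u).le.trans hy.1, hy.2⟩ (hx' ▸ hx)
    rintro rfl
    linarith [hy.1, hy'.2, h.bot_lt u]
  subst hu
  have ht : t = 1 := by
    have hyt : y = F.top u := le_antisymm hy.2 hy'.1
    have h0 : (t - 1) * (F.top u - Γ.level u) = 0 := by linarith
    exact sub_eq_zero.1 ((mul_eq_zero.1 h0).resolve_right (by linarith [h.lt_top u]))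
  subst ht
  exact ⟨rfl, h.right_inj huv huv' (by linarith)⟩

theorem eq_of_lower_fan_of_vertical (h : Γ.Fits F ε E) {u v u' v' : W} (huv : E u v)
    (huv' : E u' v') {t x y : ℝ} (hr : x = F.anchor v + t * (Γ.win u v - F.anchor v))
    (hi : y = Γ.level v - t * (Γ.level v - F.bot v)) (hx : x ∈ Set.Icc (Γ.lo v) (Γ.hi v))
    (hy : y ∈ Set.Icc (F.bot v) (Γ.level v)) (hx' : x = Γ.win u' v')
    (hy' : y ∈ Set.Icc (F.top u') (F.bot v')) : u = u' ∧ v = v' := by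
  have hv : v = v' := by
    by_contra hne
    refine h.vertical_strip huv' ?_ hne hy' ⟨hy.1, hy.2.trans (h.lt_top v).le⟩ (hx' ▸ hx)
    rintro rfl
    linarith [hy.2, hy'.1, h.lt_top v]
  subst hv
  have ht : t = 1 := by
    have hyt : y = F.bot v := le_antisymm hy'.2 hy.1
    have h0 : (t - 1) * (Γ.level v - F.bot v) = 0 := by linarith
    exact sub_eq_zero.1 ((mul_eq_zero.1 h0).resolve_right (by linarith [h.bot_lt v]))
  subst ht
  exact ⟨h.left_inj huv huv' (by linarith), rfl⟩

/-- An upper fan stays at or above its bar and a lower fan at or below. Two that meet share a strip,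
so they meet at bar level, where the lower fan is at its apex. -/
theorem eq_pos_of_upper_lower (h : Γ.Fits F ε E) {u u' v' : W} {s : ℝ} {z : ℂ} (hr' : z.re = F.anchor v' + s * (Γ.win u' v' - F.anchor v'))
    (hi' : z.im = Γ.level v' - s * (Γ.level v' - F.bot v'))
    (hx : z.re ∈ Set.Icc (Γ.lo u) (Γ.hi u)) (hy : z.im ∈ Set.Icc (Γ.level u) (F.top u))
    (hx' : z.re ∈ Set.Icc (Γ.lo v') (Γ.hi v')) (hy' : z.im ∈ Set.Icc (F.bot v') (Γ.level v')) :
    z = (Γ.drawing F).pos u := by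
  obtain rfl := h.eq_of_strips hx hx' ⟨(h.bot_lt u).le.trans hy.1, hy.2⟩
    ⟨hy'.1, hy'.2.trans (h.lt_top v').le⟩
  have h1 : z.im = Γ.level u := le_antisymm hy'.2 hy.1
  have h0 : s * (Γ.level u - F.bot u) = 0 := by linarith
  obtain rfl := (mul_eq_zero.1 h0).resolve_right (by linarith [h.bot_lt u])
  exact Complex.ext (by simp [hr', drawing]) h1

theorem isPlanar (h : Γ.Fits F ε E) : (Γ.drawing F).IsPlanar E := by
  refine ⟨fun u v huv => ?_, fun u v huv => ?_, fun u v w huv hw => ?_, ?_⟩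
  · have hr := congrArg Complex.re huv
    have hi := congrArg Complex.im huv
    have hv := h.pos_mem v
    rw [← hr, ← hi] at hv
    exact h.eq_of_strips (h.pos_mem u).1 hv.1 (h.pos_mem u).2 hv.2
  · exact simpleArc_four_of_im_lt (h.lt_top u) (h.sep u v (h.level_lt huv)) (h.bot_lt v)
  · have hp := h.pos_mem w
    rcases h.mem_trace_coarse huv hw with ⟨hr, hi⟩ | ⟨hr, hi⟩ | ⟨hr, hi⟩
    · exact .inl (h.eq_of_strips hp.1 hr hp.2 ⟨(h.bot_lt u).le.trans hi.1, hi.2⟩)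
    · by_contra! hne
      exact h.vertical_strip huv hne.1 hne.2 hi hp.2 (hr ▸ hp.1)
    · exact .inr (h.eq_of_strips hp.1 hr hp.2 ⟨hi.1, hi.2.trans (h.lt_top v).le⟩)
  · intro u v u' v' huv huv' hne z hz hz'
    have hne' : ¬ (u = u' ∧ v = v') := by
      rintro ⟨rfl, rfl⟩; exact hne rfl
    have up (u v) (huv : E u v) (t : ℝ) (t0 : 0 ≤ t) (t1 : t ≤ 1)
        (hr : z.re = F.anchor u + t * (Γ.win u v - F.anchor u))
        (hi : z.im = Γ.level u + t * (F.top u - Γ.level u)) :=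
      fan_mem t0 t1 (h.anchor_mem u) (h.win_mem_left huv)
        ⟨le_rfl, (h.lt_top u).le⟩ ⟨(h.lt_top u).le, le_rfl⟩ hr hi
    have down (u v) (huv : E u v) (t : ℝ) (t0 : 0 ≤ t) (t1 : t ≤ 1)
        (hr : z.re = F.anchor v + t * (Γ.win u v - F.anchor v))
        (hi : z.im = Γ.level v - t * (Γ.level v - F.bot v)) :
        z.re ∈ Set.Icc (Γ.lo v) (Γ.hi v) ∧ z.im ∈ Set.Icc (F.bot v) (Γ.level v) :=
      fan_mem (k := F.bot v) t0 t1 (h.anchor_mem v) (h.win_mem_right huv)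
        ⟨(h.bot_lt v).le, le_rfl⟩ ⟨le_rfl, (h.bot_lt v).le⟩ hr (by rw [hi]; ring)
    rcases h.mem_trace huv hz with ⟨t, t0, t1, hr, hi⟩ | ⟨hr, hi⟩ | ⟨t, t0, t1, hr, hi⟩ <;>
      rcases h.mem_trace huv' hz' with ⟨s, s0, s1, hr', hi'⟩ | ⟨hr', hi'⟩ | ⟨s, s0, s1, hr', hi'⟩
    · obtain ⟨x, y⟩ := up u v huv t t0 t1 hr hi
      obtain ⟨x', y'⟩ := up u' v' huv' s s0 s1 hr' hi'
      obtain rfl := h.eq_of_strips x x' ⟨(h.bot_lt u).le.trans y.1, y.2⟩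
        ⟨(h.bot_lt u').le.trans y'.1, y'.2⟩
      exact ⟨u, eq_pos_of_fans (by linarith [h.lt_top u])
        (fun hc => hne' ⟨rfl, h.right_inj huv huv' hc⟩) hr hi hr' hi'⟩
    · obtain ⟨x, y⟩ := up u v huv t t0 t1 hr hi
      exact absurd (h.eq_of_upper_fan_of_vertical huv huv' hr hi x y hr' hi') hne'
    · obtain ⟨x, y⟩ := up u v huv t t0 t1 hr hi
      obtain ⟨x', y'⟩ := down u' v' huv' s s0 s1 hr' hi'
      exact ⟨u, h.eq_pos_of_upper_lower hr' hi' x y x' y'⟩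
    · obtain ⟨x, y⟩ := up u' v' huv' s s0 s1 hr' hi'
      obtain ⟨h1, h2⟩ := h.eq_of_upper_fan_of_vertical huv' huv hr' hi' x y hr hi
      exact absurd ⟨h1.symm, h2.symm⟩ hne'
    · exact absurd (h.eq_of_verticals huv huv' (hr ▸ hr') hi hi') hne'
    · obtain ⟨x, y⟩ := down u' v' huv' s s0 s1 hr' hi'
      obtain ⟨h1, h2⟩ := h.eq_of_lower_fan_of_vertical huv' huv hr' hi' x y hr hi
      exact absurd ⟨h1.symm, h2.symm⟩ hne'
    · obtain ⟨x, y⟩ := down u v huv t t0 t1 hr hi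
      obtain ⟨x', y'⟩ := up u' v' huv' s s0 s1 hr' hi'
      exact ⟨u', h.eq_pos_of_upper_lower hr hi x' y' x y⟩
    · obtain ⟨x, y⟩ := down u v huv t t0 t1 hr hi
      exact absurd (h.eq_of_lower_fan_of_vertical huv huv' hr hi x y hr' hi') hne'
    · obtain ⟨x, y⟩ := down u v huv t t0 t1 hr hi
      obtain ⟨x', y'⟩ := down u' v' huv' s s0 s1 hr' hi'
      obtain rfl := h.eq_of_strips x x' ⟨y.1, y.2.trans (h.lt_top v).le⟩
        ⟨y'.1, y'.2.trans (h.lt_top v').le⟩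
      exact ⟨v, eq_pos_of_fans (k := F.bot v - Γ.level v) (by linarith [h.bot_lt v])
        (fun hc => hne' ⟨h.left_inj huv huv' hc, rfl⟩) hr (by linarith) hr' (by linarith)⟩

end Fits

theorem outDir_drawing (u v : W) : (Γ.drawing F).outDir u v =
    ⟨Γ.win u v - F.anchor u, F.top u - Γ.level u⟩ := rfl

theorem inDir_drawing (u v : W) : (Γ.drawing F).inDir u v =
    ⟨Γ.win u v - F.anchor v, F.bot v - Γ.level v⟩ := rfl

theorem Fits.hasLeftRightOrders {V : Type*} {Γ : BarRep (StVertex V)} {F : Fans (StVertex V)}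
    {ε : ℝ} {E : StVertex V → StVertex V → Prop} (h : Γ.Fits F ε E) {ds dt : ℂ}
    (hs : ∀ a, E .source a → cross ds ((Γ.drawing F).outDir .source a) < 0)
    (ht : ∀ a, E a .sink → cross dt ((Γ.drawing F).inDir a .sink) < 0) :
    HasLeftRightOrders (Γ.drawing F) E (fun v a b => Γ.win v a < Γ.win v b)
      (fun v a b => Γ.win a v < Γ.win b v) ds dt := by
  have hout (v a b) : cross ((Γ.drawing F).outDir v a) ((Γ.drawing F).outDir v b) < 0 ↔
      Γ.win v a < Γ.win v b := by
    have := h.lt_top v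
    simp only [outDir_drawing, cross]
    constructor <;> intro _ <;> nlinarith
  have hin (v a b) : cross ((Γ.drawing F).inDir b v) ((Γ.drawing F).inDir a v) < 0 ↔
      Γ.win a v < Γ.win b v := by
    have := h.bot_lt v
    simp only [inDir_drawing, cross]
    constructor <;> intro _ <;> nlinarith
  have hup (v a) : cross (-1) ((Γ.drawing F).outDir v a) < 0 := by
    simpa [outDir_drawing, cross] using h.lt_top v
  have hdown (v a) : 0 < cross (-1) ((Γ.drawing F).inDir a v) := by
    simpa [inDir_drawing, cross] using h.bot_lt v
  -- Turning clockwise from the left, one passes the upper half-plane with all outgoing edges from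
  -- left to right, and then the lower one with all incoming edges from right to left.
  refine ⟨fun a b ha hb => ?_, fun a b ha hb => ?_, fun v => ⟨-1, by simp, ?_, ?_, ?_⟩⟩
  · rw [cwAngle_lt_iff_of_cross_neg (hs a ha) (hs b hb), hout]
  · rw [cwAngle_lt_iff_of_cross_neg (ht b hb) (ht a ha), hin]
  · intro a b _ _
    exact cwAngle_lt_of_cross_neg_of_pos (hup _ _) (hdown _ _)
  · intro a b _ _
    rw [cwAngle_lt_iff_of_cross_neg (hup _ _) (hup _ _), hout]
  · intro a b _ _
    rw [cwAngle_lt_iff_of_cross_pos (hdown _ _) (hdown _ _), hin]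

/-- Bars that represent an `st`-graph, with the visibility segments at the source strictly to
the left of the right end of its bar, those at the sink strictly to the right of the left end. -/
structure StBars {V : Type*} (Γ : BarRep (StVertex V)) (F : Fans (StVertex V)) (ε : ℝ)
    (E : StVertex V → StVertex V → Prop) : Prop extends Γ.Fits F ε E where
  source_lt : ∀ v, v ≠ .source → Γ.level .source < Γ.level v
  lt_sink : ∀ v, v ≠ .sink → Γ.level v < Γ.level .sink
  exists_in : ∀ v, v ≠ .source → ∃ u, E u v
  exists_out : ∀ v, v ≠ .sink → ∃ u, E v u
  source_sink : E .source .sink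
  lt_hi_source : ∀ v, E .source v → Γ.win .source v < Γ.hi .source
  lo_lt_sink : ∀ v, E v .sink → Γ.lo .sink < Γ.win v .sink

namespace StBars

variable {V : Type*} {Γ : BarRep (StVertex V)} {F : Fans (StVertex V)} {ε : ℝ}
  {E : StVertex V → StVertex V → Prop}

/-- Levels increase strictly along edges, which excludes cycles, edges into the lowest bar and edges
out of the highest one. -/
theorem isStGraph (h : Γ.StBars F ε E) : IsStGraph E := by
  refine ⟨fun v hv => ?_, fun v => ⟨fun hv => ?_, ?_⟩, fun v => ⟨fun hv => ?_, ?_⟩,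
    h.source_sink⟩
  · have hl (u w) (huw : Relation.TransGen E u w) : Γ.level u < Γ.level w := by
      induction huw with
      | single e => exact h.level_lt e
      | tail _ e ih => exact ih.trans (h.level_lt e)
    exact (hl v v hv).false
  · by_contra hne
    obtain ⟨u, hu⟩ := h.exists_in v hne
    exact hv u hu
  · rintro rfl u hu
    have := h.level_lt hu
    exact (h.source_lt u (by rintro rfl; exact this.false)).not_gt this
  · by_contra hne
    obtain ⟨u, hu⟩ := h.exists_out v hne
    exact hv u hu
  · rintro rfl u hu
    have := h.level_lt hu
    exact (h.lt_sink u (by rintro rfl; exact this.false)).not_gt this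

theorem between (h : Γ.StBars F ε E) {u v : StVertex V} (huv : E u v) {z : ℂ}
    (hz : z ∈ trace ((Γ.drawing F).path u v)) :
    (z ≠ (Γ.drawing F).pos .source → ((Γ.drawing F).pos .source).im < z.im) ∧
      (z ≠ (Γ.drawing F).pos .sink → z.im < ((Γ.drawing F).pos .sink).im) := by
  have hs : Γ.level .source ≤ Γ.level u := by
    by_cases e : u = .source
    · rw [e]
    · exact (h.source_lt u e).le
  have ht : Γ.level v ≤ Γ.level .sink := by
    by_cases e : v = .sink
    · rw [e]
    · exact (h.lt_sink v e).le
  have a1 := h.lt_top u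
  have a2 := h.bot_lt v
  have a3 := h.sep u v (h.level_lt huv)
  change (_ → Γ.level .source < z.im) ∧ (_ → z.im < Γ.level .sink)
  rcases h.mem_trace huv hz with ⟨t, t0, t1, hr, hi⟩ | ⟨hr, hi⟩ | ⟨t, t0, t1, hr, hi⟩
  · refine ⟨fun hne => ?_, fun _ => by nlinarith⟩
    by_cases hu : u = .source
    · subst hu
      have h0 : t ≠ 0 := by
        rintro rfl
        exact hne (Complex.ext (by simpa [drawing] using hr) (by simpa [drawing] using hi))
      have : 0 < t := lt_of_le_of_ne t0 h0.symm
      nlinarith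
    · nlinarith [h.source_lt u hu]
  · exact ⟨fun _ => by linarith, fun _ => by linarith⟩
  · refine ⟨fun _ => by nlinarith, fun hne => ?_⟩
    by_cases hv : v = .sink
    · subst hv
      have h0 : t ≠ 0 := by
        rintro rfl
        exact hne (Complex.ext (by simpa [drawing] using hr) (by simpa [drawing] using hi))
      have : 0 < t := lt_of_le_of_ne t0 h0.symm
      nlinarith
    · nlinarith [h.lt_sink v hv]

/-- Fans in which the source is placed at the right end of its bar and all other vertices at the
left ends of their bars. -/
noncomputable def endFans (Γ : BarRep (StVertex V)) (F : Fans (StVertex V)) :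
    Fans (StVertex V) where
  anchor
    | .source => Γ.hi .source
    | v => Γ.lo v
  bot := F.bot
  top := F.top

theorem endFans_stBars (h : Γ.StBars F ε E) : Γ.StBars (endFans Γ F) ε E :=
  { h with
    anchor_mem := by
      have hl := h.represents.1
      rintro (_ | _ | v)
      · exact ⟨(hl _).le, le_rfl⟩
      · exact ⟨le_rfl, (hl _).le⟩
      · exact ⟨le_rfl, (hl _).le⟩ }

/-- The plane `st`-graph with the embedding given by the left-to-right order of the visibility
segments. -/
def planeStGraph (h : Γ.StBars F ε E) : PlaneStGraph V where
  E := E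
  outLeft v a b := Γ.win v a < Γ.win v b
  inLeft v a b := Γ.win a v < Γ.win b v
  isStGraph := h.isStGraph
  -- With the source at the right end of its bar, all its edges leave strictly to the left, inside
  -- the half-plane clockwise of `-I`; the sink at the left end is symmetric. So the cut direction
  -- does not split the order.
  planar := ⟨Γ.drawing (endFans Γ F), h.endFans_stBars.isPlanar,
    fun _ _ huv _ hz => h.endFans_stBars.between huv hz, h.endFans_stBars.hasLeftRightOrders
      (fun a ha => by simpa [cross, outDir_drawing, endFans] using h.lt_hi_source a ha)
      (fun a ha => by simpa [cross, inDir_drawing, endFans] using h.lo_lt_sink a ha)⟩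

end StBars
end BarRep
end SimVis
namespace SimVis

/-! ## Transversals from pairs of bar representations -/

namespace BarRep

/-- Source and sink are placed at the points `(0, -T)` and `(0, T)`, and all else is at distance
at most `N` from the axes, where `2 * N < T`. -/
structure Boxed {V : Type*} (Γ : BarRep (StVertex V)) (F : Fans (StVertex V))
    (E : StVertex V → StVertex V → Prop) (N T : ℝ) : Prop where
  lt : 2 * N < T
  anchor_source : F.anchor .source = 0
  anchor_sink : F.anchor .sink = 0
  level_source : Γ.level .source = -T
  level_sink : Γ.level .sink = T
  inner : ∀ v : V, |F.anchor (.inner v)| ≤ N ∧ |Γ.level (.inner v)| ≤ N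
  bends : ∀ u v, E u v → |Γ.win u v| ≤ N ∧ |F.top u| ≤ N ∧ |F.bot v| ≤ N

/-- Convexity of the `ℓ¹` norm: moving from a point of norm at most `T` towards one of norm at most
`2 * N < T` enters the open diamond at once. -/
theorem abs_add_abs_lt {a b c d t N T : ℝ} (hNT : 2 * N < T) (t0 : 0 < t) (t1 : t ≤ 1)
    (hab : |a| + |b| ≤ T) (hc : |c| ≤ N) (hd : |d| ≤ N) :
    |a + t * (c - a)| + |b + t * (d - b)| < T := by
  have key (a c : ℝ) : |a + t * (c - a)| ≤ (1 - t) * |a| + t * |c| := by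
    rw [show a + t * (c - a) = (1 - t) * a + t * c by ring]
    refine (abs_add_le _ _).trans_eq ?_
    rw [abs_mul, abs_mul, abs_of_nonneg (by linarith : 0 ≤ 1 - t), abs_of_pos t0]
  nlinarith [key a c, key b d]

variable {V : Type*} {Γ : BarRep (StVertex V)} {F : Fans (StVertex V)} {ε N T : ℝ}
  {E : StVertex V → StVertex V → Prop}

theorem Boxed.pos (b : Γ.Boxed F E N T) (h : Γ.StBars F ε E) : 0 < T := by
  linarith [h.source_lt .sink (by simp), b.level_source, b.level_sink]

theorem Boxed.abs_lt (b : Γ.Boxed F E N T) (h : Γ.StBars F ε E) {u v : StVertex V}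
    (huv : E u v) {z : ℂ} (hz : z ∈ trace ((Γ.drawing F).path u v)) :
    z = (Γ.drawing F).pos .source ∨ z = (Γ.drawing F).pos .sink ∨ |z.re| + |z.im| < T := by
  have hT := b.pos h
  have hNT := b.lt
  obtain ⟨hw, ht, hb⟩ := b.bends u v huv
  have hpos (w : StVertex V) : |F.anchor w| + |Γ.level w| ≤ T := by
    rcases w with _ | _ | w
    · rw [b.anchor_source, b.level_source, abs_zero, abs_neg, abs_of_pos hT, zero_add]
    · rw [b.anchor_sink, b.level_sink, abs_zero, abs_of_pos hT, zero_add]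
    · linarith [b.inner w]
  have hfan (w : StVertex V) (t k : ℝ) (t0 : 0 ≤ t) (t1 : t ≤ 1) (hk : |k| ≤ N)
      (hr : z.re = F.anchor w + t * (Γ.win u v - F.anchor w))
      (hi : z.im = Γ.level w + t * (k - Γ.level w)) :
      z = (Γ.drawing F).pos .source ∨ z = (Γ.drawing F).pos .sink ∨ |z.re| + |z.im| < T := by
    rcases t0.eq_or_lt with rfl | t0
    · have e : z = (Γ.drawing F).pos w :=
        Complex.ext (by simpa [drawing] using hr) (by simpa [drawing] using hi)
      rcases w with _ | _ | w
      · exact .inl e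
      · exact .inr (.inl e)
      · refine .inr (.inr ?_)
        rw [e]
        change |F.anchor (.inner w)| + |Γ.level (.inner w)| < T
        linarith [b.inner w]
    · rw [hr, hi]
      exact .inr (.inr (abs_add_abs_lt hNT t0 t1 (hpos w) hw hk))
  rcases h.mem_trace huv hz with ⟨t, t0, t1, hr, hi⟩ | ⟨hr, hi⟩ | ⟨t, t0, t1, hr, hi⟩
  · exact hfan u t _ t0 t1 ht hr hi
  · refine .inr (.inr ?_)
    have : |z.im| ≤ N := abs_le.2 ⟨(abs_le.1 ht).1.trans hi.1, hi.2.trans (abs_le.1 hb).2⟩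
    rw [hr]
    linarith
  · exact hfan v t _ t0 t1 hb hr (by rw [hi]; ring)

theorem Boxed.hasLeftRightOrders (b : Γ.Boxed F E N T) (h : Γ.StBars F ε E) :
    HasLeftRightOrders (Γ.drawing F) E (fun v a b => Γ.win v a < Γ.win v b)
      (fun v a b => Γ.win a v < Γ.win b v) ⟨-T, T⟩ ⟨T, -T⟩ := by
  have hT := b.pos h
  have hNT := b.lt
  refine h.hasLeftRightOrders (fun a ha => ?_) (fun a ha => ?_)
  · obtain ⟨hw, ht, -⟩ := b.bends _ _ ha
    rw [abs_le] at hw ht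
    simp only [cross, outDir_drawing, b.anchor_source, b.level_source]
    nlinarith
  · obtain ⟨hw, -, hb⟩ := b.bends _ _ ha
    rw [abs_le] at hw hb
    simp only [cross, inDir_drawing, b.anchor_sink, b.level_sink]
    nlinarith

/-- Compatibility of horizontal bars `H` with vertical bars. The latter are given by the
horizontal bars `Γ` that arise from them by a counterclockwise rotation by a right angle. -/
structure Compatible (H Γ : BarRep (StVertex V)) (F G : Fans (StVertex V))
    (E E' : StVertex V → StVertex V → Prop) (δ : ℝ) : Prop where
  corner : ∀ v : V, H.lo (.inner v) = Γ.level (.inner v) ∧ H.level (.inner v) = -Γ.hi (.inner v)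
  anchor : ∀ v : V, F.anchor (.inner v) = H.lo (.inner v) ∧ G.anchor (.inner v) = Γ.hi (.inner v)
  fan : ∀ v : V, F.top (.inner v) = H.level (.inner v) + δ ∧
    F.bot (.inner v) = H.level (.inner v) - δ ∧ G.top (.inner v) = Γ.level (.inner v) + δ ∧
    G.bot (.inner v) = Γ.level (.inner v) - δ
  win : ∀ u v w, E u v → H.win u v < G.bot w ∨ G.top w < H.win u v
  win' : ∀ u v w, E' u v → -Γ.win u v < F.bot w ∨ F.top w < -Γ.win u v
  strips : ∀ w w', (∀ v, w = .inner v → w' ≠ .inner v) → H.hi w < G.bot w' ∨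
    G.top w' < H.lo w ∨ F.top w < -Γ.hi w' ∨ -Γ.lo w' < F.bot w

theorem neg_I_inv : (-Complex.I)⁻¹ = Complex.I := by simp

variable {H : BarRep (StVertex V)} {G : Fans (StVertex V)} {E' : StVertex V → StVertex V → Prop}
  {δ : ℝ}

/-! ### Crossings and circular orders for compatible pairs of bars -/

namespace Compatible

/-- The window lies on the bar of `v` and avoids the strip of half-width `δ` around the vertical bar
at its left end. Hence the fan of `v`, of height `δ`, is flatter than a diagonal. -/
theorem win_gt (c : Compatible H Γ F G E E' δ) (h : H.StBars F ε E) {u w : StVertex V} {v : V}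
    (huw : E u w) (hv : u = .inner v ∨ w = .inner v) :
    H.lo (.inner v) + δ < H.win u w := by
  have h1 : H.lo (.inner v) ≤ H.win u w := by
    rcases hv with rfl | rfl
    · exact (h.win_mem_left huw).1
    · exact (h.win_mem_right huw).1
  have h2 := c.win u w (.inner v) huw
  obtain ⟨f1, f2, f3, f4⟩ := c.fan v
  have := h.lt_top (.inner v)
  have := (c.corner v).1
  rcases h2 with h2 | h2 <;> linarith

theorem win_lt (c : Compatible H Γ F G E E' δ) (h : Γ.StBars G ε E') {u w : StVertex V} {v : V}
    (huw : E' u w) (hv : u = .inner v ∨ w = .inner v) :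
    H.level (.inner v) + δ < -Γ.win u w := by
  have h1 : Γ.win u w ≤ Γ.hi (.inner v) := by
    rcases hv with rfl | rfl
    · exact (h.win_mem_left huw).2
    · exact (h.win_mem_right huw).2
  have h2 := c.win' u w (.inner v) huw
  obtain ⟨f1, f2, f3, f4⟩ := c.fan v
  have := h.lt_top (.inner v)
  have := (c.corner v).2
  rcases h2 with h2 | h2 <;> linarith

theorem delta_pos (c : Compatible H Γ F G E E' δ) (h : H.StBars F ε E) (v : V) : 0 < δ := by
  linarith [h.lt_top (.inner v), (c.fan v).1]

/-- An edge is a vertical segment in the middle, and runs in the strip of an end-vertex else. -/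
theorem _root_.SimVis.BarRep.Fits.mem_trace_strip (h : Γ.Fits F ε E) {u v : StVertex V}
    (huv : E u v) {z : ℂ} (hz : z ∈ trace ((Γ.drawing F).path u v)) :
    (z.re = Γ.win u v ∧ F.top u ≤ z.im ∧ z.im ≤ F.bot v) ∨
    ∃ w k, (u = w ∨ v = w) ∧ (k = F.top w ∨ k = F.bot w) ∧
      z.re ∈ Set.Icc (Γ.lo w) (Γ.hi w) ∧ z.im ∈ Set.Icc (F.bot w) (F.top w) ∧
      ∃ t : ℝ, 0 ≤ t ∧ z.re = F.anchor w + t * (Γ.win u v - F.anchor w) ∧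
        z.im = Γ.level w + t * (k - Γ.level w) := by
  rcases h.mem_trace huv hz with ⟨t, t0, t1, hr, hi⟩ | hm | ⟨t, t0, t1, hr, hi⟩
  · have := Fits.fan_mem t0 t1 (h.anchor_mem u) (h.win_mem_left huv) (h.level_mem u)
      ⟨((h.bot_lt u).trans (h.lt_top u)).le, le_rfl⟩ hr hi
    exact .inr ⟨u, _, .inl rfl, .inl rfl, this.1, this.2, t, t0, hr, hi⟩
  · exact .inl hm
  · have hi' : z.im = Γ.level v + t * (F.bot v - Γ.level v) := by rw [hi]; ring
    have := Fits.fan_mem t0 t1 (h.anchor_mem v) (h.win_mem_right huv) (h.level_mem v)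
      ⟨le_rfl, ((h.bot_lt v).trans (h.lt_top v)).le⟩ hr hi'
    exact .inr ⟨v, _, .inr rfl, .inr rfl, this.1, this.2, t, t0, hr, hi'⟩

/-- A red fan segment makes an angle below 45° with the horizontal axis, a blue one with the
vertical axis; the two cones share only their apex. -/
theorem eq_zero_of_fans {p q k k' s t δ : ℝ} (hp : δ < p) (hq : δ < q)
    (hk : |k| ≤ δ) (hk' : |k'| ≤ δ) (s0 : 0 ≤ s) (t0 : 0 ≤ t) (h1 : t * p = s * k')
    (h2 : t * k = s * q) : t = 0 := by
  by_contra hne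
  have ht : 0 < t := lt_of_le_of_ne t0 (Ne.symm hne)
  have a1 : t * p ≤ s * δ := by rw [h1]; gcongr; exact (le_abs_self k').trans hk'
  have a2 : s * q ≤ t * δ := by rw [← h2]; gcongr; exact (le_abs_self k).trans hk
  nlinarith

/-- A common point of a red and a blue edge is a vertex or a crossing of their middle parts. -/
theorem common_point (c : Compatible H Γ F G E E' δ) (h : H.StBars F ε E)
    (h' : Γ.StBars G ε E') {u v u' v' : StVertex V} (huv : E u v) (huv' : E' u' v') {z : ℂ}
    (hz : z ∈ trace ((H.drawing F).path u v))
    (hz' : z ∈ trace (((Γ.drawing G).mul (-Complex.I)).path u' v')) :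
    (∃ w : V, z = (H.drawing F).pos (.inner w)) ∨
      (z.re = H.win u v ∧ z.im = -Γ.win u' v' ∧ F.top u < z.im ∧ z.im < F.bot v ∧
        G.top u' < z.re ∧ z.re < G.bot v') := by
  rw [PolyDrawing.mem_trace_mul (by simp), neg_I_inv] at hz'
  have er : (Complex.I * z).re = -z.im := by simp
  have ei : (Complex.I * z).im = z.re := by simp
  rcases h.mem_trace_strip huv hz with ⟨x1, y1, y2⟩ | ⟨w, k, hw, hk, x1, y1, t, t0, hr, hi⟩ <;>
  rcases h'.mem_trace_strip huv' hz' with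
    ⟨x2, y3, y4⟩ | ⟨w', k', hw', hk', x2, y3, s, s0, hr', hi'⟩
  · rw [er] at x2
    rw [ei] at y3 y4
    refine .inr ⟨x1, by linarith, ?_, ?_, ?_, ?_⟩
    · rcases c.win' u' v' u huv' with q | q
      · linarith [h.bot_lt u, h.lt_top u]
      · linarith
    · rcases c.win' u' v' v huv' with q | q
      · linarith
      · linarith [h.bot_lt v, h.lt_top v]
    · rcases c.win u v u' huv with q | q
      · linarith [h'.bot_lt u', h'.lt_top u']
      · linarith
    · rcases c.win u v v' huv with q | q
      · linarith
      · linarith [h'.bot_lt v', h'.lt_top v']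
  · rw [ei] at y3
    rcases c.win u v w' huv with q | q <;> linarith [y3.1, y3.2]
  · rw [er] at x2
    rcases c.win' u' v' w huv' with q | q <;> linarith [y1.1, y1.2]
  · rw [er] at x2 hr'
    rw [ei] at y3 hi'
    -- Both points are in fans: those of different L-shapes, or of a dummy bar, lie in disjoint
    -- strips, and those of one L-shape in the two cones at its corner.
    by_cases hww : ∀ v, w = .inner v → w' ≠ .inner v
    · rcases c.strips w w' hww with q | q | q | q <;>
        linarith [x1.1, x1.2, x2.1, x2.2, y1.1, y1.2, y3.1, y3.2]
    · push Not at hww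
      obtain ⟨x, rfl, rfl⟩ := hww
      have hδ := c.delta_pos h x
      obtain ⟨f1, f2, f3, f4⟩ := c.fan x
      obtain ⟨c1, c2⟩ := c.corner x
      rw [(c.anchor x).1] at hr
      rw [(c.anchor x).2] at hr'
      have g1 := c.win_gt h huv hw
      have g2 := c.win_lt h' huv' hw'
      have hk1 : |k - H.level (.inner x)| ≤ δ := by
        rcases hk with rfl | rfl
        · rw [f1]; simp [abs_of_pos hδ]
        · rw [f2]; simp [abs_of_pos hδ]
      have hk2 : |k' - Γ.level (.inner x)| ≤ δ := by
        rcases hk' with rfl | rfl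
        · rw [f3]; simp [abs_of_pos hδ]
        · rw [f4]; simp [abs_of_pos hδ]
      have ht := eq_zero_of_fans (p := H.win u v - H.lo (.inner x))
        (q := -Γ.win u' v' - H.level (.inner x)) (by linarith) (by linarith) hk1 hk2 s0 t0
        (by linarith) (by rw [c2] at hi ⊢; linarith)
      subst ht
      refine .inl ⟨x, Complex.ext ?_ ?_⟩
      · change z.re = F.anchor (.inner x)
        rw [(c.anchor x).1, hr]; ring
      · change z.im = H.level (.inner x)
        rw [hi]; ring

/-- With `p > δ`, the directions are `(p, δ)` for red out, `(p, -δ)` for red in, `(-δ, p)` for blue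
in and `(δ, p)` for blue out. The diagonal `(1, 1)` has all red ones on its clockwise side and all
blue ones on the other. -/
theorem clockwiseBlocks (c : Compatible H Γ F G E E' δ) (h : H.StBars F ε E)
    (h' : Γ.StBars G ε E') (v : V) :
    ClockwiseBlocks ⟨1, 1⟩ (Rotation.lowerLeft.blocks
      {e | ∃ w, E (.inner v) w ∧ e = (H.drawing F).outDir (.inner v) w}
      {e | ∃ w, E w (.inner v) ∧ e = (H.drawing F).inDir w (.inner v)}
      {e | ∃ w, E' (.inner v) w ∧
        e = ((Γ.drawing G).mul (-Complex.I)).outDir (.inner v) w}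
      {e | ∃ w, E' w (.inner v) ∧
        e = ((Γ.drawing G).mul (-Complex.I)).inDir w (.inner v)}) := by
  have hδ := c.delta_pos h v
  obtain ⟨f1, f2, f3, f4⟩ := c.fan v
  obtain ⟨c1, c2⟩ := c.corner v
  obtain ⟨a1, a2⟩ := c.anchor v
  obtain ⟨ro, hro⟩ := h.exists_out (.inner v) (by simp)
  obtain ⟨ri, hri⟩ := h.exists_in (.inner v) (by simp)
  obtain ⟨bo, hbo⟩ := h'.exists_out (.inner v) (by simp)
  obtain ⟨bi, hbi⟩ := h'.exists_in (.inner v) (by simp)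
  have ero (w) (hw : E (.inner v) w) : ∃ p, δ < p ∧
      (H.drawing F).outDir (.inner v) w = ⟨p, δ⟩ :=
    ⟨H.win (.inner v) w - H.lo (.inner v), by linarith [c.win_gt h hw (.inl rfl)], by
      rw [outDir_drawing, a1, f1]; congr 1; ring⟩
  have eri (w) (hw : E w (.inner v)) : ∃ p, δ < p ∧
      (H.drawing F).inDir w (.inner v) = ⟨p, -δ⟩ :=
    ⟨H.win w (.inner v) - H.lo (.inner v), by linarith [c.win_gt h hw (.inr rfl)], by
      rw [inDir_drawing, a1, f2]; congr 1; ring⟩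
  have ebo (w) (hw : E' (.inner v) w) : ∃ p, δ < p ∧
      ((Γ.drawing G).mul (-Complex.I)).outDir (.inner v) w = ⟨δ, p⟩ :=
    ⟨Γ.hi (.inner v) - Γ.win (.inner v) w, by linarith [c.win_lt h' hw (.inl rfl)], by
      rw [PolyDrawing.outDir_mul, outDir_drawing, a2, f3]
      apply Complex.ext <;> simp⟩
  have ebi (w) (hw : E' w (.inner v)) : ∃ p, δ < p ∧
      ((Γ.drawing G).mul (-Complex.I)).inDir w (.inner v) = ⟨-δ, p⟩ :=
    ⟨Γ.hi (.inner v) - Γ.win w (.inner v), by linarith [c.win_lt h' hw (.inr rfl)], by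
      rw [PolyDrawing.inDir_mul, inDir_drawing, a2, f4]
      apply Complex.ext <;> simp⟩
  refine ⟨?_, ?_⟩
  · simp only [Rotation.blocks, List.mem_cons, List.not_mem_nil, or_false]
    rintro A (rfl | rfl | rfl | rfl)
    exacts [⟨_, ro, hro, rfl⟩, ⟨_, ri, hri, rfl⟩, ⟨_, bi, hbi, rfl⟩, ⟨_, bo, hbo, rfl⟩]
  · simp only [Rotation.blocks, List.pairwise_cons, List.mem_cons, List.not_mem_nil, or_false,
      forall_eq_or_imp, forall_eq, IsEmpty.forall_iff, implies_true, List.Pairwise.nil, and_true]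
    refine ⟨⟨?_, ?_, ?_⟩, ⟨?_, ?_⟩, ?_⟩
    · rintro _ ⟨w, hw, rfl⟩ _ ⟨x, hx, rfl⟩
      obtain ⟨p, hp, e⟩ := ero w hw
      obtain ⟨q, hq, e'⟩ := eri x hx
      rw [e, e', cwAngle_lt_iff_of_cross_neg] <;> simp only [cross] <;> nlinarith
    · rintro _ ⟨w, hw, rfl⟩ _ ⟨x, hx, rfl⟩
      obtain ⟨p, hp, e⟩ := ero w hw
      obtain ⟨q, hq, e'⟩ := ebi x hx
      rw [e, e']
      apply cwAngle_lt_of_cross_neg_of_pos <;> simp only [cross] <;> linarith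
    · rintro _ ⟨w, hw, rfl⟩ _ ⟨x, hx, rfl⟩
      obtain ⟨p, hp, e⟩ := ero w hw
      obtain ⟨q, hq, e'⟩ := ebo x hx
      rw [e, e']
      apply cwAngle_lt_of_cross_neg_of_pos <;> simp only [cross] <;> linarith
    · rintro _ ⟨w, hw, rfl⟩ _ ⟨x, hx, rfl⟩
      obtain ⟨p, hp, e⟩ := eri w hw
      obtain ⟨q, hq, e'⟩ := ebi x hx
      rw [e, e']
      apply cwAngle_lt_of_cross_neg_of_pos <;> simp only [cross] <;> linarith
    · rintro _ ⟨w, hw, rfl⟩ _ ⟨x, hx, rfl⟩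
      obtain ⟨p, hp, e⟩ := eri w hw
      obtain ⟨q, hq, e'⟩ := ebo x hx
      rw [e, e']
      apply cwAngle_lt_of_cross_neg_of_pos <;> simp only [cross] <;> linarith
    · rintro _ ⟨w, hw, rfl⟩ _ ⟨x, hx, rfl⟩
      obtain ⟨p, hp, e⟩ := ebi w hw
      obtain ⟨q, hq, e'⟩ := ebo x hx
      rw [e, e', cwAngle_lt_iff_of_cross_pos] <;> simp only [cross] <;> nlinarith

theorem isTransversal (c : Compatible H Γ F G E E' δ) (h : H.StBars F ε E)
    (h' : Γ.StBars G ε E') (b : H.Boxed F E N T) (b' : Γ.Boxed G E' N T) :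
    IsTransversal h.planeStGraph h'.planeStGraph (fun _ => Rotation.lowerLeft)
      (H.drawing F) ((Γ.drawing G).mul (-Complex.I)) := by
  have hT := b.pos h
  have e1 : (H.drawing F).pos .source = ⟨0, -T⟩ := by
    simp only [drawing, b.anchor_source, b.level_source]
  have e2 : (H.drawing F).pos .sink = ⟨0, T⟩ := by
    simp only [drawing, b.anchor_sink, b.level_sink]
  have e3 : ((Γ.drawing G).mul (-Complex.I)).pos .source = ⟨-T, 0⟩ := by
    simp only [drawing, PolyDrawing.mul, b'.anchor_source, b'.level_source]
    apply Complex.ext <;> simp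
  have e4 : ((Γ.drawing G).mul (-Complex.I)).pos .sink = ⟨T, 0⟩ := by
    simp only [drawing, PolyDrawing.mul, b'.anchor_sink, b'.level_sink]
    apply Complex.ext <;> simp
  -- The four dummy vertices are the corners of the diamond of `ℓ¹` radius `T`.
  have hin {z : ℂ} (hz : |z.re| + |z.im| < T) :
      RightOf ⟨0, -T⟩ ⟨-T, 0⟩ z ∧ RightOf ⟨-T, 0⟩ ⟨0, T⟩ z ∧ RightOf ⟨0, T⟩ ⟨T, 0⟩ z ∧
        RightOf ⟨T, 0⟩ ⟨0, -T⟩ z := by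
    have := neg_abs_le z.re
    have := le_abs_self z.re
    have := neg_abs_le z.im
    have := le_abs_self z.im
    simp only [RightOf, cross, Complex.sub_re, Complex.sub_im]
    refine ⟨?_, ?_, ?_, ?_⟩ <;> nlinarith
  refine
    { same_pos := fun v => ?_
      red_planar := h.isPlanar
      blue_planar := h'.isPlanar.mul (by simp)
      convex := ?_
      inside := ?_
      red_embedding := ?_
      blue_embedding := ?_
      blocks := fun v => ⟨⟨1, 1⟩, fun e => by simpa using congrArg Complex.re e,
        c.clockwiseBlocks h h' v⟩
      crossings := ?_
      cross_once := ?_ }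
  · simp only [drawing, PolyDrawing.mul, (c.anchor v).1, (c.anchor v).2, (c.corner v).1,
      (c.corner v).2]
    apply Complex.ext <;> simp
  · rintro _ _ _ _ rfl rfl rfl rfl
    rw [e1, e2, e3, e4]
    simp only [RightOf, cross, Complex.sub_re, Complex.sub_im]
    refine ⟨⟨?_, ?_⟩, ⟨?_, ?_⟩, ⟨?_, ?_⟩, ⟨?_, ?_⟩⟩ <;> nlinarith
  · intro u v z hz
    rcases hz with ⟨huv, hz⟩ | ⟨huv, hz⟩
    · rcases b.abs_lt h huv hz with r | r | r
      · exact .inl (.inl r)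
      · exact .inl (.inr (.inl r))
      · rw [e1, e2, e3, e4]
        exact .inr (hin r)
    · rw [PolyDrawing.mem_trace_mul (by simp), neg_I_inv] at hz
      have ez : -Complex.I * (Complex.I * z) = z := by rw [← mul_assoc]; simp
      rcases b'.abs_lt h' huv hz with r | r | r
      · exact .inl (.inr (.inr (.inl (by rw [← ez, r]; rfl))))
      · exact .inl (.inr (.inr (.inr (by rw [← ez, r]; rfl))))
      · rw [e1, e2, e3, e4]
        refine .inr (hin ?_)
        simpa [add_comm] using r
  · have d1 : (⟨-T, 0⟩ : ℂ) - ⟨0, -T⟩ = ⟨-T, T⟩ := by apply Complex.ext <;> simp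
    have d2 : (⟨T, 0⟩ : ℂ) - ⟨0, T⟩ = ⟨T, -T⟩ := by apply Complex.ext <;> simp
    rw [e1, e2, e3, e4, d1, d2]
    exact b.hasLeftRightOrders h
  · have d1 : (⟨0, T⟩ : ℂ) - ⟨-T, 0⟩ = -Complex.I * ⟨-T, T⟩ := by apply Complex.ext <;> simp
    have d2 : (⟨0, -T⟩ : ℂ) - ⟨T, 0⟩ = -Complex.I * ⟨T, -T⟩ := by apply Complex.ext <;> simp
    rw [e1, e2, e3, e4, d1, d2]
    exact (b'.hasLeftRightOrders h').mul (by simp)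
  · intro u v u' v' huv huv' z hz hz'
    rcases c.common_point h h' huv huv' hz hz' with r | ⟨hr, hi, g1, g2, g3, g4⟩
    · exact .inl r
    · refine .inr ⟨(⟨H.win u v, F.top u⟩, ⟨H.win u v, F.bot v⟩), ?_,
        (-Complex.I * ⟨Γ.win u' v', G.top u'⟩, -Complex.I * ⟨Γ.win u' v', G.bot v'⟩), ?_,
        ?_, ?_, ?_⟩
      · exact .tail _ (.head _)
      · exact .tail _ (.head _)
      · have hd : 0 < F.bot v - F.top u := by linarith
        refine mem_openSegment_iff.2 ⟨(z.im - F.top u) / (F.bot v - F.top u),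
          div_pos (by linarith) hd, (div_lt_one hd).2 (by linarith), ?_, ?_⟩
        · simp [hr]
        · simp only []
          rw [div_mul_cancel₀ _ hd.ne']; ring
      · have hd : 0 < G.bot v' - G.top u' := by linarith
        refine mem_openSegment_iff.2 ⟨(z.re - G.top u') / (G.bot v' - G.top u'),
          div_pos (by linarith) hd, (div_lt_one hd).2 (by linarith), ?_, ?_⟩
        · simp only [neg_mul, Complex.neg_re, Complex.I_mul_re, neg_neg]
          rw [div_mul_cancel₀ _ hd.ne']; ring
        · simp [hi]
      -- The red middle segment points straight up and the blue one, after the rotation, straight to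
      -- the right.
      · simp only [cross, neg_mul, Complex.sub_re, Complex.sub_im, Complex.neg_re,
          Complex.neg_im, Complex.I_mul_re, Complex.I_mul_im]
        nlinarith
  · rintro u v u' v' huv huv' z ⟨hz, hz', hz0⟩ y ⟨hy, hy', hy0⟩
    rcases c.common_point h h' huv huv' hz hz' with ⟨w, hw⟩ | ⟨hr, hi, -⟩
    · exact absurd hw (hz0 w)
    rcases c.common_point h h' huv huv' hy hy' with ⟨w, hw⟩ | ⟨hr', hi', -⟩
    · exact absurd hw (hy0 w)
    exact Complex.ext (hr.trans hr'.symm) (hi.trans hi'.symm)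

end Compatible
end BarRep
end SimVis
namespace SimVis

/-! ### Criteria for visibility, relabelling and reflection of bars -/

namespace BarRep

theorem visible_of {W : Type*} {Γ : BarRep W} {ε c : ℝ} {u v : W}
    (hl : Γ.level u < Γ.level v) (hu : Γ.lo u ≤ c) (hu' : c + ε ≤ Γ.hi u) (hv : Γ.lo v ≤ c)
    (hv' : c + ε ≤ Γ.hi v)
    (h : ∀ w, w ≠ u → w ≠ v → Γ.level u ≤ Γ.level w → Γ.level w ≤ Γ.level v →
      Γ.hi w < c ∨ c + ε < Γ.lo w) : Γ.Visible ε u v c := by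
  refine ⟨hl, Set.Icc_subset_Icc hu hu', Set.Icc_subset_Icc hv hv', fun w h1 h2 h3 h4 => ?_⟩
  rw [Set.disjoint_left]
  rintro x ⟨x1, x2⟩ ⟨x3, x4⟩
  rcases h w h1 h2 h3 h4 with h | h <;> linarith

theorem Visible.bounds {W : Type*} {Γ : BarRep W} {ε c : ℝ} {u v : W} (hε : 0 ≤ ε)
    (h : Γ.Visible ε u v c) : Γ.level u < Γ.level v ∧ Γ.lo u ≤ c ∧ c + ε ≤ Γ.hi u ∧
      Γ.lo v ≤ c ∧ c + ε ≤ Γ.hi v ∧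
      ∀ w, w ≠ u → w ≠ v → Γ.level u ≤ Γ.level w → Γ.level w ≤ Γ.level v → Γ.lo w ≤ c →
        Γ.hi w < c := by
  obtain ⟨h1, h2, h3, h4⟩ := h
  have hc : c ∈ Set.Icc c (c + ε) := ⟨le_rfl, by linarith⟩
  have hc' : c + ε ∈ Set.Icc c (c + ε) := ⟨by linarith, le_rfl⟩
  refine ⟨h1, (h2 hc).1, (h2 hc').2, (h3 hc).1, (h3 hc').2, fun w w1 w2 w3 w4 w5 => ?_⟩
  by_contra hw
  exact Set.disjoint_left.1 (h4 w w1 w2 w3 w4) hc ⟨w5, not_lt.1 hw⟩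

/-- Relabelling of the bars. -/
def comap {W W' : Type*} (e : W → W') (Γ : BarRep W') : BarRep W where
  level v := Γ.level (e v)
  lo v := Γ.lo (e v)
  hi v := Γ.hi (e v)
  win u v := Γ.win (e u) (e v)

theorem Represents.comap {W W' : Type*} {Γ : BarRep W'} {ε : ℝ} {E : W' → W' → Prop}
    (h : Γ.Represents ε E) (e : W ≃ W') :
    (Γ.comap e).Represents ε (fun u v => E (e u) (e v)) := by
  obtain ⟨h1, h2, h3, h4⟩ := h
  have key (u v : W) (c : ℝ) : (Γ.comap e).Visible ε u v c ↔ Γ.Visible ε (e u) (e v) c := by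
    simp only [Visible, BarRep.comap]
    rw [e.surjective.forall]
    simp only [ne_eq, e.injective.eq_iff]
  exact ⟨fun v => h1 _, fun u v huv => h2 _ _ (e.injective.ne huv),
    fun u v => (h3 _ _).trans (exists_congr fun c => (key u v c).symm),
    fun u v huv => (key u v _).2 (h4 _ _ huv)⟩

/-- The reflection that reverses all bars. It turns vertical bars, read as horizontal bars, into
their images under a counterclockwise rotation by a right angle. -/
def mirror {W : Type*} (ε : ℝ) (Γ : BarRep W) : BarRep W where
  level := Γ.level
  lo v := -Γ.hi v
  hi v := -Γ.lo v
  win u v := -(Γ.win u v + ε)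

theorem Represents.mirror {W : Type*} {Γ : BarRep W} {ε : ℝ} {E : W → W → Prop}
    (h : Γ.Represents ε E) : (Γ.mirror ε).Represents ε E := by
  obtain ⟨h1, h2, h3, h4⟩ := h
  have hd (a b c d : ℝ) (hab : Disjoint (Set.Icc a b) (Set.Icc c d)) :
      Disjoint (Set.Icc (-b) (-a)) (Set.Icc (-d) (-c)) := by
    rw [Set.disjoint_left] at hab ⊢
    rintro x ⟨x1, x2⟩ ⟨x3, x4⟩
    exact hab (a := -x) ⟨by linarith, by linarith⟩ ⟨by linarith, by linarith⟩
  have hs (a b c d : ℝ) (hab : Set.Icc a b ⊆ Set.Icc c d) :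
      Set.Icc (-b) (-a) ⊆ Set.Icc (-d) (-c) := by
    rintro x ⟨x1, x2⟩
    obtain ⟨y1, y2⟩ := hab (a := -x) ⟨by linarith, by linarith⟩
    exact ⟨by linarith, by linarith⟩
  have key (Γ : BarRep W) (u v : W) (c : ℝ) (hv : Γ.Visible ε u v c) :
      (Γ.mirror ε).Visible ε u v (-(c + ε)) := by
    obtain ⟨v1, v2, v3, v4⟩ := hv
    have e : -(c + ε) + ε = -c := by ring
    rw [Visible, e]
    exact ⟨v1, hs _ _ _ _ v2, hs _ _ _ _ v3, fun w w1 w2 w3 w4 => hd _ _ _ _ (v4 w w1 w2 w3 w4)⟩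
  refine ⟨fun v => neg_lt_neg (h1 v), fun u v huv hl => hd _ _ _ _ (h2 u v huv hl),
    fun u v => (h3 u v).trans ⟨fun ⟨c, hc⟩ => ⟨_, key Γ u v c hc⟩,
      fun ⟨c, hc⟩ => ⟨-(c + ε), ?_⟩⟩, fun u v huv => key Γ u v _ (h4 u v huv)⟩
  -- Reflecting twice gives back the bars, so the forward implication for the mirrored bars is the
  -- converse.
  have := key _ u v c hc
  simpa only [BarRep.mirror, Visible, neg_neg] using this

end BarRep

/-! ## The representation of a wheel and a matching -/

/-- The vertices of a wheel: the hub, a distinguished rim vertex `root`, and the path formed by the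
other rim vertices. -/
inductive WheelNode (m : ℕ) where
  | root : WheelNode m
  | hub : WheelNode m
  | path : Fin m → WheelNode m

/-- The heights of the bars of the path vertices, and the length of the vertical bar of `root`. -/
structure Heights (m : ℕ) where
  y : Fin m → ℕ
  rootTop : ℕ
  two_le : 2 ≤ m
  -- The hub's vertical bar will span `[4, 6]`: height 2 stays below it, 5 reaches its lower half,
  -- and 9 passes it and reaches a path bar that starts at 8.
  rootTop_eq : rootTop = 2 ∨ rootTop = 5 ∨ rootTop = 9
  le_y : ∀ i, 8 ≤ y i
  y_le : ∀ i, y i ≤ 4 * m + 9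
  -- Vertical path bars have length 2, so a difference of 1 makes them overlap and a difference of
  -- at least 3 separates them. In an overlapping pair the left bar is the lower one.
  y_pair : ∀ i j, i < j → y j = y i + 1 ∨ y i + 3 ≤ y j ∨ y j + 3 ≤ y i

namespace Heights

variable {m : ℕ} (D : Heights m)

/-- The edges of the `st`-graph that extends the wheel. -/
def Red : StVertex (WheelNode m) → StVertex (WheelNode m) → Prop
  | .source, .sink => True
  | .source, .inner .root => True
  | .inner .root, .sink => True
  | .inner .root, .inner .hub => True
  | .inner .root, .inner (.path i) => (i : ℕ) = 0 ∨ (i : ℕ) + 1 = m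
  | .inner .hub, .inner (.path _) => True
  | .inner (.path _), .sink => True
  | .inner (.path i), .inner (.path j) =>
    ((i : ℕ) + 1 = j ∨ (j : ℕ) + 1 = i) ∧ D.y i < D.y j
  | _, _ => False

/-- The horizontal bars. -/
noncomputable def redBars : BarRep (StVertex (WheelNode m)) where
  level
    | .source => -(8 * m + 50)
    | .sink => 8 * m + 50
    | .inner .root => 0
    | .inner .hub => 4
    | .inner (.path i) => D.y i
  lo
    | .source => -8
    | .sink => -8
    | .inner .root => -4
    | .inner .hub => 2
    -- Length 6 at spacing 4: consecutive bars overlap in `[4i + 4, 4i + 6]`, and the middle piece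
    -- between `4i + 2` and `4i + 4` belongs to bar `i` alone.
    | .inner (.path i) => 4 * (i : ℕ)
  hi
    | .source => 4 * m + 4
    | .sink => 4 * m + 4
    | .inner .root => 4 * m + 2
    | .inner .hub => 4 * m - 1
    | .inner (.path i) => 4 * (i : ℕ) + 6
  win
    | .source, .sink => -6
    | .source, _ => -1
    | .inner .root, .sink => -1
    -- The hub's bar is `[2, 4m - 1]`; `root` sees the two ends of the path on either side of it.
    | .inner .root, .inner (.path i) => if (i : ℕ) = 0 then 1 else 4 * m + 1
    | .inner .root, _ => 3
    | .inner .hub, .inner (.path i) => 4 * (i : ℕ) + 5 / 2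
    | .inner (.path i), .inner (.path j) => 4 * (min i j : ℕ) + 5
    | .inner (.path i), _ => 4 * (i : ℕ) + 3
    | _, _ => 0

/-- The edges of the `st`-graph that extends the matching. -/
def Blue : StVertex (WheelNode m) → StVertex (WheelNode m) → Prop
  | .source, .sink => True
  | .source, .inner .hub => D.rootTop ≠ 9
  | .source, .inner _ => True
  | .inner _, .sink => True
  | .inner .root, .inner .hub => D.rootTop ≠ 2
  | .inner .root, .inner (.path i) => D.rootTop = 9 ∧ D.y i = 8
  | .inner (.path i), .inner (.path j) => i < j ∧ D.y j = D.y i + 1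
  | _, _ => False

/-- The vertical bars. -/
noncomputable def blueBars : BarRep (StVertex (WheelNode m)) where
  level
    | .source => -(8 * m + 50)
    | .sink => 8 * m + 50
    | .inner v => D.redBars.lo (.inner v)
  lo
    | .source => -8
    | .sink => -8
    | .inner v => D.redBars.level (.inner v)
  hi
    | .source => 4 * m + 16
    | .sink => 4 * m + 16
    | .inner .root => D.rootTop
    | .inner .hub => 6
    | .inner (.path i) => D.y i + 2
  win
    | .source, .sink => -6
    -- In an overlapping pair of path bars, the upper half of the right bar is free towards the
    -- source, the lower half of the left bar is free towards the sink, and the lower half of the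
    -- right bar is where the two see each other.
    | .source, .inner v => D.redBars.level (.inner v) + 3 / 2
    | .inner _, .inner v => D.redBars.level (.inner v) + 1 / 2
    | .inner v, _ => D.redBars.level (.inner v) + 1 / 2
    | _, _ => 0

theorem two_le_cast (D : Heights m) : (2 : ℝ) ≤ m := by exact_mod_cast D.two_le

theorem le_y_cast (i : Fin m) : (8 : ℝ) ≤ D.y i := by exact_mod_cast D.le_y i

theorem y_le_cast (i : Fin m) : (D.y i : ℝ) ≤ 4 * m + 9 := by exact_mod_cast D.y_le i

theorem idx_cast (i : Fin m) : (0 : ℝ) ≤ (i : ℕ) ∧ ((i : ℕ) : ℝ) + 1 ≤ m :=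
  ⟨by positivity, by exact_mod_cast i.2⟩

theorem rootTop_cast : (D.rootTop : ℝ) = 2 ∨ (D.rootTop : ℝ) = 5 ∨ (D.rootTop : ℝ) = 9 := by
  exact_mod_cast D.rootTop_eq

theorem idx_lt_cast {i j : Fin m} (h : i < j) : ((i : ℕ) : ℝ) + 1 ≤ (j : ℕ) := by
  exact_mod_cast h

theorem y_pair_cast {i j : Fin m} (h : i < j) : (D.y j : ℝ) = D.y i + 1 ∨
    (D.y i : ℝ) + 3 ≤ D.y j ∨ (D.y j : ℝ) + 3 ≤ D.y i := by
  exact_mod_cast D.y_pair i j h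

theorem y_injective : Function.Injective D.y := by
  intro i j hij
  by_contra hne
  rcases lt_or_gt_of_ne hne with h | h
  · have := D.y_pair i j h; omega
  · have := D.y_pair j i h; omega

theorem sep_cast {i j : Fin m} (h : ¬ i = j) :
    ((i : ℕ) : ℝ) + 1 ≤ (j : ℕ) ∨ ((j : ℕ) : ℝ) + 1 ≤ (i : ℕ) := by
  rcases lt_or_gt_of_ne h with h | h
  · exact .inl (idx_lt_cast h)
  · exact .inr (idx_lt_cast h)

theorem red_win_root {j : Fin m} (h : D.Red (.inner .root) (.inner (.path j))) :
    (((j : ℕ) : ℝ) = 0 ∧ D.redBars.win (.inner .root) (.inner (.path j)) = 1) ∨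
      (((j : ℕ) : ℝ) + 1 = m ∧
        D.redBars.win (.inner .root) (.inner (.path j)) = 4 * m + 1) := by
  have := D.two_le
  rcases h with h | h
  · exact .inl ⟨by exact_mod_cast h, by simp only [redBars, if_pos h]⟩
  · have h0 : ¬ (j : ℕ) = 0 := by omega
    exact .inr ⟨by exact_mod_cast h, by simp only [redBars, if_neg h0]⟩

theorem red_win_path {i j : Fin m} (h : D.Red (.inner (.path i)) (.inner (.path j))) :
    (((j : ℕ) : ℝ) = (i : ℕ) + 1 ∧
      D.redBars.win (.inner (.path i)) (.inner (.path j)) = 4 * (i : ℕ) + 5) ∨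
    (((i : ℕ) : ℝ) = (j : ℕ) + 1 ∧
      D.redBars.win (.inner (.path i)) (.inner (.path j)) = 4 * (j : ℕ) + 5) := by
  rcases h.1 with h | h
  · refine .inl ⟨by exact_mod_cast h.symm, ?_⟩
    simp only [redBars, min_eq_left (show (i : ℕ) ≤ j by omega)]
  · refine .inr ⟨by exact_mod_cast h.symm, ?_⟩
    simp only [redBars, min_eq_right (show (j : ℕ) ≤ i by omega)]

theorem red_visible_win {u v : StVertex (WheelNode m)} (h : D.Red u v) :
    D.redBars.Visible (1 / 4) u v (D.redBars.win u v) := by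
  have hm := D.two_le_cast
  rcases u with _ | _ | _ | _ | i <;> rcases v with _ | _ | _ | _ | j
  all_goals
    try have hi := idx_cast i
    try have hi' := D.le_y_cast i
    try have hi'' := D.y_le_cast i
    try have hj := idx_cast j
    try have hj' := D.le_y_cast j
    try have hj'' := D.y_le_cast j
    try have hw := D.red_win_root h
    try have hw := D.red_win_path h
    try have hy : (D.y i : ℝ) < D.y j := by exact_mod_cast h.2
    try rcases hw with ⟨hij, hw⟩ | ⟨hij, hw⟩
    all_goals try rw [hw]
    all_goals simp only [Red] at h
  all_goals refine BarRep.visible_of ?_ ?_ ?_ ?_ ?_ ?_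
  all_goals try rintro (_ | _ | _ | _ | k)
  all_goals try have hk := idx_cast k
  all_goals try have hk' := D.le_y_cast k
  all_goals try have hk'' := D.y_le_cast k
  all_goals simp only [redBars, ne_eq, not_true_eq_false, not_false_eq_true, reduceCtorEq,
    StVertex.inner.injEq, WheelNode.path.injEq, IsEmpty.forall_iff, forall_true_left,
    imp_self]
  all_goals try linarith
  all_goals intros
  all_goals try have hki := sep_cast (i := k) (j := i) (by assumption)
  all_goals try have hkj := sep_cast (i := k) (j := j) (by assumption)
  all_goals try rcases hki with hki | hki
  all_goals try rcases hkj with hkj | hkj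
  all_goals first
    | exact .inl (by linarith)
    | exact .inr (by linarith)

/-- For each excluded pair of overlapping bars a blocking bar is exhibited: `root` above the source,
the hub below the inner path bars, the path bars above the hub. -/
theorem red_of_visible {u v : StVertex (WheelNode m)} {c : ℝ}
    (h : D.redBars.Visible (1 / 4) u v c) : D.Red u v := by
  have hm := D.two_le_cast
  obtain ⟨hl, hu, hu', hv, hv', hw⟩ := h.bounds (by norm_num)
  rcases u with _ | _ | _ | _ | i <;> rcases v with _ | _ | _ | _ | j
  all_goals
    try have hi := idx_cast i
    try have hi' := D.le_y_cast i
    try have hi'' := D.y_le_cast i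
    try have hj := idx_cast j
    try have hj' := D.le_y_cast j
    try have hj'' := D.y_le_cast j
  all_goals simp only [redBars] at hl hu hu' hv hv'
  all_goals simp only [Red]
  all_goals try linarith
  · have := hw (.inner .root) (by simp) (by simp) (by simp only [redBars]; linarith)
      (by simp only [redBars]; linarith) (by simp only [redBars]; linarith)
    simp only [redBars] at this
    linarith
  · have := hw (.inner .root) (by simp) (by simp) (by simp only [redBars]; linarith)
      (by simp only [redBars]; linarith) (by simp only [redBars]; linarith)
    simp only [redBars] at this
    linarith
  -- The bar of a path vertex other than the two ends lies over coordinates covered by the hub, as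
  -- far as a window can start there.
  · by_contra! hne
    have h1 : (1 : ℝ) ≤ (j : ℕ) := by exact_mod_cast Nat.one_le_iff_ne_zero.2 hne.1
    have h2 : ((j : ℕ) : ℝ) + 2 ≤ m := by exact_mod_cast (show (j : ℕ) + 2 ≤ m by omega)
    have := hw (.inner .hub) (by simp) (by simp) (by simp only [redBars]; linarith)
      (by simp only [redBars]; linarith) (by simp only [redBars]; linarith)
    simp only [redBars] at this
    linarith
  -- The path bars cover everything above the hub; the bar with index `⌊c / 4⌋` contains `c` and
  -- blocks the view to the sink.
  · have h0 : 0 ≤ c / 4 := by linarith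
    have h1 := Nat.floor_le h0
    have h2 := Nat.lt_floor_add_one (c / 4)
    have h3 : ⌊c / 4⌋₊ < m := (Nat.floor_lt h0).2 (by linarith)
    have hk := D.le_y_cast ⟨_, h3⟩
    have hk' := D.y_le_cast ⟨_, h3⟩
    have := hw (.inner (.path ⟨_, h3⟩)) (by simp) (by simp) (by simp only [redBars]; linarith)
      (by simp only [redBars]; linarith) (by simp only [redBars]; linarith)
    simp only [redBars] at this
    linarith
  · have hy : D.y i < D.y j := by exact_mod_cast hl
    have h1 : (i : ℕ) < j + 2 := by
      have : ((i : ℕ) : ℝ) < (j : ℕ) + 2 := by linarith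
      exact_mod_cast this
    have h2 : (j : ℕ) < i + 2 := by
      have : ((j : ℕ) : ℝ) < (i : ℕ) + 2 := by linarith
      exact_mod_cast this
    have h3 : (i : ℕ) ≠ j := by
      intro h
      rw [Fin.ext h] at hy
      exact hy.false
    exact ⟨by omega, hy⟩

theorem red_represents : D.redBars.Represents (1 / 4) D.Red := by
  have hm := D.two_le_cast
  refine ⟨?_, ?_, fun u v => ⟨fun h => ⟨_, D.red_visible_win h⟩, fun ⟨c, h⟩ => D.red_of_visible h⟩,
    fun u v h => D.red_visible_win h⟩
  · rintro (_ | _ | _ | _ | i) <;> simp only [redBars] <;> linarith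
  · rintro u v hne hl
    exfalso
    rcases u with _ | _ | _ | _ | i <;> rcases v with _ | _ | _ | _ | j
    all_goals
      try have hi := D.le_y_cast i
      try have hi' := D.y_le_cast i
      try have hj := D.le_y_cast j
      try have hj' := D.y_le_cast j
    all_goals simp only [redBars, ne_eq, not_true_eq_false] at hl hne
    all_goals try linarith
    rw [Nat.cast_inj] at hl
    exact hne (by rw [D.y_injective hl])

theorem y_sep {i k : Fin m} (h : ¬ k = i) : (D.y k : ℝ) = D.y i + 1 ∧ ((i : ℕ) : ℝ) + 1 ≤ (k : ℕ) ∨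
    (D.y i : ℝ) = D.y k + 1 ∧ ((k : ℕ) : ℝ) + 1 ≤ (i : ℕ) ∨ (D.y i : ℝ) + 3 ≤ D.y k ∨
    (D.y k : ℝ) + 3 ≤ D.y i := by
  rcases lt_or_gt_of_ne h with h | h
  · rcases D.y_pair_cast h with h' | h' | h'
    · exact .inr (.inl ⟨h', idx_lt_cast h⟩)
    · exact .inr (.inr (.inr h'))
    · exact .inr (.inr (.inl h'))
  · rcases D.y_pair_cast h with h' | h' | h'
    · exact .inl ⟨h', idx_lt_cast h⟩
    · exact .inr (.inr (.inl h'))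
    · exact .inr (.inr (.inr h'))

theorem blue_visible_win {u v : StVertex (WheelNode m)} (h : D.Blue u v) :
    D.blueBars.Visible (1 / 4) u v (D.blueBars.win u v) := by
  have hm := D.two_le_cast
  have hτ : (D.rootTop : ℝ) ≤ 9 := by rcases D.rootTop_cast with h | h | h <;> linarith
  have hτ' : (2 : ℝ) ≤ D.rootTop := by rcases D.rootTop_cast with h | h | h <;> linarith
  have h9 (h : D.rootTop ≠ 9) : (D.rootTop : ℝ) ≤ 5 := by
    have : D.rootTop ≤ 5 := by rcases D.rootTop_eq with h' | h' | h' <;> omega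
    exact_mod_cast this
  have h2 (h : D.rootTop ≠ 2) : (5 : ℝ) ≤ D.rootTop := by
    have : 5 ≤ D.rootTop := by rcases D.rootTop_eq with h' | h' | h' <;> omega
    exact_mod_cast this
  rcases u with _ | _ | _ | _ | i <;> rcases v with _ | _ | _ | _ | j
  all_goals
    try have hi := idx_cast i
    try have hi' := D.le_y_cast i
    try have hi'' := D.y_le_cast i
    try have hj := idx_cast j
    try have hj' := D.le_y_cast j
    try have hj'' := D.y_le_cast j
    simp only [Blue] at h
    try have hτ9 := h9 h
    try have hτ2 := h2 h
    try have hτ3 : (D.rootTop : ℝ) = 9 := by exact_mod_cast h.1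
    try have hy8 : (D.y j : ℝ) = 8 := by exact_mod_cast h.2
    try have hij := idx_lt_cast h.1
    try have hy : (D.y j : ℝ) = D.y i + 1 := by exact_mod_cast h.2
  all_goals refine BarRep.visible_of ?_ ?_ ?_ ?_ ?_ ?_
  all_goals try rintro (_ | _ | _ | _ | k)
  all_goals try have hk := idx_cast k
  all_goals try have hk' := D.le_y_cast k
  all_goals try have hk'' := D.y_le_cast k
  all_goals simp only [blueBars, redBars, ne_eq, not_true_eq_false, not_false_eq_true, reduceCtorEq,
    StVertex.inner.injEq, WheelNode.path.injEq, IsEmpty.forall_iff, forall_true_left,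
    imp_self]
  all_goals try linarith
  all_goals intros
  all_goals try have hki := D.y_sep (k := k) (i := i) (by assumption)
  all_goals try have hkj := D.y_sep (k := k) (i := j) (by assumption)
  all_goals try rcases hki with ⟨hki, hki'⟩ | ⟨hki, hki'⟩ | hki | hki
  all_goals try rcases hkj with ⟨hkj, hkj'⟩ | ⟨hkj, hkj'⟩ | hkj | hkj
  all_goals first
    | exact .inl (by linarith)
    | exact .inr (by linarith)

theorem blue_of_visible {u v : StVertex (WheelNode m)} {c : ℝ}
    (h : D.blueBars.Visible (1 / 4) u v c) : D.Blue u v := by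
  have hm := D.two_le_cast
  have hτ : (D.rootTop : ℝ) ≤ 9 := by rcases D.rootTop_cast with h | h | h <;> linarith
  have hτ' : (2 : ℝ) ≤ D.rootTop := by rcases D.rootTop_cast with h | h | h <;> linarith
  obtain ⟨hl, hu, hu', hv, hv', hw⟩ := h.bounds (by norm_num)
  rcases u with _ | _ | _ | _ | i <;> rcases v with _ | _ | _ | _ | j
  all_goals
    try have hi := idx_cast i
    try have hi' := D.le_y_cast i
    try have hi'' := D.y_le_cast i
    try have hj := idx_cast j
    try have hj' := D.le_y_cast j
    try have hj'' := D.y_le_cast j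
  all_goals simp only [blueBars, redBars] at hl hu hu' hv hv'
  all_goals simp only [Blue]
  all_goals try linarith
  -- A bar of `root` up to 9 hides the whole vertical bar of the hub from the source.
  · intro h9
    have h9' : (D.rootTop : ℝ) = 9 := by exact_mod_cast h9
    have := hw (.inner .root) (by simp) (by simp) (by simp only [blueBars, redBars]; linarith)
      (by simp only [blueBars, redBars]; linarith) (by simp only [blueBars, redBars]; linarith)
    simp only [blueBars] at this
    linarith
  · intro h2
    have h2' : (D.rootTop : ℝ) = 2 := by exact_mod_cast h2
    linarith
  · have h8 : D.rootTop = 9 := by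
      have : (5 : ℝ) < D.rootTop := by linarith
      have : 5 < D.rootTop := by exact_mod_cast this
      rcases D.rootTop_eq with h | h | h <;> omega
    refine ⟨h8, ?_⟩
    have : (D.y j : ℝ) < 9 := by linarith
    have : D.y j < 9 := by exact_mod_cast this
    have := D.le_y j
    omega
  · have hlt : i < j := by
      have : ((i : ℕ) : ℝ) < (j : ℕ) := by linarith
      exact_mod_cast this
    refine ⟨hlt, ?_⟩
    have : (D.y j : ℝ) = D.y i + 1 := by
      rcases D.y_pair_cast hlt with h | h | h
      · exact h
      · linarith
      · linarith
    exact_mod_cast this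

theorem blue_represents : D.blueBars.Represents (1 / 4) D.Blue := by
  have hm := D.two_le_cast
  have hτ : (2 : ℝ) ≤ D.rootTop := by rcases D.rootTop_cast with h | h | h <;> linarith
  refine ⟨?_, ?_, fun u v => ⟨fun h => ⟨_, D.blue_visible_win h⟩,
    fun ⟨c, h⟩ => D.blue_of_visible h⟩, fun u v h => D.blue_visible_win h⟩
  · rintro (_ | _ | _ | _ | i) <;> simp only [blueBars, redBars] <;> linarith
  · rintro u v hne hl
    exfalso
    rcases u with _ | _ | _ | _ | i <;> rcases v with _ | _ | _ | _ | j
    all_goals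
      try have hi := idx_cast i
      try have hj := idx_cast j
    all_goals simp only [blueBars, redBars, ne_eq, not_true_eq_false] at hl hne
    all_goals try linarith
    · have : (2 : ℕ) = 4 * (j : ℕ) := by exact_mod_cast hl
      omega
    · have : 4 * (i : ℕ) = 2 := by exact_mod_cast hl
      omega
    · have : 4 * (i : ℕ) = 4 * (j : ℕ) := by exact_mod_cast hl
      exact hne (by rw [Fin.ext (show (i : ℕ) = j by omega)])

end Heights
end SimVis
namespace SimVis

/-- Relabelling of the vertices other than the dummy vertices. -/
def StVertex.congr {V V' : Type*} (k : V ≃ V') : StVertex V ≃ StVertex V' where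
  toFun
    | .source => .source
    | .sink => .sink
    | .inner v => .inner (k v)
  invFun
    | .source => .source
    | .sink => .sink
    | .inner v => .inner (k.symm v)
  left_inv := by rintro (_ | _ | v) <;> simp
  right_inv := by rintro (_ | _ | v) <;> simp

/-! ### Invariance under relabelling, and disjointness of L-shapes -/

namespace BarRep

/-- Relabelling of fans. -/
def Fans.comap {W W' : Type*} (e : W → W') (F : Fans W') : Fans W where
  anchor v := F.anchor (e v)
  bot v := F.bot (e v)
  top v := F.top (e v)

variable {V V' : Type*} {Γ H : BarRep (StVertex V')} {F G : Fans (StVertex V')}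
  {ε N T δ : ℝ} {E E' : StVertex V' → StVertex V' → Prop}

theorem StBars.comap (h : Γ.StBars F ε E) (k : V ≃ V') :
    (Γ.comap (StVertex.congr k)).StBars (F.comap (StVertex.congr k)) ε
      (fun u v => E (StVertex.congr k u) (StVertex.congr k v)) where
  nonneg := h.nonneg
  represents := h.represents.comap _
  anchor_mem v := h.anchor_mem _
  bot_lt v := h.bot_lt _
  lt_top v := h.lt_top _
  sep u v := h.sep _ _
  source_lt v hv := h.source_lt _ ((StVertex.congr k).injective.ne hv)
  lt_sink v hv := h.lt_sink _ ((StVertex.congr k).injective.ne hv)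
  exists_in v hv := by
    obtain ⟨u, hu⟩ := h.exists_in _ ((StVertex.congr k).injective.ne hv)
    obtain ⟨u, rfl⟩ := (StVertex.congr k).surjective u
    exact ⟨u, hu⟩
  exists_out v hv := by
    obtain ⟨u, hu⟩ := h.exists_out _ ((StVertex.congr k).injective.ne hv)
    obtain ⟨u, rfl⟩ := (StVertex.congr k).surjective u
    exact ⟨u, hu⟩
  source_sink := h.source_sink
  lt_hi_source v := h.lt_hi_source _
  lo_lt_sink v := h.lo_lt_sink _

theorem Boxed.comap (h : Γ.Boxed F E N T) (k : V ≃ V') :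
    (Γ.comap (StVertex.congr k)).Boxed (F.comap (StVertex.congr k))
      (fun u v => E (StVertex.congr k u) (StVertex.congr k v)) N T where
  lt := h.lt
  anchor_source := h.anchor_source
  anchor_sink := h.anchor_sink
  level_source := h.level_source
  level_sink := h.level_sink
  inner _ := h.inner _
  bends _ _ := h.bends _ _

theorem Compatible.comap (h : Compatible H Γ F G E E' δ) (k : V ≃ V') :
    Compatible (H.comap (StVertex.congr k)) (Γ.comap (StVertex.congr k))
      (F.comap (StVertex.congr k)) (G.comap (StVertex.congr k))
      (fun u v => E (StVertex.congr k u) (StVertex.congr k v))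
      (fun u v => E' (StVertex.congr k u) (StVertex.congr k v)) δ where
  corner _ := h.corner _
  anchor _ := h.anchor _
  fan _ := h.fan _
  win _ _ _ := h.win _ _ _
  win' _ _ _ := h.win' _ _ _
  strips w w' hw := h.strips _ _ fun v hv hv' => by
    obtain ⟨x, rfl⟩ := k.surjective v
    exact hw x ((StVertex.congr k).injective hv) ((StVertex.congr k).injective hv')

/-- Compatible bars give disjoint L-shapes. -/
theorem Compatible.disjoint_lShape {K : BarRep (StVertex V')}
    (c : Compatible H (K.mirror ε) F G E E' δ) (h : H.StBars F ε E)
    (h' : (K.mirror ε).StBars G ε E') {u v : V'} (huv : u ≠ v) :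
    Disjoint (lShape H K u) (lShape H K v) := by
  have hne : (StVertex.inner u : StVertex V') ≠ .inner v := by simpa using huv
  have cross (u v : V') (huv : u ≠ v) (x y : ℝ)
      (hx : x ∈ Set.Icc (H.lo (.inner u)) (H.hi (.inner u))) (hy : y = H.level (.inner u))
      (hx' : x = K.level (.inner v)) (hy' : y ∈ Set.Icc (K.lo (.inner v)) (K.hi (.inner v))) :
      False := by
    have q := c.strips (.inner u) (.inner v) fun w hw hw' =>
      huv (StVertex.inner.inj (hw.trans hw'.symm))
    have b1 : G.bot (.inner v) < K.level (.inner v) := h'.bot_lt (.inner v)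
    have b2 : K.level (.inner v) < G.top (.inner v) := h'.lt_top (.inner v)
    have b3 := h.bot_lt (.inner u)
    have b4 := h.lt_top (.inner u)
    simp only [BarRep.mirror, neg_neg] at q
    rcases q with q | q | q | q <;> linarith [hx.1, hx.2, hy'.1, hy'.2]
  rw [Set.disjoint_left]
  rintro ⟨x, y⟩ (⟨hx, hy⟩ | ⟨hx, hy⟩) (⟨hx', hy'⟩ | ⟨hx', hy'⟩)
  · have hl : H.level (.inner u) = H.level (.inner v) := Eq.trans (Eq.symm hy) hy'
    exact Set.disjoint_left.1 (h.represents.2.1 _ _ hne hl) hx hx'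
  · exact cross u v huv x y hx hy hx' hy'
  · exact cross v u huv.symm x y hx' hy' hx hy
  · have hl : K.level (.inner u) = K.level (.inner v) := Eq.trans (Eq.symm hx) hx'
    have hd := Set.disjoint_left.1 (h'.represents.2.1 _ _ hne hl)
    exact @hd (-y) ⟨neg_le_neg hy.2, neg_le_neg hy.1⟩ ⟨neg_le_neg hy'.2, neg_le_neg hy'.1⟩

end BarRep

/-! ### Strips around the bars of the wheel and the matching -/

namespace Heights

variable {m : ℕ} (D : Heights m)

/-- Fans of height `1 / 8` at the vertices of the wheel. -/
noncomputable def fans (Γ : BarRep (StVertex (WheelNode m))) (a : WheelNode m → ℝ) :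
    BarRep.Fans (StVertex (WheelNode m)) where
  anchor
    | .source => 0
    | .sink => 0
    | .inner v => a v
  bot
    | .source => -(8 * m + 51)
    | .sink => 4 * m + 18
    | .inner v => Γ.level (.inner v) - 1 / 8
  top
    | .source => -10
    | .sink => 8 * m + 51
    | .inner v => Γ.level (.inner v) + 1 / 8

noncomputable def redFans : BarRep.Fans (StVertex (WheelNode m)) :=
  fans D.redBars fun v => D.redBars.lo (.inner v)

noncomputable def blueFans : BarRep.Fans (StVertex (WheelNode m)) :=
  fans D.blueBars fun v => -D.blueBars.lo (.inner v)

theorem y_lt_cast {i j : Fin m} (h : (D.y i : ℝ) < D.y j) : (D.y i : ℝ) + 1 ≤ D.y j := by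
  have : D.y i < D.y j := by exact_mod_cast h
  exact_mod_cast this

theorem red_stBars : D.redBars.StBars D.redFans (1 / 4) D.Red := by
  have hm := D.two_le_cast
  have m0 : 0 < m := by have := D.two_le; omega
  refine
    { nonneg := by norm_num
      represents := D.red_represents
      anchor_mem := ?_
      bot_lt := ?_
      lt_top := ?_
      sep := ?_
      source_lt := ?_
      lt_sink := ?_
      exists_in := ?_
      exists_out := ?_
      source_sink := trivial
      lt_hi_source := ?_
      lo_lt_sink := ?_ }
  · rintro (_ | _ | v)
    · simp only [redFans, fans, redBars]
      constructor <;> linarith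
    · simp only [redFans, fans, redBars]
      constructor <;> linarith
    · exact ⟨le_rfl, (D.red_represents.1 _).le⟩
  · rintro (_ | _ | v) <;> simp only [redFans, fans, redBars] <;> linarith
  · rintro (_ | _ | v) <;> simp only [redFans, fans, redBars] <;> linarith
  · intro u v hl
    rcases u with _ | _ | _ | _ | i <;> rcases v with _ | _ | _ | _ | j
    all_goals
      try have hi := D.le_y_cast i
      try have hi' := D.y_le_cast i
      try have hj := D.le_y_cast j
      try have hj' := D.y_le_cast j
    all_goals simp only [redFans, fans, redBars] at hl ⊢
    all_goals try linarith
    linarith [D.y_lt_cast hl]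
  · rintro (_ | _ | _ | _ | i) hne
    all_goals try have hi := D.le_y_cast i
    all_goals simp only [redBars, ne_eq, not_true_eq_false] at hne ⊢
    all_goals linarith
  · rintro (_ | _ | _ | _ | i) hne
    all_goals try have hi := D.y_le_cast i
    all_goals simp only [redBars, ne_eq, not_true_eq_false] at hne ⊢
    all_goals linarith
  · rintro (_ | _ | _ | _ | i) hne
    · exact absurd rfl hne
    · exact ⟨.source, trivial⟩
    · exact ⟨.source, trivial⟩
    · exact ⟨.inner .root, trivial⟩
    · exact ⟨.inner .hub, trivial⟩
  · rintro (_ | _ | _ | _ | i) hne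
    · exact ⟨.sink, trivial⟩
    · exact absurd rfl hne
    · exact ⟨.sink, trivial⟩
    · exact ⟨.inner (.path ⟨0, m0⟩), trivial⟩
    · exact ⟨.sink, trivial⟩
  · rintro (_ | _ | _ | _ | i) h
    all_goals simp only [Red] at h
    all_goals simp only [redBars]
    all_goals linarith
  · rintro (_ | _ | _ | _ | i) h
    all_goals try have hi := idx_cast i
    all_goals simp only [Red] at h
    all_goals simp only [redBars]
    all_goals linarith

theorem blue_stBars : (D.blueBars.mirror (1 / 4)).StBars D.blueFans (1 / 4) D.Blue := by
  have hm := D.two_le_cast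
  have hr := D.blue_represents
  refine
    { nonneg := by norm_num
      represents := hr.mirror
      anchor_mem := ?_
      bot_lt := ?_
      lt_top := ?_
      sep := ?_
      source_lt := ?_
      lt_sink := ?_
      exists_in := ?_
      exists_out := ?_
      source_sink := trivial
      lt_hi_source := ?_
      lo_lt_sink := ?_ }
  · rintro (_ | _ | v)
    · simp only [blueFans, fans, blueBars, BarRep.mirror]
      constructor <;> linarith
    · simp only [blueFans, fans, blueBars, BarRep.mirror]
      constructor <;> linarith
    · exact ⟨neg_le_neg (hr.1 _).le, le_rfl⟩
  · rintro (_ | _ | v) <;> simp only [blueFans, fans, blueBars, BarRep.mirror] <;> linarith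
  · rintro (_ | _ | v) <;> simp only [blueFans, fans, blueBars, BarRep.mirror] <;> linarith
  · intro u v hl
    rcases u with _ | _ | _ | _ | i <;> rcases v with _ | _ | _ | _ | j
    all_goals
      try have hi := idx_cast i
      try have hj := idx_cast j
    all_goals simp only [blueFans, fans, blueBars, redBars, BarRep.mirror] at hl ⊢
    all_goals try linarith
    -- The hub's vertical bar is at 2 and the path bars are at multiples of 4, so different levels
    -- differ by at least 2, far more than the strips need.
    · have h1 : (1 : ℝ) ≤ (j : ℕ) := by
        have : 2 < 4 * (j : ℕ) := by exact_mod_cast hl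
        exact_mod_cast (show 1 ≤ (j : ℕ) by omega)
      linarith
    · have h1 : ((i : ℕ) : ℝ) = 0 := by
        have : 4 * (i : ℕ) < 2 := by exact_mod_cast hl
        exact_mod_cast (show (i : ℕ) = 0 by omega)
      linarith
    · have h1 : ((i : ℕ) : ℝ) + 1 ≤ (j : ℕ) := by
        have : 4 * (i : ℕ) < 4 * j := by exact_mod_cast hl
        exact_mod_cast (show (i : ℕ) + 1 ≤ j by omega)
      linarith
  · rintro (_ | _ | _ | _ | i) hne
    all_goals try have hi := idx_cast i
    all_goals simp only [blueBars, redBars, BarRep.mirror, ne_eq, not_true_eq_false] at hne ⊢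
    all_goals linarith
  · rintro (_ | _ | _ | _ | i) hne
    all_goals try have hi := idx_cast i
    all_goals simp only [blueBars, redBars, BarRep.mirror, ne_eq, not_true_eq_false] at hne ⊢
    all_goals linarith
  · rintro (_ | _ | _ | _ | i) hne
    · exact absurd rfl hne
    · exact ⟨.source, trivial⟩
    · exact ⟨.source, trivial⟩
    · by_cases h9 : D.rootTop = 9
      · refine ⟨.inner .root, ?_⟩
        simp only [Blue, h9]
        decide
      · exact ⟨.source, h9⟩
    · exact ⟨.source, trivial⟩
  · rintro (_ | _ | v) hne
    · exact ⟨.sink, trivial⟩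
    · exact absurd rfl hne
    · exact ⟨.sink, by cases v <;> trivial⟩
  · rintro (_ | _ | _ | _ | i) h
    all_goals try have hi := D.le_y_cast i
    all_goals simp only [Blue] at h
    all_goals simp only [blueBars, redBars, BarRep.mirror]
    all_goals linarith
  · rintro (_ | _ | _ | _ | i) h
    all_goals try have hi := D.y_le_cast i
    all_goals simp only [Blue] at h
    all_goals simp only [blueBars, redBars, BarRep.mirror]
    all_goals linarith

theorem red_boxed : D.redBars.Boxed D.redFans D.Red (4 * m + 20) (8 * m + 50) := by
  have hm := D.two_le_cast
  refine ⟨by linarith, rfl, rfl, rfl, rfl, ?_, ?_⟩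
  · rintro (_ | _ | i)
    all_goals try have hi := idx_cast i
    all_goals try have hi' := D.le_y_cast i
    all_goals try have hi'' := D.y_le_cast i
    all_goals simp only [redFans, fans, redBars, abs_le]
    all_goals refine ⟨⟨?_, ?_⟩, ?_, ?_⟩ <;> linarith
  · intro u v h
    rcases u with _ | _ | _ | _ | i <;> rcases v with _ | _ | _ | _ | j
    all_goals
      try have hi := idx_cast i
      try have hi' := D.le_y_cast i
      try have hi'' := D.y_le_cast i
      try have hj := idx_cast j
      try have hj' := D.le_y_cast j
      try have hj'' := D.y_le_cast j
      try have hw := D.red_win_root h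
      try have hw := D.red_win_path h
      try rcases hw with ⟨hij, hw⟩ | ⟨hij, hw⟩
      all_goals try rw [hw]
      all_goals simp only [Red] at h
    all_goals simp only [redFans, fans, redBars, abs_le]
    all_goals refine ⟨⟨?_, ?_⟩, ⟨?_, ?_⟩, ?_, ?_⟩ <;> linarith

theorem blue_boxed :
    (D.blueBars.mirror (1 / 4)).Boxed D.blueFans D.Blue (4 * m + 20) (8 * m + 50) := by
  have hm := D.two_le_cast
  refine ⟨by linarith, rfl, rfl, rfl, rfl, ?_, ?_⟩
  · rintro (_ | _ | i)
    all_goals try have hi := idx_cast i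
    all_goals try have hi' := D.le_y_cast i
    all_goals try have hi'' := D.y_le_cast i
    all_goals simp only [blueFans, fans, blueBars, redBars, BarRep.mirror, abs_le]
    all_goals refine ⟨⟨?_, ?_⟩, ?_, ?_⟩ <;> linarith
  · intro u v h
    rcases u with _ | _ | _ | _ | i <;> rcases v with _ | _ | _ | _ | j
    all_goals
      try have hi := idx_cast i
      try have hi' := D.le_y_cast i
      try have hi'' := D.y_le_cast i
      try have hj := idx_cast j
      try have hj' := D.le_y_cast j
      try have hj'' := D.y_le_cast j
    all_goals simp only [Blue] at h
    all_goals simp only [blueFans, fans, blueBars, redBars, BarRep.mirror, abs_le]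
    all_goals refine ⟨⟨?_, ?_⟩, ⟨?_, ?_⟩, ?_, ?_⟩ <;> linarith

/-- Strips reach only 1/8 from an integer height, whereas the windows stay 1/4 away from the
integers. -/
theorem nat_clear (a b : ℕ) : ((a : ℝ) + 3 / 4 < b - 1 / 8 ∨ (b : ℝ) + 1 / 8 < a + 3 / 4) ∧
    ((a : ℝ) + 7 / 4 < b - 1 / 8 ∨ (b : ℝ) + 1 / 8 < a + 7 / 4) := by
  refine ⟨?_, ?_⟩
  · rcases le_or_gt b a with h | h
    · have : (b : ℝ) ≤ a := by exact_mod_cast h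
      exact .inr (by linarith)
    · have : (a : ℝ) + 1 ≤ b := by exact_mod_cast h
      exact .inl (by linarith)
  · rcases le_or_gt b (a + 1) with h | h
    · have : (b : ℝ) ≤ a + 1 := by exact_mod_cast h
      exact .inr (by linarith)
    · have : (a : ℝ) + 2 ≤ b := by exact_mod_cast h
      exact .inl (by linarith)

theorem exists_level (v : WheelNode m) :
    ∃ a : ℕ, D.redBars.level (.inner v) = a ∧ a ≤ 4 * m + 9 := by
  rcases v with _ | _ | i
  · exact ⟨0, by simp [redBars], by omega⟩
  · exact ⟨4, by simp [redBars], by omega⟩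
  · exact ⟨D.y i, rfl, D.y_le i⟩

/-- The summand `1 / 4` is the thickness: `mirror` makes the other end of the visibility segment the
start of the window, hence the fractional part 3/4 except for the source-sink edge, which runs below
all L-shapes. -/
theorem blue_win_clear {u v : StVertex (WheelNode m)} (h : D.Blue u v)
    (w : StVertex (WheelNode m)) : D.blueBars.win u v + 1 / 4 < D.redFans.bot w ∨
      D.redFans.top w < D.blueBars.win u v + 1 / 4 := by
  have hm := D.two_le_cast
  have key : (∃ a : ℕ, a ≤ 4 * m + 9 ∧ (D.blueBars.win u v + 1 / 4 = a + 3 / 4 ∨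
      D.blueBars.win u v + 1 / 4 = a + 7 / 4)) ∨ D.blueBars.win u v = -6 := by
    rcases u with _ | _ | u <;> rcases v with _ | _ | v <;> simp only [Blue] at h
    · exact .inr rfl
    · obtain ⟨a, ha, ha'⟩ := D.exists_level v
      refine .inl ⟨a, ha', .inr ?_⟩
      simp only [blueBars, ha]; ring
    · obtain ⟨a, ha, ha'⟩ := D.exists_level u
      refine .inl ⟨a, ha', .inl ?_⟩
      simp only [blueBars, ha]; ring
    · obtain ⟨a, ha, ha'⟩ := D.exists_level v
      refine .inl ⟨a, ha', .inl ?_⟩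
      simp only [blueBars, ha]; ring
  rcases key with ⟨a, ha, hw⟩ | hw
  · have ha' : (a : ℝ) ≤ 4 * m + 9 := by exact_mod_cast ha
    have a0 : (0 : ℝ) ≤ a := by positivity
    rcases w with _ | _ | w
    · simp only [redFans, fans]
      rcases hw with hw | hw <;> exact .inr (by linarith)
    · simp only [redFans, fans]
      rcases hw with hw | hw <;> exact .inl (by linarith)
    · obtain ⟨b, hb, -⟩ := D.exists_level w
      simp only [redFans, fans, hb]
      rcases hw with hw | hw <;> rw [hw]
      exacts [(nat_clear a b).1, (nat_clear a b).2]
  · rw [hw]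
    rcases w with _ | _ | w
    · simp only [redFans, fans]
      exact .inr (by linarith)
    · simp only [redFans, fans]
      exact .inl (by linarith)
    · obtain ⟨b, hb, -⟩ := D.exists_level w
      have b0 : (0 : ℝ) ≤ b := by positivity
      simp only [redFans, fans, hb]
      exact .inl (by linarith)

/-- The vertical bars of the wheel vertices have abscissas -4, 2 and multiples of 4 from 0 on; every
red window starts at distance at least 1/2 from all of them. -/
theorem red_win_clear {u v : StVertex (WheelNode m)} (h : D.Red u v)
    (w : StVertex (WheelNode m)) : D.redBars.win u v < D.blueFans.bot w ∨
      D.blueFans.top w < D.redBars.win u v := by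
  have hm := D.two_le_cast
  have sep (i k : Fin m) : ((k : ℕ) : ℝ) ≤ (i : ℕ) ∨ ((i : ℕ) : ℝ) + 1 ≤ (k : ℕ) := by
    rcases le_or_gt k i with h | h
    · exact .inl (by exact_mod_cast h)
    · exact .inr (idx_lt_cast h)
  have sep0 (k : Fin m) : ((k : ℕ) : ℝ) = 0 ∨ (1 : ℝ) ≤ (k : ℕ) := by
    rcases Nat.eq_zero_or_pos (k : ℕ) with h | h
    · exact .inl (by exact_mod_cast h)
    · exact .inr (by exact_mod_cast h)
  rcases u with _ | _ | _ | _ | i <;> rcases v with _ | _ | _ | _ | j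
  all_goals
    try have hi := idx_cast i
    try have hj := idx_cast j
    try have hw := D.red_win_root h
    try have hw := D.red_win_path h
    try rcases hw with ⟨hij, hw⟩ | ⟨hij, hw⟩
    all_goals try rw [hw]
    all_goals simp only [Red] at h
  all_goals rcases w with _ | _ | _ | _ | k
  all_goals
    try have hk := idx_cast k
    try have hk0 := sep0 k
    try have hki := sep i k
    try have hkj := sep j k
    simp only [redBars, blueFans, fans, blueBars]
    try rcases hk0 with hk0 | hk0
  all_goals try rcases hki with hki | hki
  all_goals try rcases hkj with hkj | hkj
  all_goals first
    | exact .inl (by linarith)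
    | exact .inr (by linarith)

theorem compatible : BarRep.Compatible D.redBars (D.blueBars.mirror (1 / 4)) D.redFans D.blueFans
    D.Red D.Blue (1 / 8) where
  corner v := ⟨rfl, (neg_neg _).symm⟩
  anchor v := ⟨rfl, rfl⟩
  fan v := ⟨rfl, rfl, rfl, rfl⟩
  win u v w h := D.red_win_clear h w
  win' u v w h := by
    simpa only [BarRep.mirror, neg_neg] using D.blue_win_clear h w
  strips w w' hne := by
    have hm := D.two_le_cast
    have hτ : (D.rootTop : ℝ) ≤ 9 := by rcases D.rootTop_cast with h | h | h <;> linarith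
    simp only [BarRep.mirror, neg_neg]
    rcases w with _ | _ | _ | _ | i <;> rcases w' with _ | _ | _ | _ | j
    all_goals
      try have hi := idx_cast i
      try have hi' := D.le_y_cast i
      try have hi'' := D.y_le_cast i
      try have hj := idx_cast j
      try have hj' := D.le_y_cast j
      try have hj'' := D.y_le_cast j
      simp only [redBars, blueFans, redFans, fans, blueBars]
    all_goals try exact absurd rfl (hne _ rfl)
    all_goals try first
      | exact .inl (by linarith)
      | exact .inr (.inl (by linarith))
      | exact .inr (.inr (.inl (by linarith)))
      | exact .inr (.inr (.inr (by linarith)))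
    have hij : ¬ i = j := by
      rintro rfl
      exact hne _ rfl rfl
    rcases D.y_sep hij with ⟨h, h'⟩ | ⟨h, h'⟩ | h | h
    · exact .inr (.inl (by linarith))
    · exact .inr (.inr (.inl (by linarith)))
    · exact .inr (.inr (.inr (by linarith)))
    · exact .inr (.inr (.inl (by linarith)))

theorem frame (v : WheelNode m) : D.redBars.level .source < D.blueBars.lo (.inner v) ∧
    D.blueBars.hi (.inner v) < D.redBars.level .sink ∧
    D.blueBars.level .source < D.redBars.lo (.inner v) ∧
    D.redBars.hi (.inner v) < D.blueBars.level .sink := by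
  have hm := D.two_le_cast
  have hτ : (D.rootTop : ℝ) ≤ 9 := by rcases D.rootTop_cast with h | h | h <;> linarith
  rcases v with _ | _ | i
  all_goals
    try have hi := idx_cast i
    try have hi' := D.le_y_cast i
    try have hi'' := D.y_le_cast i
  all_goals simp only [redBars, blueBars]
  all_goals refine ⟨?_, ?_, ?_, ?_⟩ <;> linarith

theorem exists_planeStGraphs {V : Type*} (k : V ≃ WheelNode m) :
    ∃ Gr Gb : PlaneStGraph V,
      (∀ u v, Gr.E (.inner u) (.inner v) ↔ D.Red (.inner (k u)) (.inner (k v))) ∧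
      (∀ u v, Gb.E (.inner u) (.inner v) ↔ D.Blue (.inner (k u)) (.inner (k v))) ∧
      AdmitsTransversal Gr Gb (fun _ => Rotation.lowerLeft) ∧
      AdmitsLSVR Gr Gb (fun _ => Rotation.lowerLeft) := by
  have h := D.red_stBars.comap k
  have h' := D.blue_stBars.comap k
  have c := D.compatible.comap k
  refine ⟨h.planeStGraph, h'.planeStGraph, fun _ _ => Iff.rfl, fun _ _ => Iff.rfl,
    ⟨_, _, c.isTransversal h h' (D.red_boxed.comap k) (D.blue_boxed.comap k)⟩,
    1 / 4, by norm_num, D.redBars.comap (StVertex.congr k), D.blueBars.comap (StVertex.congr k),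
    { red := h.represents
      blue := D.blue_represents.comap _
      red_out := fun _ _ _ _ _ => Iff.rfl
      red_in := fun _ _ _ _ _ => Iff.rfl
      -- The blue embedding is read from the mirrored bars, where left of a rightward edge has
      -- become a smaller coordinate; undoing the reflection reverses the inequality.
      blue_out := fun v a b _ _ => neg_lt_neg_iff.trans (add_lt_add_iff_right _)
      blue_in := fun v a b _ _ => neg_lt_neg_iff.trans (add_lt_add_iff_right _)
      corner := fun _ => ⟨rfl, rfl⟩
      disjoint := fun u v huv => D.compatible.disjoint_lShape D.red_stBars D.blue_stBars
        (k.injective.ne huv)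
      frame := fun v => D.frame (k v) }⟩

end Heights
end SimVis
namespace SimVis

/-! ## Heights from a matching -/

namespace WheelNode

variable {m : ℕ}

/-- The position in the wheel `W_n`, where `n = m + 2`, of the vertices if `root` is the rim vertex
at position `r` and the path starts right behind it. -/
def val (n r : ℕ) : WheelNode m → ℕ
  | root => r
  | hub => n - 1
  | path i => if r + 1 + i < n - 1 then r + 1 + i else r + 1 + i - (n - 1)

theorem val_lt {n r : ℕ} (hr : r + 1 < n) (hm : m + 2 = n) (a : WheelNode m) : a.val n r < n := by
  rcases a with _ | _ | i
  · simp only [val]; omega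
  · simp only [val]; omega
  · have := i.2
    simp only [val]
    split_ifs <;> omega

/-- The labelling of the vertices of the wheel. -/
noncomputable def equivFin {n r : ℕ} (hr : r + 1 < n) (hm : m + 2 = n) : WheelNode m ≃ Fin n :=
  Equiv.ofBijective (fun a => ⟨a.val n r, val_lt hr hm a⟩) <| by
    constructor
    · intro a b hab
      have hab : a.val n r = b.val n r := congrArg Fin.val hab
      rcases a with _ | _ | i <;> rcases b with _ | _ | j
      all_goals
        try have hi := i.2
        try have hj := j.2
      all_goals simp only [val] at hab
      all_goals try split_ifs at hab
      all_goals try rfl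
      all_goals try omega
      all_goals rw [Fin.ext (show (i : ℕ) = j by omega)]
    · intro v
      have hv := v.2
      by_cases h1 : (v : ℕ) = r
      · exact ⟨root, Fin.ext h1.symm⟩
      by_cases h2 : (v : ℕ) + 1 = n
      · exact ⟨hub, Fin.ext (by simp only [val]; omega)⟩
      by_cases h3 : r < v
      · refine ⟨path ⟨v - r - 1, by omega⟩, Fin.ext ?_⟩
        simp only [val]
        split_ifs <;> omega
      · refine ⟨path ⟨v + (n - 1) - r - 1, by omega⟩, Fin.ext ?_⟩
        simp only [val]
        split_ifs <;> omega

theorem equivFin_val {n r : ℕ} (hr : r + 1 < n) (hm : m + 2 = n) (a : WheelNode m) :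
    (equivFin hr hm a : ℕ) = a.val n r := rfl

end WheelNode

theorem wheel_adj {n : ℕ} {u v : Fin n} : (wheel n).Adj u v ↔ u ≠ v ∧
    (((v : ℕ) + 1 = n ∨ ((v : ℕ) = (u : ℕ) + 1 ∧ (v : ℕ) + 1 < n) ∨
      ((u : ℕ) = 0 ∧ (v : ℕ) + 2 = n)) ∨
    ((u : ℕ) + 1 = n ∨ ((u : ℕ) = (v : ℕ) + 1 ∧ (u : ℕ) + 1 < n) ∨
      ((v : ℕ) = 0 ∧ (u : ℕ) + 2 = n))) :=
  SimpleGraph.fromRel_adj _ _ _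

/-- Heights only orient the edges between path vertices; being distinct, they orient each in exactly
one way. What remains is cyclic index arithmetic on the rim. -/
theorem Heights.red_iff_wheel_adj {m n r : ℕ} (D : Heights m) (hr : r + 1 < n) (hm : m + 2 = n)
    {a b : WheelNode m} (hab : a ≠ b) : D.Red (.inner a) (.inner b) ∨ D.Red (.inner b) (.inner a) ↔
      (wheel n).Adj (WheelNode.equivFin hr hm a) (WheelNode.equivFin hr hm b) := by
  have hne := (WheelNode.equivFin hr hm).injective.ne hab
  have h2 := D.two_le
  rw [wheel_adj, and_iff_right hne]
  simp only [WheelNode.equivFin_val]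
  rcases a with _ | _ | i <;> rcases b with _ | _ | j
  all_goals
    try have hi := i.2
    try have hj := j.2
  all_goals simp only [WheelNode.val, Red, or_true, or_false, false_or, true_iff]
  · exact absurd rfl hab
  · omega
  · split_ifs <;> omega
  · omega
  · exact absurd rfl hab
  · omega
  · split_ifs <;> omega
  · omega
  · have hy : D.y i ≠ D.y j := fun h => hab (by rw [D.y_injective h])
    have hij : (i : ℕ) ≠ j := fun h => hab (by rw [Fin.ext h])
    split_ifs <;> omega

section

variable {m : ℕ} (N : SimpleGraph (WheelNode m))

open Classical in
/-- The height of the bar of a path vertex: matched path vertices get neighbouring heights, and the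
partner of `root` is the lowest path vertex. -/
noncomputable def matchingHeight (i : Fin m) : ℕ :=
  if N.Adj .root (.path i) then 8
  else if h : ∃ j : Fin m, j < i ∧ N.Adj (.path j) (.path i) then 13 + 4 * (h.choose : ℕ)
  else 12 + 4 * (i : ℕ)

theorem matchingHeight_cases (i : Fin m) :
    (N.Adj .root (.path i) ∧ matchingHeight N i = 8) ∨
    (¬ N.Adj .root (.path i) ∧
      ∃ j : Fin m, j < i ∧ N.Adj (.path j) (.path i) ∧ matchingHeight N i = 13 + 4 * (j : ℕ)) ∨
    (¬ N.Adj .root (.path i) ∧ (∀ j : Fin m, j < i → ¬ N.Adj (.path j) (.path i)) ∧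
      matchingHeight N i = 12 + 4 * (i : ℕ)) := by
  by_cases h1 : N.Adj .root (.path i)
  · exact .inl ⟨h1, if_pos h1⟩
  by_cases h2 : ∃ j : Fin m, j < i ∧ N.Adj (.path j) (.path i)
  · refine .inr (.inl ⟨h1, h2.choose, h2.choose_spec.1, h2.choose_spec.2, ?_⟩)
    rw [matchingHeight, if_neg h1, dif_pos h2]
  · refine .inr (.inr ⟨h1, fun j hj hij => h2 ⟨j, hj, hij⟩, ?_⟩)
    rw [matchingHeight, if_neg h1, dif_neg h2]

variable {N}

theorem IsMatchingGraph.eq {V : Type*} {M : SimpleGraph V} (hM : IsMatchingGraph M) {u v w : V}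
    (h : M.Adj u v) (h' : M.Adj u w) : v = w := hM u h h'

/-- The heights given by a matching. -/
noncomputable def matchingHeights (hN : IsMatchingGraph N) (hm : 2 ≤ m) (t : ℕ)
    (ht : t = 2 ∨ t = 5 ∨ t = 9) : Heights m where
  y := matchingHeight N
  rootTop := t
  two_le := hm
  rootTop_eq := ht
  le_y i := by
    rcases matchingHeight_cases N i with ⟨-, h⟩ | ⟨-, j, -, -, h⟩ | ⟨-, -, h⟩ <;> omega
  y_le i := by
    have := i.2
    rcases matchingHeight_cases N i with ⟨-, h⟩ | ⟨-, j, h', -, h⟩ | ⟨-, -, h⟩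
    · omega
    · have : (j : ℕ) < i := h'
      omega
    · omega
  y_pair i j hij := by
    have hij' : (i : ℕ) < j := hij
    rcases matchingHeight_cases N i with ⟨a1, h⟩ | ⟨a1, k, hk, a2, h⟩ | ⟨a1, a2, h⟩ <;>
    rcases matchingHeight_cases N j with ⟨b1, h'⟩ | ⟨b1, l, hl, b2, h'⟩ | ⟨b1, b2, h'⟩
    · have := WheelNode.path.inj (hN.eq a1 b1)
      exact absurd this hij.ne
    · omega
    · omega
    · omega
    · have hkl : (k : ℕ) ≠ l := by
        intro h
        obtain rfl := Fin.ext h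
        exact hij.ne (WheelNode.path.inj (hN.eq a2 b2))
      omega
    · have : (k : ℕ) < i := hk
      omega
    · omega
    · have : (l : ℕ) < j := hl
      omega
    · omega

/-- The heights 8 and `12 + 4 * i` are 0 modulo 4, and those of larger partners, `13 + 4 * j`, are
1. So a step of 1 leads from some `12 + 4 * l` to `13 + 4 * l`, that is, from `l` to its partner. -/
theorem matchingHeight_eq_add_one (hN : IsMatchingGraph N) {i j : Fin m} (hij : i < j) :
    matchingHeight N j = matchingHeight N i + 1 ↔ N.Adj (.path i) (.path j) := by
  have hij' : (i : ℕ) < j := hij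
  constructor
  · intro hy
    rcases matchingHeight_cases N i with ⟨a1, h⟩ | ⟨a1, k, hk, a2, h⟩ | ⟨a1, a2, h⟩ <;>
    rcases matchingHeight_cases N j with ⟨b1, h'⟩ | ⟨b1, l, hl, b2, h'⟩ | ⟨b1, b2, h'⟩ <;>
    try omega
    obtain rfl : l = i := Fin.ext (by omega)
    exact b2
  · intro hN'
    rcases matchingHeight_cases N j with ⟨b1, h'⟩ | ⟨b1, l, hl, b2, h'⟩ | ⟨b1, b2, h'⟩
    · exact absurd (hN.eq hN'.symm b1.symm) (by simp)
    · obtain rfl : l = i := WheelNode.path.inj (hN.eq b2.symm hN'.symm)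
      rcases matchingHeight_cases N l with ⟨a1, h⟩ | ⟨a1, k, hk, a2, h⟩ | ⟨a1, a2, h⟩
      · exact absurd (hN.eq hN' a1.symm) (by simp)
      · have := WheelNode.path.inj (hN.eq hN' a2.symm)
        have : (k : ℕ) < l := hk
        omega
      · omega
    · exact absurd hN' (b2 i hij)

theorem matchingHeight_eq_eight {i : Fin m} :
    matchingHeight N i = 8 ↔ N.Adj .root (.path i) := by
  rcases matchingHeight_cases N i with ⟨a1, h⟩ | ⟨a1, k, hk, a2, h⟩ | ⟨a1, a2, h⟩
  · simp [a1, h]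
  · simp only [a1, iff_false]; omega
  · simp only [a1, iff_false]; omega

/-- Visibility follows the matching on all pairs but one: whether `root` sees the hub depends on `t`
alone. -/
theorem matchingHeights_blue (hN : IsMatchingGraph N) (hm : 2 ≤ m) (t : ℕ)
    (ht : t = 2 ∨ t = 5 ∨ t = 9) (hhub : ∀ i, ¬ N.Adj .hub (.path i))
    (hroot : ∀ i, N.Adj .root (.path i) → t = 9) {a b : WheelNode m} (hab : a ≠ b) :
    ((matchingHeights hN hm t ht).Blue (.inner a) (.inner b) ∨
      (matchingHeights hN hm t ht).Blue (.inner b) (.inner a)) ↔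
    ((a = .root ∧ b = .hub ∨ a = .hub ∧ b = .root) ∧ t ≠ 2) ∨
      (¬ (a = .root ∧ b = .hub ∨ a = .hub ∧ b = .root) ∧ N.Adj a b) := by
  have hy : (matchingHeights hN hm t ht).y = matchingHeight N := rfl
  have ht' : (matchingHeights hN hm t ht).rootTop = t := rfl
  have hr (i) : t = 9 ∧ matchingHeight N i = 8 ↔ N.Adj .root (.path i) := by
    rw [matchingHeight_eq_eight]
    exact ⟨fun h => h.2, fun h => ⟨hroot i h, h⟩⟩
  rcases a with _ | _ | i <;> rcases b with _ | _ | j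
  all_goals simp only [Heights.Blue, hy, ht', hr, reduceCtorEq, and_true, true_and, and_false,
    false_and, or_false, false_or, not_true_eq_false, not_false_eq_true]
  · exact absurd rfl hab
  · exact absurd rfl hab
  · simp [hhub]
  · exact N.adj_comm _ _
  · simpa using fun h => hhub i h.symm
  · have hij : i ≠ j := fun h => hab (by rw [h])
    rcases lt_or_gt_of_ne hij with h | h
    · rw [matchingHeight_eq_add_one hN h]
      simp [h, h.not_gt]
    · rw [matchingHeight_eq_add_one hN h, N.adj_comm]
      simp [h, h.not_gt]

end

theorem exists_wheel_of_blue {n r : ℕ} (hr : r + 1 < n) {m : ℕ} (hm : m + 2 = n) (D : Heights m)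
    (B : SimpleGraph (Fin n))
    (hB : ∀ a b : WheelNode m, a ≠ b → (D.Blue (.inner a) (.inner b) ∨
      D.Blue (.inner b) (.inner a) ↔
        B.Adj (WheelNode.equivFin hr hm a) (WheelNode.equivFin hr hm b))) :
    ∃ Gr Gb : PlaneStGraph (Fin n), Gr.skeleton = wheel n ∧ Gb.skeleton = B ∧
      AdmitsTransversal Gr Gb (fun _ => Rotation.lowerLeft) ∧
      AdmitsLSVR Gr Gb (fun _ => Rotation.lowerLeft) := by
  obtain ⟨Gr, Gb, h1, h2, h3, h4⟩ := D.exists_planeStGraphs (WheelNode.equivFin hr hm).symm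
  refine ⟨Gr, Gb, ?_, ?_, h3, h4⟩
  · ext u v
    obtain ⟨a, rfl⟩ := (WheelNode.equivFin hr hm).surjective u
    obtain ⟨b, rfl⟩ := (WheelNode.equivFin hr hm).surjective v
    simp only [PlaneStGraph.skeleton, SimpleGraph.fromRel_adj, h1, Equiv.symm_apply_apply]
    by_cases hab : a = b
    · subst hab; simp
    · rw [D.red_iff_wheel_adj hr hm hab,
        and_iff_right ((WheelNode.equivFin hr hm).injective.ne hab)]
  · ext u v
    obtain ⟨a, rfl⟩ := (WheelNode.equivFin hr hm).surjective u
    obtain ⟨b, rfl⟩ := (WheelNode.equivFin hr hm).surjective v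
    simp only [PlaneStGraph.skeleton, SimpleGraph.fromRel_adj, h2, Equiv.symm_apply_apply]
    by_cases hab : a = b
    · subst hab; simp
    · rw [hB a b hab, and_iff_right ((WheelNode.equivFin hr hm).injective.ne hab)]

/-- The choice of `root` and of the top of its vertical bar: the partner of the hub with 5; else an
unmatched rim vertex with 2; else, with every rim vertex matched, rim vertex 0 with 9, at the price
of the edge to the hub. -/
theorem exists_wheel_matching (n : ℕ) (hn : 4 ≤ n) (M : SimpleGraph (Fin n))
    (hM : IsMatchingGraph M) :
    ∃ Gr Gb : PlaneStGraph (Fin n),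
      Gr.skeleton = wheel n ∧
      (Gb.skeleton = M ∨
        ((∀ v : Fin n, (∀ w, ¬ M.Adj v w) ↔ (v : ℕ) + 1 = n) ∧
          ∃ h w : Fin n, (h : ℕ) + 1 = n ∧ h ≠ w ∧ Gb.skeleton = M ⊔ SimpleGraph.edge h w)) ∧
      AdmitsTransversal Gr Gb (fun _ => Rotation.lowerLeft) ∧
      AdmitsLSVR Gr Gb (fun _ => Rotation.lowerLeft) := by
  obtain ⟨m, rfl⟩ : ∃ m, n = m + 2 := ⟨n - 2, by omega⟩
  have hm : 2 ≤ m := by omega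
  have hN (r : ℕ) (hr : r + 1 < m + 2) :
      IsMatchingGraph (M.comap (WheelNode.equivFin hr rfl : WheelNode m → Fin (m + 2))) :=
    fun a b hb c hc => (WheelNode.equivFin hr rfl).injective (hM _ hb hc)
  have ehub (r : ℕ) (hr : r + 1 < m + 2) :
      WheelNode.equivFin hr rfl (.hub : WheelNode m) = Fin.last (m + 1) := rfl
  have eroot (r : Fin (m + 2)) (hr : (r : ℕ) + 1 < m + 2) :
      WheelNode.equivFin hr rfl (.root : WheelNode m) = r := rfl
  by_cases h1 : ∃ r, M.Adj (Fin.last (m + 1)) r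
  · obtain ⟨r, hr⟩ := h1
    have hr' : (r : ℕ) + 1 < m + 2 := by
      have h1 := r.2
      have h2 : (r : ℕ) ≠ m + 1 := fun h => hr.ne (Fin.ext h.symm)
      omega
    have hNr := hN r hr'
    obtain ⟨Gr, Gb, e1, e2, e3⟩ := exists_wheel_of_blue hr' rfl
      (matchingHeights hNr hm 5 (by simp)) M fun a b hab => by
        rw [matchingHeights_blue hNr hm 5 (by simp) (fun i hi => ?_) (fun i hi => ?_) hab]
        · by_cases h : a = .root ∧ b = .hub ∨ a = .hub ∧ b = .root
          · simp only [h, true_and, not_true_eq_false, false_and, or_false]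
            rcases h with ⟨rfl, rfl⟩ | ⟨rfl, rfl⟩
            · simpa [ehub, eroot] using hr.symm
            · simpa [ehub, eroot] using hr
          · simp [h]
        · exact absurd (hNr.eq (w := .root) hi hr) (by simp)
        · exact absurd (hNr.eq (w := .hub) hi hr.symm) (by simp)
    exact ⟨Gr, Gb, e1, .inl e2, e3⟩
  push Not at h1
  by_cases h2 : ∃ r : Fin (m + 2), (r : ℕ) + 1 < m + 2 ∧ ∀ v, ¬ M.Adj r v
  · obtain ⟨r, hr', hr⟩ := h2
    have hNr := hN r hr'
    obtain ⟨Gr, Gb, e1, e2, e3⟩ := exists_wheel_of_blue hr' rfl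
      (matchingHeights hNr hm 2 (by simp)) M fun a b hab => by
        rw [matchingHeights_blue hNr hm 2 (by simp) (fun i hi => h1 _ hi)
          (fun i hi => absurd hi (hr _)) hab]
        by_cases h : a = .root ∧ b = .hub ∨ a = .hub ∧ b = .root
        · simp only [h, true_and, not_true_eq_false, false_and, or_false, ne_eq, false_iff]
          rcases h with ⟨rfl, rfl⟩ | ⟨rfl, rfl⟩
          · exact hr _
          · exact h1 _
        · simp [h]
    exact ⟨Gr, Gb, e1, .inl e2, e3⟩
  push Not at h2
  have hr' : ((0 : Fin (m + 2)) : ℕ) + 1 < m + 2 := by simp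
  have hNr := hN _ hr'
  obtain ⟨Gr, Gb, e1, e2, e3⟩ := exists_wheel_of_blue hr' rfl
    (matchingHeights hNr hm 9 (by simp)) (M ⊔ SimpleGraph.edge (Fin.last (m + 1)) 0)
    fun a b hab => by
      rw [matchingHeights_blue hNr hm 9 (by simp) (fun i hi => h1 _ hi) (fun i hi => rfl) hab,
        SimpleGraph.sup_adj, SimpleGraph.edge_adj]
      have e (a b : WheelNode m) :
          WheelNode.equivFin hr' rfl a = WheelNode.equivFin hr' rfl b ↔ a = b :=
        (WheelNode.equivFin hr' rfl).injective.eq_iff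
      have e0 (a : WheelNode m) : WheelNode.equivFin hr' rfl a = 0 ↔ a = .root := e a .root
      have elast (a : WheelNode m) : WheelNode.equivFin hr' rfl a = Fin.last (m + 1) ↔ a = .hub :=
        e a .hub
      rw [e0, e0, elast, elast]
      by_cases h : a = .root ∧ b = .hub ∨ a = .hub ∧ b = .root
      · simp [h, hab, h.symm]
      · simpa [h] using fun h' _ => absurd (Or.symm h') h
  refine ⟨Gr, Gb, e1, .inr ⟨fun v => ⟨fun hv => ?_, fun hv w hw => ?_⟩,
    Fin.last (m + 1), 0, rfl, ?_, e2⟩, e3⟩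
  · by_contra hne
    obtain ⟨w, hw⟩ := h2 v (by omega)
    exact hv w hw
  · obtain rfl : v = Fin.last (m + 1) := Fin.ext (by simpa using hv)
    exact h1 w hw
  · exact fun h => by simpa using congrArg Fin.val h

end SimVis
namespace SimVis

/-! ## Drawings of undirected graphs -/

/-- No edge in the RAC drawing has more than two bends, so reversal can be checked case by case. -/
theorem mem_trace_reverse {a c : ℂ} {l : List ℂ} (hl : l.length ≤ 2) {z : ℂ} :
    z ∈ trace (a :: (l ++ [c])).reverse ↔ z ∈ trace (a :: (l ++ [c])) := by
  match l, hl with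
  | [], _ =>
    simp only [List.nil_append, List.reverse_cons, List.reverse_nil, List.cons_append,
      mem_trace_two, segment_symm ℝ a c]
  | [b], _ =>
    simp only [List.nil_append, List.reverse_cons, List.reverse_nil, List.cons_append,
      mem_trace_three, segment_symm ℝ a b, segment_symm ℝ b c]
    tauto
  | [b, d], _ =>
    simp only [List.nil_append, List.reverse_cons, List.reverse_nil, List.cons_append,
      mem_trace_four, segment_symm ℝ a b, segment_symm ℝ b d, segment_symm ℝ d c]
    tauto

theorem SimpleArc.reverse {a c : ℂ} {l : List ℂ} (hl : l.length ≤ 2)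
    (h : SimpleArc (a :: (l ++ [c]))) : SimpleArc (a :: (l ++ [c])).reverse := by
  match l, hl with
  | [], _ =>
    simp only [List.nil_append, List.reverse_cons, List.reverse_nil, List.cons_append,
      simpleArc_two] at h ⊢
    exact h.symm
  | [b], _ =>
    simp only [List.nil_append, List.reverse_cons, List.reverse_nil, List.cons_append,
      simpleArc_three] at h ⊢
    rw [segment_symm ℝ b a, segment_symm ℝ c b]
    exact ⟨h.2.1.symm, h.1.symm, fun z hz hz' => h.2.2 z hz' hz⟩
  | [b, d], _ =>
    simp only [List.nil_append, List.reverse_cons, List.reverse_nil, List.cons_append,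
      simpleArc_four] at h ⊢
    obtain ⟨h1, h2, h3, h4, h5, h6⟩ := h
    rw [segment_symm ℝ b a, segment_symm ℝ c d, segment_symm ℝ d b]
    exact ⟨h3.symm, h2.symm, h1.symm, fun z hz hz' => h5 z hz' hz, fun z hz hz' => h4 z hz' hz,
      fun z hz hz' => h6 z hz' hz⟩

theorem mem_segs_reverse {a c : ℂ} {l : List ℂ} (hl : l.length ≤ 2) {p : ℂ × ℂ}
    (h : p ∈ segs (a :: (l ++ [c]))) : p.swap ∈ segs (a :: (l ++ [c])).reverse := by
  match l, hl with
  | [], _ =>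
    simp only [List.nil_append, List.reverse_cons, List.reverse_nil, List.cons_append,
      segs_two, List.mem_cons, List.not_mem_nil, or_false] at h ⊢
    rw [h]; rfl
  | [b], _ =>
    simp only [List.nil_append, List.reverse_cons, List.reverse_nil, List.cons_append,
      segs_three, List.mem_cons, List.not_mem_nil, or_false] at h ⊢
    rcases h with h | h <;> simp [h]
  | [b, d], _ =>
    simp only [List.nil_append, List.reverse_cons, List.reverse_nil, List.cons_append,
      segs_four, List.mem_cons, List.not_mem_nil, or_false] at h ⊢
    rcases h with h | h | h <;> simp [h]

/-! ### Reduction of undirected drawings to edges with increasing ends -/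

namespace PolyDrawing

variable {n : ℕ} {D : PolyDrawing (Fin n)} {G : SimpleGraph (Fin n)}

/-- Edges are the same curves in both directions, and have at most two bends. -/
def IsUndirected (D : PolyDrawing (Fin n)) : Prop :=
  (∀ u v, D.bends v u = (D.bends u v).reverse) ∧ ∀ u v, (D.bends u v).length ≤ 2

theorem IsUndirected.path_swap (h : D.IsUndirected) (u v : Fin n) :
    D.path v u = (D.path u v).reverse := by
  simp [path, h.1 u v]

theorem IsUndirected.mem_trace_swap (h : D.IsUndirected) {u v : Fin n} {z : ℂ} :
    z ∈ trace (D.path v u) ↔ z ∈ trace (D.path u v) := by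
  rw [h.path_swap u v]
  exact mem_trace_reverse (h.2 u v)

theorem IsUndirected.isPlanar (h : D.IsUndirected) (h1 : Function.Injective D.pos)
    (h2 : ∀ u v, u < v → G.Adj u v → SimpleArc (D.path u v))
    (h3 : ∀ u v w, u < v → G.Adj u v → D.pos w ∈ trace (D.path u v) → w = u ∨ w = v)
    (h4 : ∀ u v u' v', u < v → G.Adj u v → u' < v' → G.Adj u' v' → ¬ (u = u' ∧ v = v') →
      ∀ z ∈ trace (D.path u v), z ∈ trace (D.path u' v') → ∃ w, z = D.pos w) :
    D.IsPlanar G.Adj := by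
  refine ⟨h1, fun u v huv => ?_, fun u v w huv hw => ?_, ?_⟩
  · rcases lt_or_gt_of_ne huv.ne with hlt | hlt
    · exact h2 u v hlt huv
    · rw [h.path_swap v u]
      exact (h2 v u hlt huv.symm).reverse (h.2 v u)
  · rcases lt_or_gt_of_ne huv.ne with hlt | hlt
    · exact h3 u v w hlt huv hw
    · exact (h3 v u w hlt huv.symm (h.mem_trace_swap.1 hw)).symm
  · intro u v u' v' huv huv' hne z hz hz'
    have key (a b) (hab : G.Adj a b) (hz : z ∈ trace (D.path a b)) :
        ∃ c d, c < d ∧ G.Adj c d ∧ s(c, d) = s(a, b) ∧ z ∈ trace (D.path c d) := by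
      rcases lt_or_gt_of_ne hab.ne with hlt | hlt
      · exact ⟨a, b, hlt, hab, rfl, hz⟩
      · exact ⟨b, a, hlt, hab.symm, Sym2.eq_swap, h.mem_trace_swap.1 hz⟩
    obtain ⟨a, b, hab, hab', e, hz⟩ := key u v huv hz
    obtain ⟨c, d, hcd, hcd', e', hz'⟩ := key u' v' huv' hz'
    refine h4 a b c d hab hab' hcd hcd' ?_ z hz hz'
    rintro ⟨rfl, rfl⟩
    exact hne (e.symm.trans e')

/-- The condition on the crossings of two edges in a simultaneous RAC embedding. -/
def RightAngleAt (p q : List ℂ) (z : ℂ) : Prop :=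
  ∃ a ∈ segs p, ∃ b ∈ segs q, z ∈ openSegment ℝ a.1 a.2 ∧ z ∈ openSegment ℝ b.1 b.2 ∧
    (a.2 - a.1).re * (b.2 - b.1).re + (a.2 - a.1).im * (b.2 - b.1).im = 0

theorem IsUndirected.rightAngleAt_left (h : D.IsUndirected) {u v : Fin n} {q : List ℂ} {z : ℂ}
    (hz : RightAngleAt (D.path u v) q z) : RightAngleAt (D.path v u) q z := by
  obtain ⟨a, ha, b, hb, h1, h2, h3⟩ := hz
  refine ⟨a.swap, ?_, b, hb, ?_, h2, ?_⟩
  · rw [h.path_swap u v]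
    exact mem_segs_reverse (h.2 u v) ha
  · rw [openSegment_symm]; exact h1
  · simp only [Prod.fst_swap, Prod.snd_swap, Complex.sub_re, Complex.sub_im] at h3 ⊢
    linarith

theorem RightAngleAt.symm {p q : List ℂ} {z : ℂ} (h : RightAngleAt p q z) :
    RightAngleAt q p z := by
  obtain ⟨a, ha, b, hb, h1, h2, h3⟩ := h
  exact ⟨b, hb, a, ha, h2, h1, by linarith⟩

theorem rightAngles_of_lt {R B : PolyDrawing (Fin n)} {G' : SimpleGraph (Fin n)}
    (hR : R.IsUndirected) (hB : B.IsUndirected)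
    (h : ∀ u v u' v', u < v → G.Adj u v → u' < v' → G'.Adj u' v' →
      ∀ z ∈ trace (R.path u v), z ∈ trace (B.path u' v') →
        (∃ w, z = R.pos w) ∨ RightAngleAt (R.path u v) (B.path u' v') z)
    {u v u' v' : Fin n} (huv : G.Adj u v) (huv' : G'.Adj u' v') {z : ℂ}
    (hz : z ∈ trace (R.path u v)) (hz' : z ∈ trace (B.path u' v')) :
    (∃ w, z = R.pos w) ∨ RightAngleAt (R.path u v) (B.path u' v') z := by
  rcases lt_or_gt_of_ne huv.ne with h1 | h1 <;> rcases lt_or_gt_of_ne huv'.ne with h2 | h2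
  · exact h u v u' v' h1 huv h2 huv' z hz hz'
  · exact (h u v v' u' h1 huv h2 huv'.symm z hz (hB.mem_trace_swap.1 hz')).imp_right
      fun r => (hB.rightAngleAt_left r.symm).symm
  · exact (h v u u' v' h1 huv.symm h2 huv' z (hR.mem_trace_swap.1 hz) hz').imp_right
      fun r => hR.rightAngleAt_left r
  · exact (h v u v' u' h1 huv.symm h2 huv'.symm z (hR.mem_trace_swap.1 hz)
      (hB.mem_trace_swap.1 hz')).imp_right
      fun r => (hB.rightAngleAt_left (hR.rightAngleAt_left r).symm).symm

end PolyDrawing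

/-! ## The simultaneous RAC embedding -/

/-- An assignment of the rim vertices to horizontal lines such that two of them are on the same
line if and only if they are matched, and such that a partner of the hub is on the lowest line. -/
structure Rows (n : ℕ) (M : SimpleGraph (Fin n)) where
  y : Fin n → ℕ
  k : ℕ
  one_le : ∀ v, 1 ≤ y v
  le : ∀ v, y v ≤ n + 2
  adj : ∀ u v : Fin n, (u : ℕ) + 1 < n → (v : ℕ) + 1 < n → u ≠ v → (y u = y v ↔ M.Adj u v)
  hub : ∀ u v : Fin n, (v : ℕ) + 1 = n → M.Adj u v → (u : ℕ) = k ∧ y u = 1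

open Classical in
-- Row 1 is reserved for the partner of the hub; any other rim vertex takes the row `2 + i`, where
-- `i` is the smaller index in its matching edge, or its own index if it is unmatched.
theorem exists_rows {n : ℕ} (hn : 0 < n) {M : SimpleGraph (Fin n)} (hM : IsMatchingGraph M) :
    Nonempty (Rows n M) := by
  let h : Fin n := ⟨n - 1, by omega⟩
  have hh (v : Fin n) : (v : ℕ) + 1 = n ↔ v = h :=
    ⟨fun e => Fin.ext (by simp only [h]; omega), fun e => by rw [e]; simp only [h]; omega⟩
  let y (v : Fin n) : ℕ := if M.Adj h v then 1
    else if e : ∃ u : Fin n, u < v ∧ M.Adj u v then 2 + (e.choose : ℕ) else 2 + (v : ℕ)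
  have hy (v : Fin n) : (M.Adj h v ∧ y v = 1) ∨
      (¬ M.Adj h v ∧ ∃ u : Fin n, (u : ℕ) < v ∧ M.Adj u v ∧ y v = 2 + (u : ℕ)) ∨
      (¬ M.Adj h v ∧ (∀ u : Fin n, (u : ℕ) < v → ¬ M.Adj u v) ∧ y v = 2 + (v : ℕ)) := by
    by_cases h1 : M.Adj h v
    · exact .inl ⟨h1, if_pos h1⟩
    by_cases h2 : ∃ u : Fin n, u < v ∧ M.Adj u v
    · refine .inr (.inl ⟨h1, h2.choose, h2.choose_spec.1, h2.choose_spec.2, ?_⟩)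
      simp only [y, if_neg h1, dif_pos h2]
    · refine .inr (.inr ⟨h1, fun u hu huv => h2 ⟨u, hu, huv⟩, ?_⟩)
      simp only [y, if_neg h1, dif_neg h2]
  have hlt (u v : Fin n) (huv : M.Adj u v) (hlt : (u : ℕ) < v) (hu : u ≠ h) (hv : v ≠ h) :
      y u = y v := by
    rcases hy u with ⟨a1, a2⟩ | ⟨a1, w, a2, a3, a4⟩ | ⟨a1, a2, a3⟩
    · exact absurd (hM.eq huv a1.symm) hv
    · obtain rfl := hM.eq huv a3.symm
      omega
    rcases hy v with ⟨b1, b2⟩ | ⟨b1, x, b2, b3, b4⟩ | ⟨b1, b2, b3⟩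
    · exact absurd (hM.eq huv.symm b1.symm) hu
    · obtain rfl := hM.eq huv.symm b3.symm
      omega
    · exact absurd huv (b2 u hlt)
  -- If the hub is unmatched, `k` only fixes its abscissa, and 0 is as good as any value.
  refine ⟨⟨y, if e : ∃ v : Fin n, M.Adj h v then (e.choose : ℕ) else 0, ?_, ?_, ?_, ?_⟩⟩
  · intro v
    rcases hy v with ⟨a1, a2⟩ | ⟨a1, w, a2, a3, a4⟩ | ⟨a1, a2, a3⟩ <;> omega
  · intro v
    have := v.2
    rcases hy v with ⟨a1, a2⟩ | ⟨a1, w, a2, a3, a4⟩ | ⟨a1, a2, a3⟩ <;> omega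
  · intro u v hu hv hne
    have hu' : u ≠ h := fun e => hu.ne ((hh u).2 e)
    have hv' : v ≠ h := fun e => hv.ne ((hh v).2 e)
    constructor
    · intro e
      rcases hy u with ⟨a1, a2⟩ | ⟨a1, w, a2, a3, a4⟩ | ⟨a1, a2, a3⟩ <;>
      rcases hy v with ⟨b1, b2⟩ | ⟨b1, x, b2, b3, b4⟩ | ⟨b1, b2, b3⟩
      · exact absurd (hM.eq a1 b1) hne
      · omega
      · omega
      · omega
      · obtain rfl : w = x := Fin.ext (by omega)
        exact absurd (hM.eq a3 b3) hne
      · obtain rfl : w = v := Fin.ext (by omega)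
        exact a3.symm
      · omega
      · obtain rfl : x = u := Fin.ext (by omega)
        exact b3
      · exact absurd (Fin.ext (by omega)) hne
    · intro huv
      rcases Nat.lt_or_gt_of_ne (Fin.val_ne_of_ne hne) with hl | hl
      · exact hlt u v huv hl hu' hv'
      · exact (hlt v u huv.symm hl hv' hu').symm
  · intro u v hv huv
    obtain rfl := (hh v).1 hv
    have e : ∃ v : Fin n, M.Adj h v := ⟨u, huv.symm⟩
    refine ⟨?_, ?_⟩
    · rw [dif_pos e, hM.eq e.choose_spec huv.symm]
    · simp only [y, if_pos huv.symm]

/-! ### The drawing on rows and its crossings -/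

namespace Rows

variable {n : ℕ} {M : SimpleGraph (Fin n)} (D : Rows n M)

/-- The positions of the vertices. -/
noncomputable def pos (v : Fin n) : ℂ :=
  -- The shift by 1/2 tilts the hub's matching edge, so that it leaves the hub in a direction used
  -- by no spoke.
  if (v : ℕ) + 1 < n then ⟨(v : ℕ), D.y v⟩ else ⟨D.k - 1 / 2, 0⟩

/-- The bends of the wheel edge from `u` to `v`, where `u < v`. -/
noncomputable def bend (u v : Fin n) : List ℂ :=
  if (v : ℕ) + 1 < n then
    -- The slanted end pieces rise by less than 1 from an integer height, so they meet no row but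
    -- that of their own vertex. The different fractions 1/2 and 1/4 keep the vertical piece from
    -- degenerating.
    if (v : ℕ) = u + 1 then [⟨(u : ℕ) + 1 / 2, D.y u + 1 / 2⟩, ⟨(u : ℕ) + 1 / 2, D.y v + 1 / 4⟩]
    -- The closing rim edge passes above all rows, which end at `n + 2`, and beside all other rim
    -- vertices.
    else [⟨-1, n + 3⟩, ⟨n, n + 3⟩]
  else [⟨(u : ℕ), 1 / 2⟩]

/-- The drawing of the wheel. -/
noncomputable def red : PolyDrawing (Fin n) where
  pos := D.pos
  bends u v := if u < v then D.bend u v else if v < u then (D.bend v u).reverse else []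

/-- The drawing of the matching. -/
noncomputable def blue : PolyDrawing (Fin n) where
  pos := D.pos
  bends _ _ := []

theorem bend_length (u v : Fin n) : (D.bend u v).length ≤ 2 := by
  rw [bend]; split_ifs <;> simp

theorem red_isUndirected : D.red.IsUndirected := by
  refine ⟨fun u v => ?_, fun u v => ?_⟩
  · rcases lt_trichotomy u v with h | rfl | h
    · simp [red, h, h.not_gt]
    · simp [red]
    · simp [red, h, h.not_gt]
  · simp only [red]
    split_ifs
    · exact D.bend_length u v
    · rw [List.length_reverse]; exact D.bend_length v u
    · simp

theorem blue_isUndirected : D.blue.IsUndirected := ⟨fun _ _ => rfl, fun _ _ => by simp [blue]⟩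

variable {D}

theorem pos_rim {v : Fin n} (h : (v : ℕ) + 1 < n) : D.pos v = ⟨(v : ℕ), D.y v⟩ := if_pos h

theorem pos_hub {v : Fin n} (h : (v : ℕ) + 1 = n) : D.pos v = ⟨D.k - 1 / 2, 0⟩ :=
  if_neg h.not_lt

theorem one_le_cast (v : Fin n) : (1 : ℝ) ≤ D.y v := by exact_mod_cast D.one_le v

theorem le_cast (v : Fin n) : (D.y v : ℝ) ≤ n + 2 := by exact_mod_cast D.le v

theorem rim_or_hub (v : Fin n) : (v : ℕ) + 1 < n ∨ (v : ℕ) + 1 = n := by have := v.2; omega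

theorem pos_injective : Function.Injective D.pos := by
  intro u v h
  rcases rim_or_hub u with hu | hu <;> rcases rim_or_hub v with hv | hv
  · rw [pos_rim hu, pos_rim hv] at h
    have h' : ((u : ℕ) : ℝ) = (v : ℕ) := congrArg Complex.re h
    exact Fin.ext (by exact_mod_cast h')
  · rw [pos_rim hu, pos_hub hv] at h
    have h' : (D.y u : ℝ) = 0 := congrArg Complex.im h
    linarith [D.one_le_cast u]
  · rw [pos_hub hu, pos_rim hv] at h
    have h' : (0 : ℝ) = D.y v := congrArg Complex.im h
    linarith [D.one_le_cast v]
  · exact Fin.ext (by omega)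

/-- The three kinds of wheel edges. -/
theorem wheel_adj_cases {u v : Fin n} (huv : u < v) (h : (wheel n).Adj u v) :
    ((v : ℕ) = u + 1 ∧ (v : ℕ) + 1 < n) ∨ ((u : ℕ) + 1 < n ∧ (v : ℕ) + 1 = n) ∨
      ((u : ℕ) = 0 ∧ (v : ℕ) + 2 = n) := by
  rw [wheel_adj] at h
  have : (u : ℕ) < v := huv
  have := v.2
  omega

theorem path_rim {u v : Fin n} (h : (v : ℕ) = u + 1) (hv : (v : ℕ) + 1 < n) :
    D.red.path u v = [⟨(u : ℕ), D.y u⟩, ⟨(u : ℕ) + 1 / 2, D.y u + 1 / 2⟩,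
      ⟨(u : ℕ) + 1 / 2, D.y v + 1 / 4⟩, ⟨(u : ℕ) + 1, D.y v⟩] := by
  have huv : u < v := by rw [Fin.lt_def]; omega
  have hc : ((v : ℕ) : ℝ) = (u : ℕ) + 1 := by exact_mod_cast h
  simp only [PolyDrawing.path, red, if_pos huv, bend, if_pos hv, if_pos h, pos_rim hv,
    pos_rim (show (u : ℕ) + 1 < n by omega), hc, List.cons_append, List.nil_append]

theorem path_spoke {u v : Fin n} (hu : (u : ℕ) + 1 < n) (hv : (v : ℕ) + 1 = n) :
    D.red.path u v = [⟨(u : ℕ), D.y u⟩, ⟨(u : ℕ), 1 / 2⟩, ⟨D.k - 1 / 2, 0⟩] := by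
  have huv : u < v := by rw [Fin.lt_def]; omega
  simp only [PolyDrawing.path, red, if_pos huv, bend, if_neg hv.not_lt, pos_rim hu, pos_hub hv,
    List.cons_append, List.nil_append]

theorem path_closing (hn : 4 ≤ n) {u v : Fin n} (hu : (u : ℕ) = 0) (hv : (v : ℕ) + 2 = n) :
    D.red.path u v = [⟨0, D.y u⟩, ⟨-1, n + 3⟩, ⟨n, n + 3⟩, ⟨n - 2, D.y v⟩] := by
  have huv : u < v := by rw [Fin.lt_def]; omega
  have hc : ((v : ℕ) : ℝ) = n - 2 := by
    rw [eq_sub_iff_add_eq]; exact_mod_cast hv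
  have hu' : ((u : ℕ) : ℝ) = 0 := by exact_mod_cast hu
  have hne : ¬ (v : ℕ) = u + 1 := by omega
  simp only [PolyDrawing.path, red, if_pos huv, bend, if_pos (show (v : ℕ) + 1 < n by omega),
    if_neg hne, pos_rim (show (v : ℕ) + 1 < n by omega), pos_rim (show (u : ℕ) + 1 < n by omega),
    hu', hc, List.cons_append, List.nil_append]

theorem mem_path_rim {u v : Fin n} (h : (v : ℕ) = u + 1) (hv : (v : ℕ) + 1 < n) {z : ℂ}
    (hz : z ∈ trace (D.red.path u v)) : z = D.pos u ∨ z = D.pos v ∨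
      ((u : ℕ) < z.re ∧ z.re < (u : ℕ) + 1 ∧ 1 ≤ z.im ∧ z.im < n + 3) := by
  have h1 := D.one_le_cast u
  have h2 := D.one_le_cast v
  have h3 := D.le_cast u
  have h4 := D.le_cast v
  have hc : ((v : ℕ) : ℝ) = (u : ℕ) + 1 := by exact_mod_cast h
  rw [path_rim h hv, mem_trace_four] at hz
  rw [pos_rim (show (u : ℕ) + 1 < n by omega), pos_rim hv, hc]
  rcases hz with hz | hz | hz <;> obtain ⟨t, t0, t1, hr, hi⟩ := mem_segment_iff.1 hz <;>
    simp only at hr hi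
  · rcases t0.eq_or_lt with rfl | t0
    · exact .inl (Complex.ext (by simpa using hr) (by simpa using hi))
    · exact .inr (.inr ⟨by linarith, by linarith, by linarith, by linarith⟩)
  · exact .inr (.inr ⟨by linarith, by linarith, by nlinarith, by nlinarith⟩)
  · rcases t1.eq_or_lt with rfl | t1
    · exact .inr (.inl (Complex.ext (by simp only [hr]; ring) (by simp only [hi]; ring)))
    · exact .inr (.inr ⟨by linarith, by linarith, by linarith, by linarith⟩)

theorem mem_path_spoke {u v : Fin n} (hu : (u : ℕ) + 1 < n) (hv : (v : ℕ) + 1 = n) {z : ℂ}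
    (hz : z ∈ trace (D.red.path u v)) : z = D.pos u ∨ z = D.pos v ∨
      (z.re = (u : ℕ) ∧ 1 / 2 ≤ z.im ∧ z.im < D.y u) ∨
      (0 < z.im ∧ z.im ≤ 1 / 2 ∧
        z.re - (D.k - 1 / 2) = 2 * z.im * ((u : ℕ) - (D.k - 1 / 2))) := by
  have h1 := D.one_le_cast u
  rw [path_spoke hu hv, mem_trace_three] at hz
  rw [pos_rim hu, pos_hub hv]
  rcases hz with hz | hz <;> obtain ⟨t, t0, t1, hr, hi⟩ := mem_segment_iff.1 hz <;>
    simp only at hr hi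
  · rcases t0.eq_or_lt with rfl | t0
    · exact .inl (Complex.ext (by simpa using hr) (by simpa using hi))
    · exact .inr (.inr (.inl ⟨by linarith, by nlinarith, by nlinarith⟩))
  · rcases t1.eq_or_lt with rfl | t1
    · exact .inr (.inl (Complex.ext (by simp only [hr]; ring) (by simp only [hi]; ring)))
    · exact .inr (.inr (.inr ⟨by linarith, by linarith, by rw [hr, hi]; ring⟩))

theorem mem_path_closing (hn : 4 ≤ n) {u v : Fin n} (hu : (u : ℕ) = 0) (hv : (v : ℕ) + 2 = n)
    {z : ℂ} (hz : z ∈ trace (D.red.path u v)) : z = D.pos u ∨ z = D.pos v ∨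
      (1 ≤ z.im ∧ (z.re < 0 ∨ z.im = n + 3 ∨ n - 2 < z.re)) := by
  have h1 := D.one_le_cast u
  have h2 := D.one_le_cast v
  have h3 := D.le_cast u
  have h4 := D.le_cast v
  have hn' : (4 : ℝ) ≤ n := by exact_mod_cast hn
  have hc : ((v : ℕ) : ℝ) = n - 2 := by
    rw [eq_sub_iff_add_eq]; exact_mod_cast hv
  rw [path_closing hn hu hv, mem_trace_four] at hz
  rw [pos_rim (show (u : ℕ) + 1 < n by omega), pos_rim (show (v : ℕ) + 1 < n by omega), hc, hu]
  rcases hz with hz | hz | hz <;> obtain ⟨t, t0, t1, hr, hi⟩ := mem_segment_iff.1 hz <;>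
    simp only at hr hi
  · rcases t0.eq_or_lt with rfl | t0
    · exact .inl (Complex.ext (by simpa using hr) (by simpa using hi))
    · exact .inr (.inr ⟨by nlinarith, .inl (by linarith)⟩)
  · exact .inr (.inr ⟨by linarith, .inr (.inl (by linarith))⟩)
  · rcases t1.eq_or_lt with rfl | t1
    · exact .inr (.inl (Complex.ext (by simp only [hr]; ring) (by simp only [hi]; ring)))
    · exact .inr (.inr ⟨by nlinarith, .inr (.inr (by linarith))⟩)

/-- This keeps the two bends of a rim edge distinct. -/
theorem nat_add_half_ne (a b : ℕ) : (a : ℝ) + 1 / 2 ≠ b + 1 / 4 := by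
  intro h
  have : ((4 * a + 2 : ℕ) : ℝ) = ((4 * b + 1 : ℕ) : ℝ) := by push_cast; linarith
  have := Nat.cast_injective this
  omega

theorem simpleArc_red (hn : 4 ≤ n) {u v : Fin n} (huv : u < v) (h : (wheel n).Adj u v) :
    SimpleArc (D.red.path u v) := by
  have h1 := D.one_le_cast u
  have h2 := D.one_le_cast v
  have h3 := D.le_cast u
  have h4 := D.le_cast v
  have hn' : (4 : ℝ) ≤ n := by exact_mod_cast hn
  rcases wheel_adj_cases huv h with ⟨hu, hv⟩ | ⟨hu, hv⟩ | ⟨hu, hv⟩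
  · rw [path_rim hu hv, simpleArc_four]
    refine ⟨fun e => ?_, fun e => ?_, fun e => ?_, ?_, ?_, ?_⟩
    · have := congrArg Complex.re e
      simp only at this
      linarith
    · exact nat_add_half_ne _ _ (congrArg Complex.im e)
    · have := congrArg Complex.re e
      simp only at this
      linarith
    all_goals
      intro z hz hz'
      obtain ⟨t, t0, t1, hr, hi⟩ := mem_segment_iff.1 hz
      obtain ⟨s, s0, s1, hr', hi'⟩ := mem_segment_iff.1 hz'
      simp only at hr hi hr' hi'
    · obtain rfl : t = 1 := by linarith
      exact Complex.ext (by linarith) (by linarith)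
    · obtain rfl : s = 0 := by linarith
      exact Complex.ext (by linarith) (by linarith)
    · obtain rfl : s = 0 := by linarith
      obtain rfl : t = 1 := by linarith
      exact nat_add_half_ne (D.y u) (D.y v) (by linarith)
  · rw [path_spoke hu hv, simpleArc_three]
    refine ⟨fun e => ?_, fun e => ?_, ?_⟩
    · have := congrArg Complex.im e
      simp only at this
      linarith
    · have := congrArg Complex.im e
      simp at this
    · intro z hz hz'
      obtain ⟨t, t0, t1, hr, hi⟩ := mem_segment_iff.1 hz
      obtain ⟨s, s0, s1, hr', hi'⟩ := mem_segment_iff.1 hz'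
      simp only at hr hi hr' hi'
      exact Complex.ext (by simp only; linarith) (by simp only; nlinarith)
  · rw [path_closing hn hu hv, simpleArc_four]
    refine ⟨fun e => ?_, fun e => ?_, fun e => ?_, ?_, ?_, ?_⟩
    · have := congrArg Complex.re e
      simp only at this
      linarith
    · have := congrArg Complex.re e
      simp only at this
      linarith
    · have := congrArg Complex.re e
      simp only at this
      linarith
    all_goals
      intro z hz hz'
      obtain ⟨t, t0, t1, hr, hi⟩ := mem_segment_iff.1 hz
      obtain ⟨s, s0, s1, hr', hi'⟩ := mem_segment_iff.1 hz'
      simp only at hr hi hr' hi'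
    · obtain rfl : t = 1 := by nlinarith
      exact Complex.ext (by linarith) (by linarith)
    · obtain rfl : s = 0 := by nlinarith
      exact Complex.ext (by linarith) (by linarith)
    · linarith

theorem rim_cast {w : Fin n} (hw : (w : ℕ) + 1 < n) :
    (0 : ℝ) ≤ (w : ℕ) ∧ ((w : ℕ) : ℝ) ≤ n - 2 := by
  refine ⟨by positivity, ?_⟩
  have : ((w : ℕ) : ℝ) + 2 ≤ n := by exact_mod_cast (show (w : ℕ) + 2 ≤ n by omega)
  linarith

theorem not_between {a b : ℕ} {x : ℝ} (hx : x = b) (h1 : (a : ℝ) < x) (h2 : x < a + 1) : False := by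
  rw [hx] at h1 h2
  have h1' : a < b := by exact_mod_cast h1
  have h2' : b < a + 1 := by exact_mod_cast h2
  omega

theorem red_vertex (hn : 4 ≤ n) {u v w : Fin n} (huv : u < v) (h : (wheel n).Adj u v)
    (hw : D.red.pos w ∈ trace (D.red.path u v)) : w = u ∨ w = v := by
  have hred : D.red.pos w = D.pos w := rfl
  have h1 := D.one_le_cast w
  have h3 := D.le_cast w
  rcases wheel_adj_cases huv h with ⟨hu, hv⟩ | ⟨hu, hv⟩ | ⟨hu, hv⟩
  · rcases mem_path_rim hu hv hw with e | e | e
    · exact .inl (pos_injective e)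
    · exact .inr (pos_injective e)
    · exfalso
      rw [hred] at e
      rcases rim_or_hub w with hw' | hw'
      · rw [pos_rim hw'] at e
        exact not_between rfl e.1 e.2.1
      · rw [pos_hub hw'] at e
        simp only at e
        linarith
  · rcases mem_path_spoke hu hv hw with e | e | e | e
    · exact .inl (pos_injective e)
    · exact .inr (pos_injective e)
    all_goals
      rw [hred] at e
      rcases rim_or_hub w with hw' | hw'
      · rw [pos_rim hw'] at e
        simp only at e
        first
        | exact .inl (Fin.ext (by exact_mod_cast e.1))
        | (exfalso; linarith)
      · rw [pos_hub hw'] at e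
        exfalso
        simp only at e
        linarith
  · rcases mem_path_closing hn hu hv hw with e | e | e
    · exact .inl (pos_injective e)
    · exact .inr (pos_injective e)
    · exfalso
      rw [hred] at e
      rcases rim_or_hub w with hw' | hw'
      · rw [pos_rim hw'] at e
        obtain ⟨w0, w1⟩ := rim_cast hw'
        simp only at e
        rcases e with ⟨e, e' | e' | e'⟩ <;> linarith
      · rw [pos_hub hw'] at e
        simp only at e
        linarith

theorem rim_spoke_false {u w : Fin n} {x y κ : ℝ} (hP : ((u : ℕ) : ℝ) < x ∧ x < (u : ℕ) + 1 ∧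
    1 ≤ y ∧ y < n + 3) {b : ℝ} (hH : (x = (w : ℕ) ∧ 1 / 2 ≤ y ∧ y < b) ∨
      (0 < y ∧ y ≤ 1 / 2 ∧ x - κ = 2 * y * ((w : ℕ) - κ))) : False := by
  rcases hH with h | h
  · exact not_between h.1 hP.1 hP.2.1
  · linarith

theorem rim_closing_false {u v : Fin n} (hu : (v : ℕ) = u + 1) (hv : (v : ℕ) + 1 < n) {x y : ℝ}
    (hP : ((u : ℕ) : ℝ) < x ∧ x < (u : ℕ) + 1 ∧ 1 ≤ y ∧ y < n + 3)
    (hC : 1 ≤ y ∧ (x < 0 ∨ y = n + 3 ∨ n - 2 < x)) : False := by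
  have h0 : (0 : ℝ) ≤ (u : ℕ) := by positivity
  have h1 : ((u : ℕ) : ℝ) + 3 ≤ n := by exact_mod_cast (show (u : ℕ) + 3 ≤ n by omega)
  rcases hC with ⟨-, h | h | h⟩ <;> linarith

theorem spoke_closing_false {u : Fin n} (hu : (u : ℕ) + 1 < n) {x y κ b : ℝ} (hb : b ≤ n + 2)
    (hH : (x = (u : ℕ) ∧ 1 / 2 ≤ y ∧ y < b) ∨
      (0 < y ∧ y ≤ 1 / 2 ∧ x - κ = 2 * y * ((u : ℕ) - κ)))
    (hC : 1 ≤ y ∧ (x < 0 ∨ y = n + 3 ∨ n - 2 < x)) : False := by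
  obtain ⟨h0, h1⟩ := rim_cast hu
  rcases hH with h | h
  · rcases hC with ⟨-, h' | h' | h'⟩ <;> linarith
  · linarith

/-- At any height in `(0, 1/2]` the abscissa of a spoke is an affine function of its rim index with
nonzero slope `2 * y`; above that it is the index itself. -/
theorem spoke_spoke_false {u w : Fin n} (hne : u ≠ w) {x y κ b b' : ℝ}
    (h : (x = (u : ℕ) ∧ 1 / 2 ≤ y ∧ y < b) ∨
      (0 < y ∧ y ≤ 1 / 2 ∧ x - κ = 2 * y * ((u : ℕ) - κ)))
    (h' : (x = (w : ℕ) ∧ 1 / 2 ≤ y ∧ y < b') ∨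
      (0 < y ∧ y ≤ 1 / 2 ∧ x - κ = 2 * y * ((w : ℕ) - κ))) : False := by
  have hne' : ((u : ℕ) : ℝ) ≠ (w : ℕ) := fun e => hne (Fin.ext (by exact_mod_cast e))
  rcases h with ⟨h1, h2, h3⟩ | ⟨h1, h2, h3⟩ <;> rcases h' with ⟨g1, g2, g3⟩ | ⟨g1, g2, g3⟩
  · exact hne' (h1.symm.trans g1)
  · obtain rfl : y = 1 / 2 := le_antisymm g2 h2
    exact hne' (by linarith)
  · obtain rfl : y = 1 / 2 := le_antisymm h2 g2
    exact hne' (by linarith)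
  · have : 2 * y * ((u : ℕ) - (w : ℕ) : ℝ) = 0 := by linarith
    rcases mul_eq_zero.1 this with e | e
    · linarith
    · exact hne' (by linarith)

/-- Apart from their ends, rim edges stay in open vertical strips between consecutive integers at
heights at least 1, spokes stay on integer verticals or at heights at most 1/2, and the closing edge
stays outside the box of the rim. -/
theorem red_isPlanar (hn : 4 ≤ n) : D.red.IsPlanar (wheel n).Adj := by
  refine D.red_isUndirected.isPlanar pos_injective (fun u v => simpleArc_red hn)
    (fun u v w => red_vertex hn) ?_
  intro u v u' v' huv h huv' h' hne z hz hz'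
  have b1 := D.le_cast u
  have b2 := D.le_cast u'
  rcases wheel_adj_cases huv h with ⟨hu, hv⟩ | ⟨hu, hv⟩ | ⟨hu, hv⟩
  · rcases mem_path_rim hu hv hz with e | e | e
    · exact ⟨_, e⟩
    · exact ⟨_, e⟩
    rcases wheel_adj_cases huv' h' with ⟨hu', hv'⟩ | ⟨hu', hv'⟩ | ⟨hu', hv'⟩
    · rcases mem_path_rim hu' hv' hz' with e' | e' | e'
      · exact ⟨_, e'⟩
      · exact ⟨_, e'⟩
      · exfalso
        have l1 : ((u : ℕ) : ℝ) < (u' : ℕ) + 1 := by linarith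
        have l2 : ((u' : ℕ) : ℝ) < (u : ℕ) + 1 := by linarith
        have l1' : (u : ℕ) < u' + 1 := by exact_mod_cast l1
        have l2' : (u' : ℕ) < u + 1 := by exact_mod_cast l2
        exact hne ⟨Fin.ext (by omega), Fin.ext (by omega)⟩
    · rcases mem_path_spoke hu' hv' hz' with e' | e' | e'
      · exact ⟨_, e'⟩
      · exact ⟨_, e'⟩
      · exact (rim_spoke_false e e').elim
    · rcases mem_path_closing hn hu' hv' hz' with e' | e' | e'
      · exact ⟨_, e'⟩
      · exact ⟨_, e'⟩
      · exact (rim_closing_false hu hv e e').elim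
  · rcases mem_path_spoke hu hv hz with e | e | e
    · exact ⟨_, e⟩
    · exact ⟨_, e⟩
    rcases wheel_adj_cases huv' h' with ⟨hu', hv'⟩ | ⟨hu', hv'⟩ | ⟨hu', hv'⟩
    · rcases mem_path_rim hu' hv' hz' with e' | e' | e'
      · exact ⟨_, e'⟩
      · exact ⟨_, e'⟩
      · exact (rim_spoke_false e' e).elim
    · rcases mem_path_spoke hu' hv' hz' with e' | e' | e'
      · exact ⟨_, e'⟩
      · exact ⟨_, e'⟩
      · exact (spoke_spoke_false (fun e => hne ⟨e, Fin.ext (by omega)⟩) e e').elim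
    · rcases mem_path_closing hn hu' hv' hz' with e' | e' | e'
      · exact ⟨_, e'⟩
      · exact ⟨_, e'⟩
      · exact (spoke_closing_false hu b1 e e').elim
  · rcases mem_path_closing hn hu hv hz with e | e | e
    · exact ⟨_, e⟩
    · exact ⟨_, e⟩
    rcases wheel_adj_cases huv' h' with ⟨hu', hv'⟩ | ⟨hu', hv'⟩ | ⟨hu', hv'⟩
    · rcases mem_path_rim hu' hv' hz' with e' | e' | e'
      · exact ⟨_, e'⟩
      · exact ⟨_, e'⟩
      · exact (rim_closing_false hu' hv' e' e).elim
    · rcases mem_path_spoke hu' hv' hz' with e' | e' | e'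
      · exact ⟨_, e'⟩
      · exact ⟨_, e'⟩
      · exact (spoke_closing_false hu' b2 e' e).elim
    · exact absurd ⟨Fin.ext (by omega), Fin.ext (by omega)⟩ hne

theorem path_blue (u v : Fin n) : D.blue.path u v = [D.pos u, D.pos v] := rfl

/-- A matching edge is horizontal or joins the hub to a vertex of the lowest row. -/
theorem mem_path_blue {u v : Fin n} (huv : u < v) (h : M.Adj u v) {z : ℂ}
    (hz : z ∈ trace (D.blue.path u v)) :
    ((u : ℕ) + 1 < n ∧ (v : ℕ) + 1 < n ∧ D.y u = D.y v ∧ z.im = D.y u) ∨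
    ((v : ℕ) + 1 = n ∧ (u : ℕ) = D.k ∧ D.y u = 1 ∧ z.im ≤ 1 ∧ 0 ≤ z.im ∧
      z.re = D.k - 1 / 2 + z.im / 2 ∧ (1 ≤ z.im → z = D.pos u)) := by
  have huv' : (u : ℕ) < v := huv
  have hu : (u : ℕ) + 1 < n := by have := v.2; omega
  rw [path_blue, mem_trace_two] at hz
  obtain ⟨t, t0, t1, hr, hi⟩ := mem_segment_iff.1 hz
  rcases rim_or_hub v with hv | hv
  · have hy := (D.adj u v hu hv huv.ne).2 h
    rw [pos_rim hu, pos_rim hv] at hi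
    simp only [hy] at hi
    exact .inl ⟨hu, hv, hy, by rw [hy]; linarith⟩
  · obtain ⟨hk, hy⟩ := D.hub u v hv h
    rw [pos_rim hu, pos_hub hv] at hi hr
    simp only [hy, Nat.cast_one, hk] at hi hr
    refine .inr ⟨hv, hk, hy, by linarith, by linarith, by rw [hr, hi]; ring, fun h1 => ?_⟩
    obtain rfl : t = 0 := by linarith
    rw [pos_rim hu, hy, hk]
    exact Complex.ext (by simpa using hr) (by simpa using hi)

/-- A row contains no rim vertices besides a matched pair or a single vertex, and the hub's edge
reaches the lowest row only at its rim end. -/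
theorem blue_isPlanar (hM : IsMatchingGraph M) : D.blue.IsPlanar M.Adj := by
  refine D.blue_isUndirected.isPlanar pos_injective ?_ ?_ ?_
  · intro u v huv h
    rw [path_blue, simpleArc_two]
    exact fun e => huv.ne (pos_injective e)
  · intro u v w huv h hw
    have hpos : D.blue.pos w = D.pos w := rfl
    rw [hpos] at hw
    have h1 := D.one_le_cast u
    have h1' := D.one_le_cast w
    rcases mem_path_blue huv h hw with ⟨hu, hv, hy, hi⟩ | ⟨hv, hk, hy, hi, -, -, he⟩
    · rcases rim_or_hub w with hw' | hw'
      · by_cases e : u = w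
        · exact .inl e.symm
        · rw [pos_rim hw'] at hi
          simp only at hi
          have hi' : D.y u = D.y w := by exact_mod_cast hi.symm
          exact .inr (hM.eq ((D.adj u w hu hw' e).1 hi') h)
      · rw [pos_hub hw'] at hi
        simp only at hi
        linarith
    · rcases rim_or_hub w with hw' | hw'
      · exact .inl (pos_injective (he (by rw [pos_rim hw']; exact h1')))
      · exact .inr (Fin.ext (by omega))
  · intro u v u' v' huv h huv' h' hne z hz hz'
    have h1 := D.one_le_cast u
    have h1' := D.one_le_cast u'
    rcases mem_path_blue huv h hz with ⟨hu, hv, hy, hi⟩ | ⟨hv, hk, hy, hi, -, -, he⟩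
    · rcases mem_path_blue huv' h' hz' with ⟨hu', hv', hy', hi'⟩ | ⟨hv', hk', hy', hi', -, -, he'⟩
      · exfalso
        have hyy : D.y u = D.y u' := by exact_mod_cast hi.symm.trans hi'
        by_cases e : u = u'
        · subst e
          exact hne ⟨rfl, hM.eq h h'⟩
        · have ha := (D.adj u u' hu hu' e).1 hyy
          obtain rfl := hM.eq h ha
          obtain rfl := hM.eq h.symm h'
          exact huv.not_gt huv'
      · exact ⟨u', he' (by linarith)⟩
    · rcases mem_path_blue huv' h' hz' with ⟨hu', hv', hy', hi'⟩ | ⟨hv', hk', hy', hi', -, -, he'⟩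
      · exact ⟨u, he (by linarith)⟩
      · exact absurd ⟨Fin.ext (by omega), Fin.ext (by omega)⟩ hne

theorem nat_ne {a b c : ℕ} {x : ℝ} (hx : x = a) (h1 : (b : ℝ) < x) (h2 : x < c) (hbc : c ≤ b + 1) :
    False := by
  rw [hx] at h1 h2
  have h1' : b < a := by exact_mod_cast h1
  have h2' : a < c := by exact_mod_cast h2
  omega

theorem rightAngle_of_vertical {p : List ℂ} {a b c d z : ℂ} (hp : (a, b) ∈ segs p)
    (hab : a.re = b.re) (hcd : c.im = d.im) (hz : z ∈ segment ℝ a b) (hz' : z ∈ segment ℝ c d)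
    (ha : a ≠ z) (hb : b ≠ z) (hc : c ≠ z) (hd : d ≠ z) :
    PolyDrawing.RightAngleAt p [c, d] z :=
  ⟨(a, b), hp, (c, d), .head _, mem_openSegment_of_ne_left_right ha hb hz,
    mem_openSegment_of_ne_left_right hc hd hz', by simp [hab, hcd]⟩

/-- The common point has integer height at least 1. This excludes the slanted pieces of rim edges
and the lower pieces of spokes, except for vertices, and the closing edge avoids the horizontal
range between rim vertices; only vertical pieces remain. -/
theorem horizontal_rightAngle (hn : 4 ≤ n) {u v u' v' : Fin n} (huv : u < v)
    (h : (wheel n).Adj u v) (hu' : (u' : ℕ) + 1 < n) (hv' : (v' : ℕ) + 1 < n)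
    (hy : D.y u' = D.y v') {z : ℂ} (hi : z.im = D.y u') (hz : z ∈ trace (D.red.path u v))
    (hz' : z ∈ segment ℝ (D.pos u') (D.pos v')) :
    (∃ w, z = D.pos w) ∨ PolyDrawing.RightAngleAt (D.red.path u v) [D.pos u', D.pos v'] z := by
  by_cases hw : ∃ w, z = D.pos w
  · exact .inl hw
  right
  have hw' (w : Fin n) : D.pos w ≠ z := fun e => hw ⟨w, e.symm⟩
  have hc : (D.pos u').im = (D.pos v').im := by
    rw [pos_rim hu', pos_rim hv', hy]
  have h1 := D.one_le_cast u'
  have h2 := D.le_cast u'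
  obtain ⟨s, s0, s1, hr', -⟩ := mem_segment_iff.1 hz'
  obtain ⟨a0, a1⟩ := rim_cast hu'
  obtain ⟨b0, b1⟩ := rim_cast hv'
  rw [pos_rim hu', pos_rim hv'] at hr'
  simp only at hr'
  rcases wheel_adj_cases huv h with ⟨hu, hv⟩ | ⟨hu, hv⟩ | ⟨hu, hv⟩
  · have hz0 := hz
    rw [path_rim hu hv, mem_trace_four] at hz
    have hru : (u : ℕ) + 1 < n := by omega
    have hcast : ((v : ℕ) : ℝ) = (u : ℕ) + 1 := by exact_mod_cast hu
    rcases hz with hz | hz | hz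
    · exfalso
      obtain ⟨t, t0, t1, hr, hi'⟩ := mem_segment_iff.1 hz
      simp only at hr hi'
      rcases t0.eq_or_lt with rfl | t0
      · exact hw ⟨u, by rw [pos_rim hru]; exact Complex.ext (by simpa using hr) (by simpa using hi')⟩
      · exact nat_ne (b := D.y u) (c := D.y u + 1) hi (by linarith) (by push_cast; linarith) le_rfl
    · refine rightAngle_of_vertical ?_ ?_ hc hz hz' ?_ ?_ (hw' u') (hw' v')
      · rw [path_rim hu hv]; exact .tail _ (.head _)
      · rfl
      · intro e
        have := congrArg Complex.im e
        rw [hi] at this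
        simp only at this
        exact nat_ne (a := D.y u') (b := D.y u) (c := D.y u + 1) rfl (by linarith)
          (by push_cast; linarith) le_rfl
      · intro e
        have := congrArg Complex.im e
        rw [hi] at this
        simp only at this
        exact nat_ne (a := D.y u') (b := D.y v) (c := D.y v + 1) rfl (by linarith)
          (by push_cast; linarith) le_rfl
    · exfalso
      obtain ⟨t, t0, t1, hr, hi'⟩ := mem_segment_iff.1 hz
      simp only at hr hi'
      rcases t1.eq_or_lt with rfl | t1
      · refine hw ⟨v, ?_⟩
        rw [pos_rim hv, hcast]
        exact Complex.ext (by simp only [hr]; ring) (by simp only [hi']; ring)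
      · exact nat_ne (b := D.y v) (c := D.y v + 1) hi (by linarith) (by push_cast; linarith) le_rfl
  · rw [path_spoke hu hv, mem_trace_three] at hz
    rcases hz with hz | hz
    · refine rightAngle_of_vertical ?_ ?_ hc hz hz' ?_ ?_ (hw' u') (hw' v')
      · rw [path_spoke hu hv]; exact .head _
      · rfl
      · rw [← pos_rim hu]; exact hw' u
      · intro e
        have := congrArg Complex.im e
        rw [hi] at this
        simp only at this
        linarith
    · exfalso
      obtain ⟨t, t0, t1, hr, hi'⟩ := mem_segment_iff.1 hz
      simp only at hr hi'
      linarith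
  · exfalso
    rcases mem_path_closing hn hu hv hz with e | e | ⟨-, e | e | e⟩
    · exact hw ⟨_, e⟩
    · exact hw ⟨_, e⟩
    · nlinarith
    · linarith
    · nlinarith

theorem hub_edge_vertex (hn : 4 ≤ n) {u v u' : Fin n} (huv : u < v) (h : (wheel n).Adj u v)
    {z : ℂ} (hr : z.re = D.k - 1 / 2 + z.im / 2)
    (he : 1 ≤ z.im → z = D.pos u') (hz : z ∈ trace (D.red.path u v)) :
    ∃ w, z = D.pos w := by
  rcases wheel_adj_cases huv h with ⟨hu, hv⟩ | ⟨hu, hv⟩ | ⟨hu, hv⟩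
  · rcases mem_path_rim hu hv hz with e | e | e
    · exact ⟨_, e⟩
    · exact ⟨_, e⟩
    · exact ⟨_, he e.2.2.1⟩
  · rcases mem_path_spoke hu hv hz with e | e | ⟨e1, e2, e3⟩ | ⟨e1, e2, e3⟩
    · exact ⟨_, e⟩
    · exact ⟨_, e⟩
    · refine ⟨u', he ?_⟩
      -- On the hub's edge at heights in `[1/2, 1)` the abscissa lies in `[k - 1/4, k)`, which
      -- contains no integer, whereas upper spoke pieces have integer abscissas.
      by_contra! hlt
      have l1 : ((u : ℕ) : ℝ) < D.k := by linarith
      have l2 : (D.k : ℝ) < (u : ℕ) + 1 := by linarith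
      have l1' : (u : ℕ) < D.k := by exact_mod_cast l1
      have l2' : D.k < (u : ℕ) + 1 := by exact_mod_cast l2
      omega
    · exfalso
      -- Both lines pass through the hub, so a common point at positive height means equal slopes,
      -- that is, `4u + 1 = 4k`, which fails modulo 4.
      have : z.im * (4 * ((u : ℕ) : ℝ) - 4 * D.k + 1) = 0 := by linarith
      rcases mul_eq_zero.1 this with e | e
      · linarith
      · have : ((4 * (u : ℕ) + 1 : ℕ) : ℝ) = ((4 * D.k : ℕ) : ℝ) := by push_cast; linarith
        have := Nat.cast_injective this
        omega
  · rcases mem_path_closing hn hu hv hz with e | e | e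
    · exact ⟨_, e⟩
    · exact ⟨_, e⟩
    · exact ⟨_, he e.1⟩

variable (D)

theorem isSRE (hn : 4 ≤ n) (hM : IsMatchingGraph M) : IsSRE (wheel n) M D.red D.blue where
  same_pos := rfl
  red_symm := D.red_isUndirected.1
  blue_symm := D.blue_isUndirected.1
  red_planar := red_isPlanar hn
  blue_planar := blue_isPlanar hM
  right_angles := fun u v u' v' huv huv' z hz hz' => by
    refine PolyDrawing.rightAngles_of_lt D.red_isUndirected D.blue_isUndirected ?_ huv huv' hz hz'
    intro u v u' v' huv h huv' h' z hz hz'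
    rcases mem_path_blue huv' h' hz' with ⟨hu', hv', hy', hi'⟩ | ⟨hv', hk', -, hi', h0, hr, he'⟩
    · rw [path_blue, mem_trace_two] at hz'
      exact horizontal_rightAngle hn huv h hu' hv' hy' hi' hz hz'
    · exact .inl (hub_edge_vertex hn huv h hr he' hz)

end Rows
end SimVis

theorem mainTheorem6 (n : ℕ) (hn : 4 ≤ n) (M : SimpleGraph (Fin n))
    (hM : SimVis.IsMatchingGraph M) :
    (∃ Gr Gb : SimVis.PlaneStGraph (Fin n),
      Gr.skeleton = SimVis.wheel n ∧
      (Gb.skeleton = M ∨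
        ((∀ v : Fin n, (∀ w, ¬ M.Adj v w) ↔ (v : ℕ) + 1 = n) ∧
          ∃ h w : Fin n, (h : ℕ) + 1 = n ∧ h ≠ w ∧ Gb.skeleton = M ⊔ SimpleGraph.edge h w)) ∧
      SimVis.AdmitsTransversal Gr Gb (fun _ => SimVis.Rotation.lowerLeft) ∧
      SimVis.AdmitsLSVR Gr Gb (fun _ => SimVis.Rotation.lowerLeft)) ∧
    (∃ R B : SimVis.PolyDrawing (Fin n),
      SimVis.IsSRE (SimVis.wheel n) M R B ∧
      (∀ u v, (SimVis.wheel n).Adj u v → (R.bends u v).length ≤ 2) ∧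
      (∀ u v, M.Adj u v → B.bends u v = [])) := by
  obtain ⟨D⟩ := SimVis.exists_rows (by omega) hM
  exact ⟨SimVis.exists_wheel_matching n hn M hM, D.red, D.blue, D.isSRE hn hM,
    fun u v _ => D.red_isUndirected.2 u v, fun _ _ _ => rfl⟩
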